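/- Let $\gamma$ be the Euler–Mascheroni constant and $D=4-2\varepsilon$. Consider the normalized three-loop vacuum banana integral with four propagators of unit mass and all indices equal to $1$, $$I(\varepsilon)=e^{3\varepsilon\gamma}\int[\mathrm dk_1][\mathrm dk_2][\mathrm dk_3]\,\frac{1}{D_1D_2D_3D_4},\qquad [\mathrm dk]=\frac{\mathrm d^Dk}{i\pi^{D/2}},\quad D_i=-k_i^2+1\ (i\le 3),\quad D_4=-(-k_1+k_2+k_3)^2+1,$$ in dimensional regularization. That is: after Wick rotation, for $\tfrac23<\operatorname{Re}\varepsilon<1$ it is the absolutely convergent integral obtained by writing the volume elements of the Euclidean momenta in adapted orthonormal coordinates $k_1=r_1e_1$, $k_2=s_1e_1+r_2e_2$, $k_3=s_2e_1+s_3e_2+r_3e_3$, $$\prod_{i=1}^3\frac{\mathrm d^Dk_i}{\pi^{D/2}}=\prod_{j=0}^{2}\frac{\Omega_{D-j}\,r_{j+1}^{D-j-1}\,\mathrm dr_{j+1}}{\pi^{D/2}}\;\mathrm ds_1\,\mathrm ds_2\,\mathrm ds_3,\qquad \Omega_d=\frac{2\pi^{d/2}}{\Gamma(d/2)},\quad r_j>0,\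 s_j\in\mathbb R,$$ and it has a unique meromorphic continuation $I$ to all $\varepsilon\in\mathbb C$. With $(a)_n=a(a+1)\cdots(a+n-1)$, for every $\varepsilon\in\mathbb C$ with $\operatorname{Re}\varepsilon<1$ such that none of $2\varepsilon-1$, $3\varepsilon-2$, $2\varepsilon-\tfrac12$ is a non-positive integer, the three double series below converge absolutely and $$\begin{aligned} I(\varepsilon)={}&\frac{\sqrt{\pi}\,e^{3\gamma\varepsilon}\,\Gamma(-1+\varepsilon)^2\,\Gamma(\varepsilon)}{2\,\Gamma(\frac32)}\sum_{m,n\ge0}\frac{(2-\varepsilon)_{m+n}(1)_{m+n}(\varepsilon)_{m+n}}{(2-\varepsilon)_n(\frac32)_{m+n}(2-\varepsilon)_m}\,\frac{1}{m!\,n!}\Big(\frac14\Big)^{m+n}\\ &+\frac{\sqrt{\pi}\,e^{3\gamma\varepsilon}\,\Gamma(\varepsilon)\Gamma(-1+2\varepsilon)\Gamma(1-\varepsilon)\Gamma(-1+\varepsilon)}{\Gamma(2-\varepsilon)\Gamma(\frac12+\varepsilon)}\Big(\frac14\Big)^{-1+\varepsilon}\sum_{m,n\ge0}\frac{(1)_{m+n}(\varepsilon)_{m+n}(-1+2\varepsilon)_{m+n}}{(\varepsilon)_n(\frac12+\varepsilon)_{m+n}(2-\varepsilon)_m}\,\frac{1}{m!\,n!}\Big(\frac14\Big)^{m+n}\\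 &+\frac{\sqrt{\pi}\,e^{3\gamma\varepsilon}\,\Gamma(\varepsilon)\Gamma(-1+2\varepsilon)\Gamma(-2+3\varepsilon)\Gamma(1-\varepsilon)^2}{2\,\Gamma(2-\varepsilon)\Gamma(-\frac12+2\varepsilon)}\Big(\frac14\Big)^{-2+2\varepsilon}\sum_{m,n\ge0}\frac{(\varepsilon)_{m+n}(-1+2\varepsilon)_{m+n}(-2+3\varepsilon)_{m+n}}{(\varepsilon)_n(-\frac12+2\varepsilon)_{m+n}(\varepsilon)_m}\,\frac{1}{m!\,n!}\Big(\frac14\Big)^{m+n}. \end{aligned}$$ -/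

import Mathlib

open scoped BigOperators

noncomputable section

namespace Banana

/-- The area `2 π^{d/2} / Γ(d/2)` of the unit sphere of `d`-dimensional Euclidean space, for
complex `d`. -/
def sphereArea (d : ℂ) : ℂ :=
  2 * (Real.pi : ℂ) ^ (d / 2) / Complex.Gamma (d / 2)

/-- Three vectors in adapted orthonormal coordinates: the first points along `e₀`, the second
lies in the span of `e₀, e₁`, the third in the span of `e₀, e₁, e₂`; the radii `r` are the lengths
of the components transverse to the preceding vectors. -/
def frame (r s : Fin 3 → ℝ) : Fin 3 → EuclideanSpace ℝ (Fin 3) :=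
  ![!₂[r 0, 0, 0], !₂[s 0, r 1, 0], !₂[s 1, s 2, r 2]]

/-- The range of the adapted coordinates: positive radii, arbitrary parallel components. -/
def frameDomain : Set ((Fin 3 → ℝ) × (Fin 3 → ℝ)) :=
  {p | ∀ i, 0 < p.1 i}

/-- A rotation-invariant function of three Euclidean loop momenta, times the `D`-dimensional
volume density in adapted coordinates: the component of the `j`-th momentum (`j = 0, 1, 2`)
transverse to the preceding ones lives in a space of dimension `D - j`, whose volume element is
`sphereArea (D - j) * r ^ (D - j - 1) dr` after integrating over directions. Each momentum comes
with the normalisation `1 / π^{D/2}`. -/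
def dimRegIntegrand (D : ℂ) (f : (Fin 3 → EuclideanSpace ℝ (Fin 3)) → ℂ)
    (p : (Fin 3 → ℝ) × (Fin 3 → ℝ)) : ℂ :=
  (∏ j : Fin 3, sphereArea (D - (j : ℕ)) * (p.1 j : ℂ) ^ (D - (j : ℕ) - 1) /
      (Real.pi : ℂ) ^ (D / 2)) * f (frame p.1 p.2)

/-- The `D`-dimensional integral `∫ ∏ᵢ d^D kᵢ / π^{D/2} f(k₁, k₂, k₃)` of a rotation-invariant
function of three Euclidean momenta, for complex `D`. -/
def dimRegIntegral (D : ℂ) (f : (Fin 3 → EuclideanSpace ℝ (Fin 3)) → ℂ) : ℂ :=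
  ∫ p in frameDomain, dimRegIntegrand D f p

/-- The product of the four (Wick rotated) unit-mass propagators `1 / (k² + 1)` with momenta
`k₁, k₂, k₃, -k₁ + k₂ + k₃`. -/
def propagators (k : Fin 3 → EuclideanSpace ℝ (Fin 3)) : ℂ :=
  ((1 / ((‖k 0‖ ^ 2 + 1) * (‖k 1‖ ^ 2 + 1) * (‖k 2‖ ^ 2 + 1) *
    (‖-k 0 + k 1 + k 2‖ ^ 2 + 1)) : ℝ) : ℂ)

/-- The normalised momentum integral `e^{3 ε γ} ∫ [dk₁][dk₂][dk₃] 1 / (D₁ D₂ D₃ D₄)` in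
`D = 4 - 2 ε` dimensions. -/
def momentumIntegral (ε : ℂ) : ℂ :=
  Complex.exp (3 * ε * (Real.eulerMascheroniConstant : ℂ)) *
    dimRegIntegral (4 - 2 * ε) propagators

/-- `I` is the dimensionally regularised integral: the meromorphic function of `ε ∈ ℂ` (in normal
form, i.e. without removable singularities and with value `0` at its poles) that is given by the
momentum integral in its strip of absolute convergence. -/
def IsDimRegIntegral (I : ℂ → ℂ) : Prop :=
  MeromorphicNFOn I Set.univ ∧
    ∀ ε : ℂ, 2 / 3 < ε.re → ε.re < 1 → I ε = momentumIntegral ε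

/-- The Pochhammer symbol `(a)_n = a (a + 1) ⋯ (a + n - 1)`. -/
def poch (a : ℂ) (n : ℕ) : ℂ := (ascPochhammer ℂ n).eval a

/-- The term `(a)_{m+n} (b)_{m+n} (c)_{m+n} / ((d)_n (e)_{m+n} (f)_m) / (m! n!) (1/4)^{m+n}`. -/
def term (a b c d e f : ℂ) (m n : ℕ) : ℂ :=
  poch a (m + n) * poch b (m + n) * poch c (m + n) /
      (poch d n * poch e (m + n) * poch f m) *
    (1 / ((m.factorial : ℂ) * (n.factorial : ℂ))) * (1 / 4) ^ (m + n)

end Banana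

end

open scoped BigOperators

noncomputable section

namespace Banana

/-! ### Bounds for Pochhammer symbols and reciprocal Gamma values -/

/-! Put `a = D/2 = 2 - ε` and `ν = a - 1 = 1 - ε`; the strip of absolute convergence is `0 < Re ν <
1/3`. In position space the banana is a product of four propagators. Schwinger parameters and
Gaussian momentum integration turn it into `∫ U^(-a) e^(-∑ αᵢ) dα`, with `U` the third elementary
symmetric polynomial (`lintegral_radialWeight_mul_propagatorProd`). Since `U / ∏ αᵢ = ∑ 1/αᵢ`,
`Γ(a)` times this is the one-dimensional moment `∫ t^ν besselK(-ν, t)^4 dt`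
(`Gamma_mul_lintegral_symanzik`).

Two of the four Bessel factors are rewritten by the connection formula `besselK_eq`, `K = const ·
(I_{-ν} - I_ν)` up to powers of `t`. Squaring gives three products `I · I · K²`, hence the three
double series: the power series of the two `I` supply the indices `m, n`, and the Mellin transform
of `K²` is a quotient of Gamma functions (`lintegral_besselK_sq`). For real `ε` everything is
positive, so Tonelli justifies each interchange, and the convergence of the series proves the
finiteness of the integrals (`lintegral_besselK_pow_four`).

The argument `(1/4, 1/4)` lies on the boundary of the convergence region. Vandermonde's identity on
the diagonals `m + n = N`, with `C(2N, N) ≤ 4^N (N+1)^(-1/2)`, leaves `∑ (N+1)^(x - 1/2)`, where `x`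
is the parameter excess. It equals `2 Re ε - 5/2` in all three series, and this is where `Re ε < 1`
enters. The bounds are locally uniform once the Pochhammer denominators become reciprocal Gamma
functions, so the sums are holomorphic on `Re ε < 1` and poles can only come from Gamma prefactors
(`differentiableOn_tsum_rterm`).

Finally, the momentum and Schwinger integrals are complex moment generating functions, hence
analytic. The identities on the real segment `(2/3, 1)` spread to the strip; the Schwinger integral,
analytic on `Re ε > 2/3`, and the series, meromorphic on `Re ε < 1`, glue to a meromorphic function
on `ℂ`, unique by the identity theorem. -/

lemma poch_zero (a : ℂ) : poch a 0 = 1 := by simp [poch]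

lemma poch_succ (a : ℂ) (n : ℕ) : poch a (n + 1) = poch a n * (a + n) :=
  ascPochhammer_succ_eval n a

lemma differentiable_poch (n : ℕ) : Differentiable ℂ fun a => poch a n :=
  (ascPochhammer ℂ n).differentiable

lemma Gamma_mul_poch {a : ℂ} (ha : ∀ k : ℕ, a ≠ -k) (n : ℕ) :
    Complex.Gamma a * poch a n = Complex.Gamma (a + n) := by
  induction n with
  | zero => simp [poch_zero]
  | succ n ih =>
    have h : a + n ≠ 0 := fun h => ha n (eq_neg_of_add_eq_zero_left h)
    rw [poch_succ, ← mul_assoc, ih, mul_comm, ← Complex.Gamma_add_one _ h]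
    push_cast; ring_nf

lemma inv_Gamma_eq_poch_mul (z : ℂ) (k : ℕ) :
    (Complex.Gamma z)⁻¹ = poch z k * (Complex.Gamma (z + k))⁻¹ := by
  induction k with
  | zero => simp [poch_zero]
  | succ k ih =>
    rw [ih, poch_succ, mul_assoc, Complex.one_div_Gamma_eq_self_mul_one_div_Gamma_add_one (z + k)]
    push_cast; ring_nf

lemma norm_one_add_le_exp (w : ℂ) : ‖1 + w‖ ≤ Real.exp (w.re + ‖w‖ ^ 2 / 2) := by
  have h : ‖1 + w‖ ^ 2 ≤ Real.exp (w.re + ‖w‖ ^ 2 / 2) ^ 2 := by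
    have h1 : ‖1 + w‖ ^ 2 = (2 * w.re + ‖w‖ ^ 2) + 1 := by
      rw [← Complex.normSq_eq_norm_sq, ← Complex.normSq_eq_norm_sq, Complex.normSq_apply,
        Complex.normSq_apply]
      simp; ring
    rw [h1, ← Real.exp_nat_mul]
    refine (Real.add_one_le_exp _).trans (le_of_eq ?_)
    congr 1; push_cast; ring
  exact (pow_le_pow_iff_left₀ (norm_nonneg _) (Real.exp_pos _).le two_ne_zero).1 h

/-- Write `1/(1+w) = 1 + (-w + v)` with `v = w²/(1+w)`. As `|1+w| ≥ 1`, both `|v| ≤ |w|²` and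
`|-w+v| = |w/(1+w)| ≤ |w|` hold. The bound for `1 + u` at `u = -w + v` then costs `|w|²` and
`|w|²/2`, whence `3/2`. -/
lemma norm_inv_one_add_le_exp {w : ℂ} (hw : 0 ≤ w.re) :
    ‖(1 + w)⁻¹‖ ≤ Real.exp (-w.re + 3 / 2 * ‖w‖ ^ 2) := by
  have h1 : 1 ≤ ‖1 + w‖ := by
    calc (1 : ℝ) ≤ (1 + w).re := by simpa
      _ ≤ ‖1 + w‖ := Complex.re_le_norm _
  have h0 : 1 + w ≠ 0 := fun h => by simp [h] at h1; linarith
  have hinv : ‖(1 + w)⁻¹‖ ≤ 1 := by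
    rw [norm_inv]; exact inv_le_one_of_one_le₀ h1
  set v := w ^ 2 * (1 + w)⁻¹ with hv
  have hvn : ‖v‖ ≤ ‖w‖ ^ 2 := by
    rw [hv, norm_mul, norm_pow]
    exact mul_le_of_le_one_right (by positivity) hinv
  have hu : (1 + w)⁻¹ = 1 + (-w + v) := by rw [hv]; field_simp; ring
  have hu2 : -w + v = -(w * (1 + w)⁻¹) := by rw [hv]; field_simp; ring
  have hun : ‖-w + v‖ ≤ ‖w‖ := by
    rw [hu2, norm_neg, norm_mul]
    exact mul_le_of_le_one_right (norm_nonneg _) hinv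
  rw [hu]
  refine (norm_one_add_le_exp _).trans (Real.exp_le_exp.2 ?_)
  have h2 : v.re ≤ ‖v‖ := Complex.re_le_norm v
  have h3 : ‖-w + v‖ ^ 2 ≤ ‖w‖ ^ 2 := by gcongr
  simp only [Complex.add_re, Complex.neg_re]
  linarith

/-- The sum `∑_{k < n} 1 / (k + 1)^2`. -/
def invSqSum (n : ℕ) : ℝ := ∑ k ∈ Finset.range n, 1 / ((k : ℝ) + 1) ^ 2

lemma invSqSum_le (n : ℕ) : invSqSum n ≤ 2 := by
  -- The sharper bound `2 - 1/(n+1)` is what an induction can carry, by telescoping.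
  have h : ∀ n : ℕ, invSqSum (n + 1) ≤ 2 - 1 / ((n : ℝ) + 1) := by
    intro n
    induction n with
    | zero => norm_num [invSqSum]
    | succ n ih =>
      rw [invSqSum, Finset.sum_range_succ, ← invSqSum]
      have e : 1 / ((n : ℝ) + 1) - 1 / ((n : ℝ) + 1 + 1) - 1 / ((n : ℝ) + 1 + 1) ^ 2 =
          1 / (((n : ℝ) + 1) * ((n : ℝ) + 1 + 1) ^ 2) := by field_simp; ring
      have h2 : 0 ≤ 1 / (((n : ℝ) + 1) * ((n : ℝ) + 1 + 1) ^ 2) := by positivity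
      push_cast
      linarith
  cases n with
  | zero => simp [invSqSum]
  | succ n =>
    have : 0 ≤ 1 / ((n : ℝ) + 1) := by positivity
    linarith [h n]

/-- Each factor is `a + k = (k+1)(1 + w)` with `w = (a-1)/(k+1)`. The real parts of the `w` add up
to a harmonic number, which produces the power of `n`; the quadratic errors stay bounded. -/
lemma norm_poch_le_exp (a : ℂ) (n : ℕ) :
    ‖poch a n‖ ≤ n.factorial * Real.exp ((a.re - 1) * harmonic n + ‖a - 1‖ ^ 2 / 2 * invSqSum n) := by
  induction n with
  | zero => simp [poch_zero, invSqSum]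
  | succ n ih =>
    have hn : (0 : ℝ) < (n : ℝ) + 1 := by positivity
    have hnc : ((n : ℂ) + 1) ≠ 0 := by exact_mod_cast hn.ne'
    set w : ℂ := (a - 1) / ((n : ℂ) + 1) with hw
    have e1 : a + n = ((n : ℂ) + 1) * (1 + w) := by rw [hw]; field_simp; ring
    have e2 : w.re = (a.re - 1) / ((n : ℝ) + 1) := by
      have : w = (a - 1) / (((n : ℝ) + 1 : ℝ) : ℂ) := by rw [hw]; push_cast; rfl
      rw [this, Complex.div_ofReal_re]; simp
    have e0 : ‖(n : ℂ) + 1‖ = (n : ℝ) + 1 := by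
      rw [← Nat.cast_succ, Complex.norm_natCast]; push_cast; rfl
    have e3 : ‖w‖ ^ 2 = ‖a - 1‖ ^ 2 * (1 / ((n : ℝ) + 1) ^ 2) := by
      rw [hw, norm_div, e0]; field_simp
    rw [poch_succ, norm_mul, e1, norm_mul, e0]
    calc ‖poch a n‖ * (((n : ℝ) + 1) * ‖1 + w‖)
        ≤ (n.factorial * Real.exp ((a.re - 1) * harmonic n + ‖a - 1‖ ^ 2 / 2 * invSqSum n)) *
          (((n : ℝ) + 1) * Real.exp (w.re + ‖w‖ ^ 2 / 2)) := by
          gcongr; exact norm_one_add_le_exp w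
      _ = _ := by
          rw [Nat.factorial_succ, harmonic_succ, invSqSum, invSqSum, Finset.sum_range_succ, e2, e3]
          push_cast
          rw [show ∀ A B C D : ℝ, A * B * (C * D) = C * A * (B * D) by intros; ring, ← Real.exp_add]
          congr 2
          field_simp
          ring

lemma norm_inv_poch_le_exp {a : ℂ} (ha : 1 ≤ a.re) (n : ℕ) :
    ‖(poch a n)⁻¹‖ ≤ (n.factorial : ℝ)⁻¹ *
      Real.exp (-(a.re - 1) * harmonic n + 3 / 2 * ‖a - 1‖ ^ 2 * invSqSum n) := by
  induction n with
  | zero => simp [poch_zero, invSqSum]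
  | succ n ih =>
    have hn : (0 : ℝ) < (n : ℝ) + 1 := by positivity
    have hnc : ((n : ℂ) + 1) ≠ 0 := by exact_mod_cast hn.ne'
    set w : ℂ := (a - 1) / ((n : ℂ) + 1) with hw
    have e1 : a + n = ((n : ℂ) + 1) * (1 + w) := by rw [hw]; field_simp; ring
    have e2 : w.re = (a.re - 1) / ((n : ℝ) + 1) := by
      have : w = (a - 1) / (((n : ℝ) + 1 : ℝ) : ℂ) := by rw [hw]; push_cast; rfl
      rw [this, Complex.div_ofReal_re]; simp
    have e0 : ‖(n : ℂ) + 1‖ = (n : ℝ) + 1 := by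
      rw [← Nat.cast_succ, Complex.norm_natCast]; push_cast; rfl
    have e3 : ‖w‖ ^ 2 = ‖a - 1‖ ^ 2 * (1 / ((n : ℝ) + 1) ^ 2) := by
      rw [hw, norm_div, e0]; field_simp
    have hwre : 0 ≤ w.re := by rw [e2]; exact div_nonneg (by linarith) hn.le
    rw [poch_succ, mul_inv, norm_mul, e1, mul_inv, norm_mul, norm_inv ((n : ℂ) + 1), e0]
    calc ‖(poch a n)⁻¹‖ * (((n : ℝ) + 1)⁻¹ * ‖(1 + w)⁻¹‖)
        ≤ ((n.factorial : ℝ)⁻¹ *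
          Real.exp (-(a.re - 1) * harmonic n + 3 / 2 * ‖a - 1‖ ^ 2 * invSqSum n)) *
          (((n : ℝ) + 1)⁻¹ * Real.exp (-w.re + 3 / 2 * ‖w‖ ^ 2)) := by
          gcongr; exact norm_inv_one_add_le_exp hwre
      _ = _ := by
          rw [Nat.factorial_succ, harmonic_succ, invSqSum, invSqSum, Finset.sum_range_succ, e2, e3]
          push_cast
          rw [show ∀ A B C D : ℝ, A * B * (C * D) = C * A * (B * D) by intros; ring, ← Real.exp_add,
            mul_inv]
          congr 2
          field_simp
          ring

lemma abs_harmonic_sub_log_le (n : ℕ) : |(harmonic n : ℝ) - Real.log (n + 1)| ≤ 1 := by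
  have h1 := log_add_one_le_harmonic n
  have h2 := harmonic_le_one_add_log n
  have h3 : Real.log n ≤ Real.log (n + 1) := by
    rcases n.eq_zero_or_pos with rfl | hn
    · simp
    · exact Real.log_le_log (by exact_mod_cast hn) (by linarith)
  push_cast at h1
  rw [abs_le]; constructor <;> linarith

lemma exp_mul_harmonic_le (x : ℝ) (n : ℕ) :
    Real.exp (x * harmonic n) ≤ Real.exp |x| * ((n : ℝ) + 1) ^ x := by
  have hn : (0 : ℝ) < (n : ℝ) + 1 := by positivity
  rw [Real.rpow_def_of_pos hn, ← Real.exp_add]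
  apply Real.exp_le_exp.2
  have h := abs_harmonic_sub_log_le n
  have : x * ((harmonic n : ℝ) - Real.log (n + 1)) ≤ |x| * 1 :=
    (le_abs_self _).trans (by rw [abs_mul]; gcongr)
  linarith

/-- The constant depends only on the radius of the disc of parameters; this uniformity later yields
locally uniform convergence in `ε`. -/
lemma exists_norm_poch_le (R : ℝ) : ∃ C : ℝ, 0 < C ∧ ∀ a : ℂ, ‖a‖ ≤ R → ∀ n : ℕ,
    ‖poch a n‖ ≤ C * (n.factorial * ((n : ℝ) + 1) ^ (a.re - 1)) := by
  refine ⟨Real.exp (R + 1) * Real.exp ((R + 1) ^ 2), by positivity, fun a ha n => ?_⟩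
  refine (norm_poch_le_exp a n).trans ?_
  have hb : ‖a - 1‖ ≤ R + 1 := (norm_sub_le _ _).trans (by simpa using ha)
  have hre : |a.re - 1| ≤ R + 1 := by
    have := Complex.abs_re_le_norm (a - 1)
    simp at this; exact this.trans hb
  have h2 : ‖a - 1‖ ^ 2 / 2 * invSqSum n ≤ (R + 1) ^ 2 := by
    have h3 : ‖a - 1‖ ^ 2 ≤ (R + 1) ^ 2 := by gcongr
    have h4 := invSqSum_le n
    nlinarith [sq_nonneg ‖a - 1‖]
  rw [Real.exp_add]
  calc _ ≤ (n.factorial : ℝ) * ((Real.exp |a.re - 1| * ((n : ℝ) + 1) ^ (a.re - 1)) *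
        Real.exp ((R + 1) ^ 2)) := by
        gcongr; exact exp_mul_harmonic_le _ _
    _ ≤ (n.factorial : ℝ) * ((Real.exp (R + 1) * ((n : ℝ) + 1) ^ (a.re - 1)) *
        Real.exp ((R + 1) ^ 2)) := by gcongr
    _ = _ := by ring

lemma exists_norm_inv_poch_le (R : ℝ) : ∃ C : ℝ, 0 < C ∧ ∀ a : ℂ, ‖a‖ ≤ R → 1 ≤ a.re → ∀ n : ℕ,
    ‖(poch a n)⁻¹‖ ≤ C * ((n.factorial : ℝ)⁻¹ * ((n : ℝ) + 1) ^ (1 - a.re)) := by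
  refine ⟨Real.exp (R + 1) * Real.exp (3 * (R + 1) ^ 2), by positivity, fun a ha h1 n => ?_⟩
  refine (norm_inv_poch_le_exp h1 n).trans ?_
  have hb : ‖a - 1‖ ≤ R + 1 := (norm_sub_le _ _).trans (by simpa using ha)
  have hre : |1 - a.re| ≤ R + 1 := by
    have := Complex.abs_re_le_norm (a - 1)
    simp at this; rw [abs_sub_comm]; exact this.trans hb
  have h2 : 3 / 2 * ‖a - 1‖ ^ 2 * invSqSum n ≤ 3 * (R + 1) ^ 2 := by
    have h3 : ‖a - 1‖ ^ 2 ≤ (R + 1) ^ 2 := by gcongr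
    have h4 := invSqSum_le n
    nlinarith [sq_nonneg ‖a - 1‖]
  rw [Real.exp_add, neg_sub]
  calc _ ≤ (n.factorial : ℝ)⁻¹ * ((Real.exp |1 - a.re| * ((n : ℝ) + 1) ^ (1 - a.re)) *
        Real.exp (3 * (R + 1) ^ 2)) := by
        gcongr; exact exp_mul_harmonic_le _ _
    _ ≤ (n.factorial : ℝ)⁻¹ * ((Real.exp (R + 1) * ((n : ℝ) + 1) ^ (1 - a.re)) *
        Real.exp (3 * (R + 1) ^ 2)) := by gcongr
    _ = _ := by ring

lemma norm_poch_le_pow (z : ℂ) (k : ℕ) : ‖poch z k‖ ≤ (‖z‖ + k) ^ k := by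
  induction k with
  | zero => simp [poch_zero]
  | succ k ih =>
    rw [poch_succ, norm_mul, pow_succ]
    have h : ‖z + k‖ ≤ ‖z‖ + (k + 1 : ℕ) := by
      refine (norm_add_le _ _).trans ?_
      rw [Complex.norm_natCast]; push_cast; linarith
    have h' : (‖z‖ + k) ^ k ≤ (‖z‖ + (k + 1 : ℕ)) ^ k := by gcongr; omega
    exact mul_le_mul (ih.trans h') h (norm_nonneg _) (by positivity)

/-- Unlike `1 / poch a n`, this needs no distance from the poles. Shifting by `k ≥ R + 1` brings `a
+ k` into `Re ≥ 1`, where `1/Γ(a+k+n)` factors through `poch (a + k) n`; the shift costs `poch (a +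
n) k`, of order `(n+1)^k`, which the improved exponent `1 - Re a - k` compensates. -/
lemma exists_norm_inv_Gamma_le (R : ℝ) : ∃ C : ℝ, 0 < C ∧ ∀ a : ℂ, ‖a‖ ≤ R → ∀ n : ℕ,
    ‖(Complex.Gamma (a + n))⁻¹‖ ≤ C * ((n.factorial : ℝ)⁻¹ * ((n : ℝ) + 1) ^ (1 - a.re)) := by
  rcases lt_or_ge R 0 with hR | hR
  · exact ⟨1, one_pos, fun a ha => absurd (norm_nonneg a) (by linarith)⟩
  obtain ⟨k, hk⟩ := exists_nat_ge (R + 1)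
  obtain ⟨C, hC, hinv⟩ := exists_norm_inv_poch_le (R + k)
  obtain ⟨B, hB⟩ := (isCompact_closedBall (0 : ℂ) (R + k)).exists_bound_of_continuousOn
    Complex.differentiable_one_div_Gamma.continuous.continuousOn
  have hB0 : 0 ≤ B := (norm_nonneg _).trans (hB 0 (by simp; positivity))
  refine ⟨(R + 1 + k) ^ k * (C * (B + 1)), by positivity, fun a ha n => ?_⟩
  have hak : ‖a + k‖ ≤ R + k := (norm_add_le _ _).trans (by simpa using ha)
  have hre : 1 ≤ (a + k).re := by
    have := Complex.abs_re_le_norm a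
    simp; linarith [neg_abs_le a.re]
  have hpole : ∀ j : ℕ, a + k ≠ -j := fun j h => by
    rw [h] at hre; simp at hre
    have : (0 : ℝ) ≤ j := j.cast_nonneg
    linarith
  have e : (Complex.Gamma (a + n))⁻¹ =
      poch (a + n) k * ((poch (a + k) n)⁻¹ * (Complex.Gamma (a + k))⁻¹) := by
    rw [inv_Gamma_eq_poch_mul (a + n) k, ← mul_inv, mul_comm (poch (a + k) n),
      Gamma_mul_poch hpole]
    ring_nf
  have hn : (0 : ℝ) < (n : ℝ) + 1 := by positivity
  have h1 : ‖poch (a + n) k‖ ≤ (R + 1 + k) ^ k * ((n : ℝ) + 1) ^ k := by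
    refine (norm_poch_le_pow _ _).trans ?_
    rw [← mul_pow]
    have : ‖a + n‖ ≤ R + n := (norm_add_le _ _).trans (by simpa using ha)
    gcongr
    have : 0 ≤ (R + k) * n := by positivity
    nlinarith
  have h2 := hinv _ hak hre n
  have h3 : ‖(Complex.Gamma (a + k))⁻¹‖ ≤ B + 1 := (hB _ (by simpa using hak)).trans (by linarith)
  rw [e, norm_mul, norm_mul]
  calc _ ≤ ((R + 1 + k) ^ k * ((n : ℝ) + 1) ^ k) *
        ((C * ((n.factorial : ℝ)⁻¹ * ((n : ℝ) + 1) ^ (1 - (a + k).re))) * (B + 1)) := by gcongr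
    _ = (R + 1 + k) ^ k * (C * (B + 1)) * ((n.factorial : ℝ)⁻¹ *
        (((n : ℝ) + 1) ^ (k : ℝ) * ((n : ℝ) + 1) ^ (1 - (a + k).re))) := by
        rw [Real.rpow_natCast]; ring
    _ = _ := by
        rw [← Real.rpow_add hn]
        congr 3
        simp only [Complex.add_re, Complex.natCast_re]
        ring

/-! ### A dominating double series -/

/-- The factor `2n+1` closes the induction because `4(2n+1)(2n+3) ≤ 16(n+1)²`. It saves the
`n^(-1/2)` without which the double series would not be controlled up to `Re ε = 1`. -/
lemma centralBinom_sq_le (n : ℕ) : (2 * n + 1) * n.centralBinom ^ 2 ≤ 16 ^ n := by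
  induction n with
  | zero => simp
  | succ n ih =>
    have h := Nat.succ_mul_centralBinom_succ n
    have key : (n + 1) ^ 2 * ((2 * (n + 1) + 1) * (n + 1).centralBinom ^ 2) ≤
        (n + 1) ^ 2 * 16 ^ (n + 1) := by
      calc (n + 1) ^ 2 * ((2 * (n + 1) + 1) * (n + 1).centralBinom ^ 2)
          = (2 * n + 3) * ((n + 1) * (n + 1).centralBinom) ^ 2 := by ring
        _ = (2 * n + 3) * (2 * (2 * n + 1) * n.centralBinom) ^ 2 := by rw [h]
        _ = 4 * (2 * n + 3) * (2 * n + 1) * ((2 * n + 1) * n.centralBinom ^ 2) := by ring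
        _ ≤ 4 * (2 * n + 3) * (2 * n + 1) * 16 ^ n := by gcongr
        _ ≤ (16 * (n + 1) ^ 2) * 16 ^ n := Nat.mul_le_mul_right _ (by nlinarith)
        _ = _ := by ring
    exact Nat.le_of_mul_le_mul_left key (by positivity)

lemma centralBinom_le (n : ℕ) :
    (n.centralBinom : ℝ) ≤ 4 ^ n * ((n : ℝ) + 1) ^ (-(1 / 2) : ℝ) := by
  have h : ((2 * n + 1 : ℕ) : ℝ) * (n.centralBinom : ℝ) ^ 2 ≤ 16 ^ n := by
    exact_mod_cast centralBinom_sq_le n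
  have hn : (0 : ℝ) < (n : ℝ) + 1 := by positivity
  have h2 : (4 ^ n * ((n : ℝ) + 1) ^ (-(1 / 2) : ℝ)) ^ 2 = 16 ^ n * ((n : ℝ) + 1)⁻¹ := by
    rw [mul_pow, ← pow_mul, mul_comm n 2, pow_mul, ← Real.rpow_natCast (_ ^ (_ : ℝ)),
      ← Real.rpow_mul hn.le, ← Real.rpow_neg_one]
    norm_num
  refine (pow_le_pow_iff_left₀ (by positivity) (by positivity) two_ne_zero).1 ?_
  rw [h2, ← div_eq_mul_inv, le_div_iff₀ hn]
  refine le_trans ?_ h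
  rw [mul_comm]
  gcongr
  push_cast
  linarith [(Nat.cast_nonneg n : (0 : ℝ) ≤ n)]

/-- One factor `(m+n+1)/(m+1)` is exactly what raises both indices of the binomial coefficient by
one. Repeating this with the ratio frozen at its first value loses at most `k+1` in each step, hence
`k!`. -/
lemma choose_mul_pow_le (k m n : ℕ) :
    ((m + n).choose m : ℝ) * (((m + n : ℕ) + 1 : ℝ) / (m + 1)) ^ k ≤
      k.factorial * ((m + n + k).choose (m + k) : ℝ) := by
  induction k with
  | zero => simp
  | succ k ih =>
    have h1 := Nat.add_one_mul_choose_eq (m + n + k) (m + k)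
    have h1' : ((m + n + k : ℕ) + 1 : ℝ) * ((m + n + k).choose (m + k) : ℝ) =
        ((m + n + k + 1).choose (m + k + 1) : ℝ) * ((m + k : ℕ) + 1 : ℝ) := by exact_mod_cast h1
    have hx : (((m + n : ℕ) + 1 : ℝ) / (m + 1)) ≤
        (k + 1) * (((m + n + k : ℕ) + 1 : ℝ) / ((m + k : ℕ) + 1)) := by
      rw [← mul_div_assoc, div_le_div_iff₀ (by positivity) (by positivity)]
      push_cast
      have : (0 : ℝ) ≤ m := m.cast_nonneg
      have : (0 : ℝ) ≤ n := n.cast_nonneg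
      have : (0 : ℝ) ≤ k := k.cast_nonneg
      have e : ((k : ℝ) + 1) * (m + n + k + 1) * (m + 1) - (m + n + 1) * (m + k + 1) =
        k * m * (m + n + 1) + k * (m + 1) + k * k * (m + 1) := by ring
      have : 0 ≤ (k : ℝ) * m * (m + n + 1) + k * (m + 1) + k * k * (m + 1) := by positivity
      linarith
    have e2 : ((m + n + k + 1).choose (m + k + 1) : ℝ) =
        ((m + n + k : ℕ) + 1 : ℝ) / ((m + k : ℕ) + 1) * ((m + n + k).choose (m + k) : ℝ) := by
      field_simp; linarith
    calc _ = (((m + n).choose m : ℝ) * (((m + n : ℕ) + 1 : ℝ) / (m + 1)) ^ k) *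
          (((m + n : ℕ) + 1 : ℝ) / (m + 1)) := by ring
      _ ≤ (k.factorial * ((m + n + k).choose (m + k) : ℝ)) *
          ((k + 1) * (((m + n + k : ℕ) + 1 : ℝ) / ((m + k : ℕ) + 1))) := by gcongr
      _ = _ := by
          rw [show m + n + (k + 1) = m + n + k + 1 by ring, show m + (k + 1) = m + k + 1 by ring,
            e2, Nat.factorial_succ]
          push_cast; ring

/-- The weight `C(m+n,m)² ((m+n+1)/(m+1))^k ((m+n+1)/(n+1))^k`. -/
def binomWeight (k m n : ℕ) : ℝ :=
  ((m + n).choose m : ℝ) ^ 2 * (((m + n : ℕ) + 1 : ℝ) / (m + 1)) ^ k *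
    (((m + n : ℕ) + 1 : ℝ) / (n + 1)) ^ k

lemma binomWeight_nonneg (k m n : ℕ) : 0 ≤ binomWeight k m n := by
  unfold binomWeight; positivity

/-- The two weights are absorbed into the two copies of the binomial coefficient, one on each side.
Vandermonde then sums the diagonal to `C(2(N+k), N)`, at most a central binomial coefficient. -/
lemma sum_binomWeight_le (k N : ℕ) :
    ∑ p ∈ Finset.HasAntidiagonal.antidiagonal N, binomWeight k p.1 p.2 ≤
      (k.factorial : ℝ) ^ 2 * 4 ^ (N + k) * ((N : ℝ) + 1) ^ (-(1 / 2) : ℝ) := by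
  have h1 : ∀ p ∈ Finset.HasAntidiagonal.antidiagonal N, binomWeight k p.1 p.2 ≤
      (k.factorial : ℝ) ^ 2 * (((N + k).choose p.1 * (N + k).choose p.2 : ℕ) : ℝ) := by
    rintro ⟨m, n⟩ hp
    simp only [Finset.HasAntidiagonal.mem_antidiagonal] at hp
    have a1 := choose_mul_pow_le k m n
    have a2 := choose_mul_pow_le k n m
    rw [show ((n + m).choose n) = (m + n).choose m by
      rw [add_comm, Nat.choose_symm_add], add_comm n m] at a2
    have s1 : (m + n + k).choose (m + k) = (N + k).choose n := by
      rw [← hp, ← Nat.choose_symm_of_eq_add (a := n) (b := m + k) (by ring)]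
    have s2 : (m + n + k).choose (n + k) = (N + k).choose m := by
      rw [← hp, ← Nat.choose_symm_of_eq_add (a := m) (b := n + k) (by ring)]
    rw [s1] at a1
    rw [s2] at a2
    calc binomWeight k m n = (((m + n).choose m : ℝ) * (((m + n : ℕ) + 1 : ℝ) / (m + 1)) ^ k) *
          (((m + n).choose m : ℝ) * (((m + n : ℕ) + 1 : ℝ) / (n + 1)) ^ k) := by
            unfold binomWeight; ring
      _ ≤ (k.factorial * ((N + k).choose n : ℝ)) * (k.factorial * ((N + k).choose m : ℝ)) := by
            gcongr
      _ = _ := by push_cast; ring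
  refine (Finset.sum_le_sum h1).trans ?_
  rw [← Finset.mul_sum, ← Nat.cast_sum, ← Nat.add_choose_eq, mul_assoc]
  gcongr
  calc (((N + k) + (N + k)).choose N : ℝ) ≤ ((N + k).centralBinom : ℝ) := by
        rw [← two_mul]; exact_mod_cast Nat.choose_le_centralBinom _ _
    _ ≤ 4 ^ (N + k) * (((N + k : ℕ) : ℝ) + 1) ^ (-(1 / 2) : ℝ) := centralBinom_le _
    _ ≤ _ := by
        gcongr ?_ * ?_
        refine Real.rpow_le_rpow_of_nonpos (by positivity) ?_ (by norm_num)
        push_cast; linarith [(Nat.cast_nonneg k : (0 : ℝ) ≤ k)]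

/-- Summing along diagonals leaves a constant times `∑ (N+1)^(e - 1/2)`, so the threshold `-1/2`
reflects the gain from the central binomial coefficient. -/
lemma summable_binomWeight {e : ℝ} (he : e < -(1 / 2)) (k : ℕ) :
    Summable fun p : ℕ × ℕ =>
      (((p.1 + p.2 : ℕ) : ℝ) + 1) ^ e * binomWeight k p.1 p.2 / 4 ^ (p.1 + p.2) := by
  rw [← Finset.HasAntidiagonal.sigmaAntidiagonalEquivProd.summable_iff,
    summable_sigma_of_nonneg]
  swap
  · intro x
    have := binomWeight_nonneg k x.2.1.1 x.2.1.2
    simp only [Function.comp]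
    positivity
  refine ⟨fun N => (hasSum_fintype _).summable, ?_⟩
  have hs : Summable fun N : ℕ => (k.factorial : ℝ) ^ 2 * 4 ^ k * ((N : ℝ) + 1) ^ (e - 1 / 2) := by
    apply Summable.mul_left
    have := (summable_nat_add_iff 1).2 (Real.summable_nat_rpow.2 (by linarith : e - 1 / 2 < -1))
    simpa using this
  refine Summable.of_nonneg_of_le (fun N => tsum_nonneg fun x => ?_) (fun N => ?_) hs
  · have := binomWeight_nonneg k x.1.1 x.1.2
    simp only [Function.comp]
    positivity
  · have hN : (0 : ℝ) < (N : ℝ) + 1 := by positivity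
    rw [tsum_fintype]
    have e1 : ∀ x : (Finset.HasAntidiagonal.antidiagonal N : Finset (ℕ × ℕ)),
        ((fun p : ℕ × ℕ => (((p.1 + p.2 : ℕ) : ℝ) + 1) ^ e * binomWeight k p.1 p.2 /
          4 ^ (p.1 + p.2)) ∘ Finset.HasAntidiagonal.sigmaAntidiagonalEquivProd) ⟨N, x⟩ =
        ((N : ℝ) + 1) ^ e / 4 ^ N * binomWeight k x.1.1 x.1.2 := by
      rintro ⟨⟨m, n⟩, hx⟩
      have hx' := Finset.HasAntidiagonal.mem_antidiagonal.1 hx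
      simp only at hx'
      subst hx'
      simp only [Function.comp, Finset.HasAntidiagonal.sigmaAntidiagonalEquivProd_apply]
      ring
    rw [Finset.sum_congr rfl fun x _ => e1 x, ← Finset.mul_sum,
      Finset.sum_coe_sort (Finset.HasAntidiagonal.antidiagonal N) fun p => binomWeight k p.1 p.2]
    calc _ ≤ ((N : ℝ) + 1) ^ e / 4 ^ N * ((k.factorial : ℝ) ^ 2 * 4 ^ (N + k) *
          ((N : ℝ) + 1) ^ (-(1 / 2) : ℝ)) := by
          gcongr; exact sum_binomWeight_le k N
      _ = (k.factorial : ℝ) ^ 2 * 4 ^ k * (((N : ℝ) + 1) ^ e * ((N : ℝ) + 1) ^ (-(1 / 2) : ℝ)) := by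
          rw [pow_add]; field_simp
      _ = _ := by rw [← Real.rpow_add hN]; ring_nf

end Banana

end
open scoped BigOperators

noncomputable section

namespace Banana

/-! ### The double series with reciprocal Gamma functions in place of Pochhammer denominators -/

/-- The term of the double series, with each denominator `(d)_n` replaced by `Γ(d + n)`. It is an
entire function of the parameters. -/
def rterm (a b c d e f : ℂ) (m n : ℕ) : ℂ :=
  poch a (m + n) * poch b (m + n) * poch c (m + n) *
      ((Complex.Gamma (d + n))⁻¹ * (Complex.Gamma (e + (m + n : ℕ)))⁻¹ *
        (Complex.Gamma (f + m))⁻¹) *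
    (1 / ((m.factorial : ℂ) * (n.factorial : ℂ))) * (1 / 4) ^ (m + n)

lemma inv_poch_eq {a : ℂ} (ha : ∀ k : ℕ, a ≠ -k) (n : ℕ) :
    (poch a n)⁻¹ = Complex.Gamma a * (Complex.Gamma (a + n))⁻¹ := by
  rw [← Gamma_mul_poch ha, mul_inv, mul_inv_cancel_left₀ (Complex.Gamma_ne_zero ha)]

lemma term_eq_rterm {d e f : ℂ} (a b c : ℂ) (hd : ∀ k : ℕ, d ≠ -k) (he : ∀ k : ℕ, e ≠ -k)
    (hf : ∀ k : ℕ, f ≠ -k) (m n : ℕ) :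
    term a b c d e f m n =
      Complex.Gamma d * Complex.Gamma e * Complex.Gamma f * rterm a b c d e f m n := by
  rw [term, div_eq_mul_inv (poch a _ * _ * _), mul_inv, mul_inv, inv_poch_eq hd, inv_poch_eq he,
    inv_poch_eq hf, rterm]
  ring

lemma rpow_one_sub_le {x y p : ℝ} {k : ℕ} (hy : 0 < y) (hyx : y ≤ x) (hp : p - 1 ≤ k) :
    y ^ (1 - p) ≤ x ^ (1 - p) * (x / y) ^ k := by
  have hx : 0 < x := hy.trans_le hyx
  have h1 : y ^ (1 - p) = x ^ (1 - p) * (x / y) ^ (p - 1) := by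
    rw [Real.div_rpow hx.le hy.le, ← mul_div_assoc, ← Real.rpow_add hx, div_eq_mul_inv,
      ← Real.rpow_neg hy.le]
    simp
  rw [h1, ← Real.rpow_natCast]
  gcongr
  rwa [one_le_div hy]

/-- The factorials combine to `C(m+n, m)²`. Powers of `m+1` and `n+1` are traded for powers of
`m+n+1` at the price of `k` ratio factors, which `binomWeight` stores; the remaining exponent is the
parameter excess. -/
lemma exists_norm_rterm_le (R : ℝ) : ∃ C : ℝ, 0 < C ∧ ∃ k : ℕ, ∀ a b c d e f : ℂ,
    ‖a‖ ≤ R → ‖b‖ ≤ R → ‖c‖ ≤ R → ‖d‖ ≤ R → ‖e‖ ≤ R → ‖f‖ ≤ R → ∀ m n : ℕ,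
    ‖rterm a b c d e f m n‖ ≤
      C * ((((m + n : ℕ) : ℝ) + 1) ^ (a + b + c - d - e - f).re * binomWeight k m n /
        4 ^ (m + n)) := by
  obtain ⟨A, hA, hpoch⟩ := exists_norm_poch_le R
  obtain ⟨B, hB, hGam⟩ := exists_norm_inv_Gamma_le R
  obtain ⟨k, hk⟩ := exists_nat_ge R
  refine ⟨A ^ 3 * B ^ 3, by positivity, k, fun a b c d e f ha hb hc hd he hf m n => ?_⟩
  have hre : ∀ z : ℂ, ‖z‖ ≤ R → z.re - 1 ≤ k := fun z hz => by
    linarith [Complex.re_le_norm z]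
  set X : ℝ := ((m + n : ℕ) : ℝ) + 1 with hX
  have hXpos : 0 < X := by positivity
  have hm0 : (0 : ℝ) < (m : ℝ) + 1 := by positivity
  have hn0 : (0 : ℝ) < (n : ℝ) + 1 := by positivity
  have hmX : (m : ℝ) + 1 ≤ X := by rw [hX]; push_cast; linarith [(Nat.cast_nonneg n : (0:ℝ) ≤ n)]
  have hnX : (n : ℝ) + 1 ≤ X := by rw [hX]; push_cast; linarith [(Nat.cast_nonneg m : (0:ℝ) ≤ m)]
  have hy := rpow_one_sub_le hm0 hmX (hre f hf)
  have hz := rpow_one_sub_le hn0 hnX (hre d hd)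
  have hch : ((m + n).factorial : ℝ) = ((m + n).choose m : ℝ) * (m.factorial * n.factorial) := by
    rw [← mul_assoc, Nat.choose_symm_add]
    exact_mod_cast (Nat.add_choose_mul_factorial_mul_factorial m n).symm
  have hexp : X ^ (a + b + c - d - e - f).re = X ^ (a.re - 1) * X ^ (b.re - 1) * X ^ (c.re - 1) *
      (X ^ (1 - d.re) * X ^ (1 - e.re) * X ^ (1 - f.re)) := by
    simp only [← Real.rpow_add hXpos]
    congr 1
    simp; ring
  have hm! : (m.factorial : ℝ) ≠ 0 := by positivity
  have hn! : (n.factorial : ℝ) ≠ 0 := by positivity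
  have hc! : ((m + n).choose m : ℝ) ≠ 0 := by
    have := Nat.choose_pos (Nat.le_add_right m n); positivity
  rw [rterm]
  simp only [norm_mul, norm_div, norm_pow, norm_one, Complex.norm_natCast, Complex.norm_ofNat]
  calc _ ≤ (A * ((m + n).factorial * X ^ (a.re - 1))) * (A * ((m + n).factorial * X ^ (b.re - 1))) *
        (A * ((m + n).factorial * X ^ (c.re - 1))) *
        ((B * ((n.factorial : ℝ)⁻¹ * ((n : ℝ) + 1) ^ (1 - d.re))) *
          (B * (((m + n).factorial : ℝ)⁻¹ * X ^ (1 - e.re))) *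
          (B * ((m.factorial : ℝ)⁻¹ * ((m : ℝ) + 1) ^ (1 - f.re)))) *
        (1 / (m.factorial * n.factorial)) * (1 / 4) ^ (m + n) := by
        gcongr
        · exact hpoch a ha _
        · exact hpoch b hb _
        · exact hpoch c hc _
        · exact hGam d hd _
        · exact hGam e he _
        · exact hGam f hf _
    _ ≤ (A * ((m + n).factorial * X ^ (a.re - 1))) * (A * ((m + n).factorial * X ^ (b.re - 1))) *
        (A * ((m + n).factorial * X ^ (c.re - 1))) *
        ((B * ((n.factorial : ℝ)⁻¹ * (X ^ (1 - d.re) * (X / (n + 1)) ^ k))) *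
          (B * (((m + n).factorial : ℝ)⁻¹ * X ^ (1 - e.re))) *
          (B * ((m.factorial : ℝ)⁻¹ * (X ^ (1 - f.re) * (X / (m + 1)) ^ k)))) *
        (1 / (m.factorial * n.factorial)) * (1 / 4) ^ (m + n) := by gcongr
    _ = _ := by
        rw [hexp, binomWeight, ← hX, hch, div_pow 1 (4 : ℝ), one_pow]
        field_simp

lemma summable_rterm {a b c d e f : ℂ} (h : (a + b + c - d - e - f).re < -(1 / 2)) :
    Summable fun p : ℕ × ℕ => rterm a b c d e f p.1 p.2 := by
  obtain ⟨C, hC, k, hbound⟩ := exists_norm_rterm_le (‖a‖ + ‖b‖ + ‖c‖ + ‖d‖ + ‖e‖ + ‖f‖)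
  have := norm_nonneg a
  have := norm_nonneg b
  have := norm_nonneg c
  have := norm_nonneg d
  have := norm_nonneg e
  have := norm_nonneg f
  refine Summable.of_norm_bounded ((summable_binomWeight h k).mul_left C) fun p =>
    hbound a b c d e f ?_ ?_ ?_ ?_ ?_ ?_ p.1 p.2 <;> linarith

lemma summable_term {a b c d e f : ℂ} (hd : ∀ k : ℕ, d ≠ -k) (he : ∀ k : ℕ, e ≠ -k)
    (hf : ∀ k : ℕ, f ≠ -k) (h : (a + b + c - d - e - f).re < -(1 / 2)) :
    Summable fun p : ℕ × ℕ => term a b c d e f p.1 p.2 := by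
  simp_rw [term_eq_rterm a b c hd he hf]
  exact (summable_rterm h).mul_left _

lemma differentiable_rterm {a b c d e f : ℂ → ℂ} (ha : Differentiable ℂ a)
    (hb : Differentiable ℂ b) (hc : Differentiable ℂ c) (hd : Differentiable ℂ d)
    (he : Differentiable ℂ e) (hf : Differentiable ℂ f) (m n : ℕ) :
    Differentiable ℂ fun z => rterm (a z) (b z) (c z) (d z) (e z) (f z) m n := by
  have hG : ∀ {g : ℂ → ℂ}, Differentiable ℂ g → ∀ j : ℕ,
      Differentiable ℂ fun z => (Complex.Gamma (g z + j))⁻¹ := fun hg j =>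
    Complex.differentiable_one_div_Gamma.comp (hg.add_const _)
  have hP : ∀ {g : ℂ → ℂ}, Differentiable ℂ g → ∀ j : ℕ,
      Differentiable ℂ fun z => poch (g z) j := fun hg j => (differentiable_poch j).comp hg
  exact (((((hP ha _).mul (hP hb _)).mul (hP hc _)).mul (((hG hd n).mul (hG he _)).mul
    (hG hf m))).mul_const _).mul_const _

lemma differentiableOn_tsum_rterm {a b c d e f : ℂ → ℂ} (ha : Differentiable ℂ a)
    (hb : Differentiable ℂ b) (hc : Differentiable ℂ c) (hd : Differentiable ℂ d)
    (he : Differentiable ℂ e) (hf : Differentiable ℂ f)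
    (h : ∀ z, a z + b z + c z - d z - e z - f z = 2 * z - 5 / 2) :
    DifferentiableOn ℂ
      (fun z => ∑' p : ℕ × ℕ, rterm (a z) (b z) (c z) (d z) (e z) (f z) p.1 p.2)
      {z | z.re < 1} := by
  intro z₀ hz₀
  obtain ⟨x, hx1, hx2⟩ := exists_between (show z₀.re < 1 from hz₀)
  have hbd : ∀ {g : ℂ → ℂ}, Differentiable ℂ g → ∃ R : ℝ, 0 ≤ R ∧
      ∀ z ∈ Metric.ball z₀ 1, ‖g z‖ ≤ R := fun {g} hg => by
    obtain ⟨R, hR⟩ := (isCompact_closedBall z₀ 1).exists_bound_of_continuousOn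
      hg.continuous.continuousOn
    exact ⟨R, (norm_nonneg _).trans (hR z₀ (by simp)),
      fun z hz => hR z (Metric.ball_subset_closedBall hz)⟩
  obtain ⟨Ra, pa, ha'⟩ := hbd ha
  obtain ⟨Rb, pb, hb'⟩ := hbd hb
  obtain ⟨Rc, pc, hc'⟩ := hbd hc
  obtain ⟨Rd, pd, hd'⟩ := hbd hd
  obtain ⟨Re, pe, he'⟩ := hbd he
  obtain ⟨Rf, pf, hf'⟩ := hbd hf
  obtain ⟨C, hC, k, hbound⟩ := exists_norm_rterm_le (Ra + Rb + Rc + Rd + Re + Rf)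
  set U : Set ℂ := Metric.ball z₀ 1 ∩ {z | z.re < x} with hU
  have hUo : IsOpen U := Metric.isOpen_ball.inter (isOpen_lt Complex.continuous_re continuous_const)
  have hz₀U : z₀ ∈ U := ⟨Metric.mem_ball_self one_pos, hx1⟩
  have key : DifferentiableOn ℂ
      (fun z => ∑' p : ℕ × ℕ, rterm (a z) (b z) (c z) (d z) (e z) (f z) p.1 p.2) U := by
    -- Near `z₀` the excess has real part below `2x - 5/2 < -1/2`, since `x < 1`; one majorant
    -- therefore serves the whole neighbourhood.
    refine Complex.differentiableOn_tsum_of_summable_norm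
      ((summable_binomWeight (e := 2 * x - 5 / 2) (by linarith) k).mul_left C)
      (fun p => (differentiable_rterm ha hb hc hd he hf p.1 p.2).differentiableOn) hUo ?_
    rintro p z ⟨hz1, hz2⟩
    have hz2' : z.re < x := hz2
    refine (hbound _ _ _ _ _ _ ((ha' z hz1).trans ?_) ((hb' z hz1).trans ?_)
      ((hc' z hz1).trans ?_) ((hd' z hz1).trans ?_) ((he' z hz1).trans ?_) ((hf' z hz1).trans ?_)
      p.1 p.2).trans ?_
    · linarith
    · linarith
    · linarith
    · linarith
    · linarith
    · linarith
    have := binomWeight_nonneg k p.1 p.2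
    gcongr
    · push_cast; linarith [(Nat.cast_nonneg p.1 : (0:ℝ) ≤ _), (Nat.cast_nonneg p.2 : (0:ℝ) ≤ _)]
    · rw [h z]; simp; linarith
  exact ((key z₀ hz₀U).differentiableAt (hUo.mem_nhds hz₀U)).differentiableWithinAt

end Banana

end
open scoped BigOperators

noncomputable section

namespace Banana

open MeasureTheory Set Filter Topology

/-! ### Modified Bessel functions -/

/-- The entire function `∑ tⁿ / (n! Γ(b + n))`, i.e. `t^{(1-b)/2} I_{b-1}(2√t)`. -/
def besselI (b t : ℝ) : ℝ := ∑' n : ℕ, t ^ n / (n.factorial * Real.Gamma (b + n))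

/-- The integral `∫₀^∞ α^{μ-1} exp(-α - t/α) dα`, i.e. `2 t^{μ/2} K_μ(2√t)`. -/
def besselK (μ t : ℝ) : ℝ := ∫ α in Ioi (0 : ℝ), α ^ (μ - 1) * Real.exp (-α - t / α)

lemma exists_inv_Gamma_le {b : ℝ} (hb : 0 < b) : ∃ M : ℝ, 0 < M ∧ ∀ n : ℕ,
    (Real.Gamma (b + n))⁻¹ ≤ M := by
  have h1 := Real.Gamma_pos_of_pos hb
  have h2 := Real.Gamma_pos_of_pos (show 0 < b + 1 by linarith)
  have key : ∀ n : ℕ, Real.Gamma (b + 1) ≤ Real.Gamma (b + (n + 1 : ℕ)) := by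
    intro n
    induction n with
    | zero => simp
    | succ n ih =>
      refine ih.trans ?_
      have hp : 0 < b + (n + 1 : ℕ) := by positivity
      have := Real.Gamma_pos_of_pos hp
      rw [show b + ((n + 1 + 1 : ℕ) : ℝ) = b + (n + 1 : ℕ) + 1 by push_cast; ring,
        Real.Gamma_add_one hp.ne']
      have : (1 : ℝ) ≤ b + (n + 1 : ℕ) := by
        push_cast; linarith [(Nat.cast_nonneg n : (0:ℝ) ≤ n)]
      nlinarith
  -- From `b + 1` on, the values `Γ(b + n)` increase because their arguments are at least `1`. Only
  -- `n = 0` may break monotonicity, so its reciprocal is added.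
  refine ⟨(Real.Gamma b)⁻¹ + (Real.Gamma (b + 1))⁻¹, by positivity, fun n => ?_⟩
  have p1 := inv_pos.2 h1
  have p2 := inv_pos.2 h2
  cases n with
  | zero => simp; linarith
  | succ n =>
    have := inv_anti₀ h2 (key n)
    linarith

lemma summable_besselI {b : ℝ} (hb : 0 < b) (t : ℝ) :
    Summable fun n : ℕ => t ^ n / (n.factorial * Real.Gamma (b + n)) := by
  obtain ⟨M, hM, h⟩ := exists_inv_Gamma_le hb
  refine Summable.of_norm_bounded ((Real.summable_pow_div_factorial |t|).mul_left M) fun n => ?_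
  have hG : 0 < Real.Gamma (b + n) := Real.Gamma_pos_of_pos (by positivity)
  rw [Real.norm_eq_abs, abs_div, abs_pow, abs_mul, abs_of_pos hG,
    abs_of_pos (by positivity : (0:ℝ) < n.factorial), ← div_div, div_eq_mul_inv _ (Real.Gamma _),
    mul_comm]
  gcongr
  exact h n

lemma besselI_zero (b : ℝ) : besselI b 0 = (Real.Gamma b)⁻¹ := by
  rw [besselI, tsum_eq_single 0 fun n hn => by simp [hn]]
  simp

lemma besselI_nonneg {b t : ℝ} (hb : 0 < b) (ht : 0 ≤ t) : 0 ≤ besselI b t :=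
  tsum_nonneg fun n => by
    have hG : 0 < Real.Gamma (b + n) := Real.Gamma_pos_of_pos (by positivity)
    positivity

lemma hasDerivAt_besselI {b : ℝ} (hb : 0 < b) (t : ℝ) :
    HasDerivAt (besselI b) (besselI (b + 1) t) t := by
  obtain ⟨M, hM, hMb⟩ := exists_inv_Gamma_le hb
  set r : ℝ := |t| + 1 with hr
  have hr0 : 0 < r := by positivity
  have hu : Summable fun n : ℕ => M * (n * r ^ (n - 1) / n.factorial) := by
    apply Summable.mul_left
    rw [← summable_nat_add_iff 1]
    refine (Real.summable_pow_div_factorial r).congr fun n => ?_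
    rw [Nat.factorial_succ]
    push_cast
    field_simp
  have key := hasDerivAt_tsum_of_isPreconnected (t := Metric.ball (0 : ℝ) r)
    (g := fun (n : ℕ) (y : ℝ) => y ^ n / (n.factorial * Real.Gamma (b + n)))
    (g' := fun (n : ℕ) (y : ℝ) => (n * y ^ (n - 1)) / (n.factorial * Real.Gamma (b + n)))
    hu Metric.isOpen_ball (convex_ball _ _).isPreconnected
    (fun n y _ => (hasDerivAt_pow n y).div_const _) ?_ (Metric.mem_ball_self hr0)
    (summable_besselI hb 0) (y := t) (by simp [hr])
  · refine key.congr_deriv ?_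
    have hs : Summable fun n : ℕ => (n * t ^ (n - 1)) / (n.factorial * Real.Gamma (b + n)) := by
      rw [← summable_nat_add_iff 1]
      refine (summable_besselI (show 0 < b + 1 by linarith) t).congr fun n => ?_
      rw [Nat.factorial_succ, show b + ((n + 1 : ℕ) : ℝ) = b + 1 + n by push_cast; ring]
      have hG : 0 < Real.Gamma (b + 1 + n) := Real.Gamma_pos_of_pos (by positivity)
      push_cast
      field_simp
    rw [hs.tsum_eq_zero_add, besselI]
    simp only [CharP.cast_eq_zero, zero_mul, zero_div, zero_add]
    congr 1 with n
    rw [Nat.factorial_succ, show b + ((n + 1 : ℕ) : ℝ) = b + 1 + n by push_cast; ring]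
    have hG : 0 < Real.Gamma (b + 1 + n) := Real.Gamma_pos_of_pos (by positivity)
    push_cast
    field_simp
  · intro n y hy
    have hy' : |y| ≤ r := by simpa using (Metric.mem_ball.1 hy).le
    have hG : 0 < Real.Gamma (b + n) := Real.Gamma_pos_of_pos (by positivity)
    rw [Real.norm_eq_abs, abs_div, abs_mul, abs_mul, abs_pow, abs_of_pos hG, Nat.abs_cast,
      Nat.abs_cast, ← div_div, div_eq_mul_inv _ (Real.Gamma _), mul_comm]
    gcongr
    exact hMb n

/-- Coefficientwise this is `1/Γ(b+n) = (b+n)/Γ(b+1+n)`: the part with `b` gives the first term, the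
part with `n` cancels against `n!` and shifts the index. -/
lemma besselI_contiguous {b : ℝ} (hb : 0 < b) (t : ℝ) :
    besselI b t = b * besselI (b + 1) t + t * besselI (b + 2) t := by
  have s1 := (summable_besselI (show 0 < b + 1 by linarith) t).mul_left b
  have s2 := (summable_besselI (show 0 < b + 2 by linarith) t).mul_left t
  have hn : ∀ n : ℕ, t * (t ^ n / (n.factorial * Real.Gamma (b + 2 + n))) =
      ((n + 1 : ℕ) : ℝ) * t ^ (n + 1) /
        ((n + 1).factorial * Real.Gamma (b + 1 + (n + 1 : ℕ))) := by
    intro n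
    rw [Nat.factorial_succ, show b + 1 + ((n + 1 : ℕ) : ℝ) = b + 2 + n by push_cast; ring]
    have hG : 0 < Real.Gamma (b + 2 + n) := Real.Gamma_pos_of_pos (by positivity)
    push_cast
    field_simp
    ring
  have s3 : Summable fun n : ℕ => (n : ℝ) * t ^ n / (n.factorial * Real.Gamma (b + 1 + n)) := by
    rw [← summable_nat_add_iff 1]
    exact s2.congr hn
  have e2 : t * besselI (b + 2) t =
      ∑' n : ℕ, (n : ℝ) * t ^ n / (n.factorial * Real.Gamma (b + 1 + n)) := by
    rw [s3.tsum_eq_zero_add, besselI, ← tsum_mul_left]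
    simp only [CharP.cast_eq_zero, zero_mul, zero_div, zero_add]
    exact tsum_congr hn
  rw [e2, besselI, besselI, ← tsum_mul_left, ← s1.tsum_add s3]
  refine tsum_congr fun n => ?_
  have hp : 0 < b + n := by positivity
  have hG := Real.Gamma_pos_of_pos hp
  rw [show b + 1 + (n : ℝ) = b + n + 1 by ring, Real.Gamma_add_one hp.ne']
  field_simp

/-! ### The integrals `besselK`: convergence, derivative, recurrence, reflection, behaviour at `0`
-/

lemma exp_neg_le_factorial_mul {u : ℝ} (hu : 0 < u) (k : ℕ) :
    Real.exp (-u) ≤ k.factorial * (u ^ k)⁻¹ := by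
  have h := Real.pow_div_factorial_le_exp u hu.le k
  have hk : (0 : ℝ) < k.factorial := by positivity
  rw [Real.exp_neg, ← div_eq_mul_inv, ← inv_div]
  exact inv_anti₀ (by positivity) h

/-- The factor `e^(-t/α)` beats every negative power of `α` at `0`. Using it as `k! (α/t)^k` reduces
convergence for arbitrary real `μ` to a Gamma integral. -/
lemma besselK_integrand_le {t α : ℝ} (ht : 0 < t) (hα : 0 < α) (k : ℕ) (p : ℝ) :
    α ^ p * Real.exp (-α - t / α) ≤ k.factorial * (t ^ k)⁻¹ * (Real.exp (-α) * α ^ (p + k)) := by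
  rw [sub_eq_add_neg, Real.exp_add, Real.rpow_add hα, Real.rpow_natCast]
  have h := exp_neg_le_factorial_mul (div_pos ht hα) k
  rw [div_pow, inv_div] at h
  calc α ^ p * (Real.exp (-α) * Real.exp (-(t / α)))
      ≤ α ^ p * (Real.exp (-α) * (k.factorial * (α ^ k / t ^ k))) := by gcongr
    _ = _ := by ring

lemma aestronglyMeasurable_besselK_integrand (μ t : ℝ) :
    AEStronglyMeasurable (fun α : ℝ => α ^ (μ - 1) * Real.exp (-α - t / α))
      (volume.restrict (Ioi 0)) := by
  apply Measurable.aestronglyMeasurable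
  fun_prop

lemma integrableOn_besselK (μ : ℝ) {t : ℝ} (ht : 0 < t) :
    IntegrableOn (fun α : ℝ => α ^ (μ - 1) * Real.exp (-α - t / α)) (Ioi 0) := by
  obtain ⟨k, hk⟩ := exists_nat_gt (-μ)
  have h := (Real.GammaIntegral_convergent (s := μ + k) (by linarith)).const_mul
    (k.factorial * (t ^ k)⁻¹)
  refine h.mono' (aestronglyMeasurable_besselK_integrand μ t) ?_
  refine (ae_restrict_mem measurableSet_Ioi).mono fun α (hα : 0 < α) => ?_
  rw [Real.norm_of_nonneg (by positivity)]
  refine (besselK_integrand_le ht hα k _).trans (le_of_eq ?_)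
  congr 3; ring

lemma hasDerivAt_besselK (μ : ℝ) {t : ℝ} (ht : 0 < t) :
    HasDerivAt (besselK μ) (-besselK (μ - 1) t) t := by
  have h2 : 0 < t / 2 := by linarith
  have key := (hasDerivAt_integral_of_dominated_loc_of_deriv_le (μ := volume.restrict (Ioi (0:ℝ)))
    (F := fun t α => α ^ (μ - 1) * Real.exp (-α - t / α)) (x₀ := t) (s := Ioi (t / 2))
    (F' := fun t α => -(α ^ (μ - 1 - 1) * Real.exp (-α - t / α)))
    (bound := fun α => α ^ (μ - 1 - 1) * Real.exp (-α - (t / 2) / α))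
    (Ioi_mem_nhds (by linarith))
    (Eventually.of_forall fun x => aestronglyMeasurable_besselK_integrand μ x)
    (integrableOn_besselK μ ht) (aestronglyMeasurable_besselK_integrand (μ - 1) t).neg ?_
    (integrableOn_besselK (μ - 1) h2) ?_).2
  · rwa [integral_neg] at key
  · refine (ae_restrict_mem measurableSet_Ioi).mono fun α (hα : 0 < α) x (hx : t / 2 < x) => ?_
    rw [norm_neg, Real.norm_of_nonneg (by positivity)]
    gcongr
  · refine (ae_restrict_mem measurableSet_Ioi).mono fun α (hα : 0 < α) x (hx : t / 2 < x) => ?_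
    have h := ((((hasDerivAt_id x).div_const α).const_sub (-α)).exp).const_mul (α ^ (μ - 1))
    refine h.congr_deriv ?_
    rw [Real.rpow_sub_one hα.ne' (μ - 1)]
    simp only [id]
    ring

/-- Integration by parts: the three terms are the integral of the derivative of `α^μ exp(-α - t/α)`,
which vanishes at `0` and at `∞`. -/
lemma besselK_recurrence (μ : ℝ) {t : ℝ} (ht : 0 < t) :
    μ * besselK μ t - besselK (μ + 1) t + t * besselK (μ - 1) t = 0 := by
  have i0 := integrableOn_besselK μ ht
  have i1 := integrableOn_besselK (μ + 1) ht
  have i2 := integrableOn_besselK (μ - 1) ht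
  have hsum : IntegrableOn (fun α : ℝ => μ * (α ^ (μ - 1) * Real.exp (-α - t / α)) -
      α ^ (μ + 1 - 1) * Real.exp (-α - t / α) + t * (α ^ (μ - 1 - 1) * Real.exp (-α - t / α)))
      (Ioi 0) := ((i0.const_mul μ).sub i1).add (i2.const_mul t)
  have heq : ∀ α ∈ Ioi (0 : ℝ), μ * (α ^ (μ - 1) * Real.exp (-α - t / α)) -
      α ^ (μ + 1 - 1) * Real.exp (-α - t / α) + t * (α ^ (μ - 1 - 1) * Real.exp (-α - t / α)) =
      (μ * α ^ (μ - 1)) * Real.exp (-α - t / α) +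
        α ^ μ * (Real.exp (-α - t / α) * (-1 - t * (-(α ^ 2)⁻¹))) := by
    intro α hα
    have hα' : α ≠ 0 := ne_of_gt hα
    rw [Real.rpow_sub_one hα' (μ - 1), Real.rpow_sub_one hα', add_sub_cancel_right]
    field_simp
    ring
  have key := integral_Ioi_deriv_mul_eq_sub (a := (0:ℝ)) (a' := (0:ℝ)) (b' := (0:ℝ))
    (u := fun α : ℝ => α ^ μ) (u' := fun α => μ * α ^ (μ - 1))
    (v := fun α : ℝ => Real.exp (-α - t / α))
    (v' := fun α => Real.exp (-α - t / α) * (-1 - t * (-(α ^ 2)⁻¹)))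
    (fun α hα => Real.hasDerivAt_rpow_const (Or.inl (ne_of_gt hα)))
    (fun α hα => by
      have h := (((hasDerivAt_id α).neg).sub ((hasDerivAt_inv (ne_of_gt hα)).const_mul t)).exp
      simpa [div_eq_mul_inv] using h)
    (hsum.congr_fun heq measurableSet_Ioi) ?_ ?_
  · have a1 := integral_sub (i0.const_mul μ) i1
    have a2 := integral_add ((i0.const_mul μ).sub i1) (i2.const_mul t)
    simp only [Pi.sub_apply] at a2
    rw [← setIntegral_congr_fun measurableSet_Ioi heq, a2, a1,
      integral_const_mul, integral_const_mul] at key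
    simpa [besselK] using key
  · obtain ⟨k, hk⟩ := exists_nat_gt (-μ)
    have hlim : Tendsto (fun α : ℝ => k.factorial * (t ^ k)⁻¹ * (Real.exp (-α) * α ^ (μ + k)))
        (𝓝[>] 0) (𝓝 0) := by
      have hc : Continuous fun α : ℝ =>
          k.factorial * (t ^ k)⁻¹ * (Real.exp (-α) * α ^ (μ + k)) :=
        continuous_const.mul ((Real.continuous_exp.comp continuous_neg).mul
          (Real.continuous_rpow_const (by linarith)))
      have := (hc.tendsto 0).mono_left (nhdsWithin_le_nhds (s := Ioi 0))
      simpa [Real.zero_rpow (by linarith : μ + k ≠ 0)] using this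
    refine tendsto_of_tendsto_of_tendsto_of_le_of_le' tendsto_const_nhds hlim ?_ ?_
    · filter_upwards [self_mem_nhdsWithin] with α hα
      have : (0 : ℝ) < α := hα
      simp only [Pi.mul_apply]
      positivity
    · filter_upwards [self_mem_nhdsWithin] with α hα
      exact besselK_integrand_le ht hα k μ
  · have hlim := tendsto_rpow_mul_exp_neg_mul_atTop_nhds_zero μ 1 one_pos
    refine tendsto_of_tendsto_of_tendsto_of_le_of_le' tendsto_const_nhds hlim ?_ ?_
    · filter_upwards [Ioi_mem_atTop 0] with α hα
      have : (0 : ℝ) < α := hα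
      simp only [Pi.mul_apply]
      positivity
    · filter_upwards [Ioi_mem_atTop 0] with α hα
      have : (0 : ℝ) < α := hα
      have : 0 < t / α := by positivity
      simp only [Pi.mul_apply]
      gcongr
      linarith

/-- The substitution `α ↦ t/α` exchanges the two terms of the exponent; it is carried out as a
scaling by `t` followed by an inversion. -/
lemma besselK_neg (μ : ℝ) {t : ℝ} (ht : 0 < t) : besselK (-μ) t = t ^ (-μ) * besselK μ t := by
  have h1 := integral_comp_mul_left_Ioi
    (fun α : ℝ => α ^ (-μ - 1) * Real.exp (-α - t / α)) 0 ht
  rw [mul_zero] at h1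
  have h2 := integral_comp_rpow_Ioi
    (fun α : ℝ => (t * α) ^ (-μ - 1) * Real.exp (-(t * α) - t / (t * α)))
    (p := -1) (by norm_num)
  rw [h1] at h2
  have h3 : besselK (-μ) t = t * (t⁻¹ • besselK (-μ) t) := by
    rw [smul_eq_mul, mul_inv_cancel_left₀ ht.ne']
  rw [h3, besselK, ← h2, besselK, ← integral_const_mul, ← integral_const_mul]
  refine setIntegral_congr_fun measurableSet_Ioi fun α hα => ?_
  have hα : 0 < α := hα
  simp only [smul_eq_mul, abs_neg, abs_one, one_mul, Real.rpow_neg_one]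
  rw [Real.mul_rpow ht.le (inv_nonneg.2 hα.le), Real.inv_rpow hα.le, ← Real.rpow_neg hα.le,
    show -α - t / α = -(t * α⁻¹) - t / (t * α⁻¹) by field_simp; ring,
    Real.rpow_sub_one ht.ne', show -(-μ - 1) = (μ - 1) + 2 by ring, Real.rpow_add hα]
  rw [show ((-1 : ℝ) - 1) = -2 by norm_num, Real.rpow_neg hα.le]
  have := Real.rpow_pos_of_pos hα 2
  field_simp

lemma tendsto_besselK {μ : ℝ} (hμ : 0 < μ) :
    Tendsto (besselK μ) (𝓝[>] 0) (𝓝 (Real.Gamma μ)) := by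
  rw [Real.Gamma_eq_integral hμ]
  refine tendsto_integral_filter_of_dominated_convergence
    (fun α => Real.exp (-α) * α ^ (μ - 1))
    (Eventually.of_forall fun t => aestronglyMeasurable_besselK_integrand μ t) ?_
    (Real.GammaIntegral_convergent hμ) ?_
  · filter_upwards [self_mem_nhdsWithin] with t ht
    refine (ae_restrict_mem measurableSet_Ioi).mono fun α (hα : 0 < α) => ?_
    have ht : 0 < t := ht
    have : 0 < t / α := by positivity
    rw [Real.norm_of_nonneg (by positivity), mul_comm]
    gcongr
    linarith
  · refine (ae_restrict_mem measurableSet_Ioi).mono fun α (hα : 0 < α) => ?_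
    have hc : Continuous fun t : ℝ => α ^ (μ - 1) * Real.exp (-α - t / α) := by fun_prop
    have := (hc.tendsto 0).mono_left (nhdsWithin_le_nhds (s := Ioi 0))
    simpa [mul_comm] using this

lemma tendsto_mul_besselK {μ : ℝ} (hμ : -1 < μ) :
    Tendsto (fun t => t * besselK μ t) (𝓝[>] 0) (𝓝 0) := by
  have e : (fun t => t * besselK μ t) = fun t =>
      ∫ α in Ioi (0:ℝ), t * (α ^ (μ - 1) * Real.exp (-α - t / α)) := by
    ext t; rw [integral_const_mul, besselK]
  rw [e]
  rw [show 𝓝 (0 : ℝ) = 𝓝 (∫ α in Ioi (0:ℝ), (0 : ℝ)) by simp]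
  refine tendsto_integral_filter_of_dominated_convergence
    (fun α => Real.exp (-α) * α ^ (μ + 1 - 1))
    (Eventually.of_forall fun t => (aestronglyMeasurable_besselK_integrand μ t).const_mul t) ?_
    (Real.GammaIntegral_convergent (by linarith)) ?_
  · filter_upwards [self_mem_nhdsWithin] with t ht
    refine (ae_restrict_mem measurableSet_Ioi).mono fun α (hα : 0 < α) => ?_
    have ht : 0 < t := ht
    have h := besselK_integrand_le ht hα 1 (μ - 1)
    rw [Real.norm_of_nonneg (by positivity)]
    calc _ ≤ t * (Nat.factorial 1 * (t ^ 1)⁻¹ * (Real.exp (-α) * α ^ (μ - 1 + (1 : ℕ)))) := by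
          gcongr
      _ = _ := by
          rw [show μ + 1 - 1 = μ - 1 + (1 : ℕ) by push_cast; ring]
          simp only [Nat.factorial_one, Nat.cast_one, pow_one]
          field_simp
  · refine (ae_restrict_mem measurableSet_Ioi).mono fun α (hα : 0 < α) => ?_
    have hc : Continuous fun t : ℝ => t * (α ^ (μ - 1) * Real.exp (-α - t / α)) := by fun_prop
    have := (hc.tendsto 0).mono_left (nhdsWithin_le_nhds (s := Ioi 0))
    simpa using this

/-- The Wronskian of `K_μ` and `I_μ`. -/
lemma besselK_besselI_wronskian {μ : ℝ} (hμ : -1 < μ) {t : ℝ} (ht : 0 < t) :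
    besselK (1 + μ) t * besselI (1 + μ) t + t * (besselK μ t * besselI (2 + μ) t) = 1 := by
  set W : ℝ → ℝ := fun t =>
    besselK (1 + μ) t * besselI (1 + μ) t + t * (besselK μ t * besselI (2 + μ) t) with hW
  have p1 : 0 < 1 + μ := by linarith
  have p2 : 0 < 2 + μ := by linarith
  have hd : ∀ s : ℝ, 0 < s → HasDerivAt W 0 s := by
    intro s hs
    have k1 := hasDerivAt_besselK (1 + μ) hs
    have k0 := hasDerivAt_besselK μ hs
    have i1 := hasDerivAt_besselI p1 s
    have i2 := hasDerivAt_besselI p2 s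
    refine ((k1.mul i1).add ((hasDerivAt_id s).mul (k0.mul i2))).congr_deriv ?_
    have c := besselI_contiguous p1 s
    have r := besselK_recurrence μ hs
    rw [show 1 + μ + 1 = 2 + μ by ring, show 1 + μ + 2 = 2 + μ + 1 by ring] at c
    rw [show 1 + μ - 1 = μ by ring, show 1 + μ + 1 = 2 + μ by ring]
    rw [add_comm μ 1] at r
    simp only [id, Pi.mul_apply]
    -- Both derivatives lower or raise an index; the contiguous relation for `I` and the recurrence
    -- for `K` bring the terms back and cancel them.
    linear_combination (-besselK μ s) * c - besselI (2 + μ) s * r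
  have hconst : ∀ s : ℝ, 0 < s → W s = W t := fun s hs =>
    isOpen_Ioi.is_const_of_deriv_eq_zero isPreconnected_Ioi
      (fun x hx => (hd x hx).differentiableAt.differentiableWithinAt)
      (fun x hx => (hd x hx).deriv) (Set.mem_Ioi.2 hs) (Set.mem_Ioi.2 ht)
  have hcont : ∀ {b : ℝ}, 0 < b → Tendsto (besselI b) (𝓝[>] 0) (𝓝 (Real.Gamma b)⁻¹) :=
    fun {b} hb => by
      rw [← besselI_zero]
      exact ((hasDerivAt_besselI hb 0).continuousAt.tendsto).mono_left nhdsWithin_le_nhds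
  -- The constant is read off at `t → 0`: the first product tends to `Γ(1+μ) / Γ(1+μ)`, and the
  -- second vanishes because of the factor `t`.
  have hlim : Tendsto W (𝓝[>] 0) (𝓝 1) := by
    have l := ((tendsto_besselK p1).mul (hcont p1)).add ((tendsto_mul_besselK hμ).mul (hcont p2))
    rw [mul_inv_cancel₀ (Real.Gamma_pos_of_pos p1).ne', zero_mul, add_zero] at l
    refine l.congr fun s => ?_
    simp only [hW]; ring
  exact tendsto_nhds_unique (tendsto_const_nhds.congr' (by
    filter_upwards [self_mem_nhdsWithin] with s hs using (hconst s hs).symm)) hlim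

/-- The Wronskian of `I_ν` and `I_{-ν}`. -/
lemma besselI_wronskian {ν : ℝ} (h0 : 0 < ν) (h1 : ν < 1) (t : ℝ) :
    ν * (besselI (1 + ν) t * besselI (1 - ν) t) + t * (besselI (2 + ν) t * besselI (1 - ν) t) -
      t * (besselI (2 - ν) t * besselI (1 + ν) t) =
      ν * ((Real.Gamma (1 + ν))⁻¹ * (Real.Gamma (1 - ν))⁻¹) := by
  set W : ℝ → ℝ := fun t => ν * (besselI (1 + ν) t * besselI (1 - ν) t) +
    t * (besselI (2 + ν) t * besselI (1 - ν) t) - t * (besselI (2 - ν) t * besselI (1 + ν) t)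
    with hW
  have hd : ∀ s : ℝ, HasDerivAt W 0 s := by
    intro s
    have a1 := hasDerivAt_besselI (show 0 < 1 + ν by linarith) s
    have a2 := hasDerivAt_besselI (show 0 < 2 + ν by linarith) s
    have b1 := hasDerivAt_besselI (show 0 < 1 - ν by linarith) s
    have b2 := hasDerivAt_besselI (show 0 < 2 - ν by linarith) s
    refine ((((a1.mul b1).const_mul ν).add ((hasDerivAt_id s).mul (a2.mul b1))).sub
      ((hasDerivAt_id s).mul (b2.mul a1))).congr_deriv ?_
    have ca := besselI_contiguous (show 0 < 1 + ν by linarith) s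
    have cb := besselI_contiguous (show 0 < 1 - ν by linarith) s
    rw [show 1 + ν + 1 = 2 + ν by ring, show 1 + ν + 2 = 2 + ν + 1 by ring] at ca
    rw [show 1 - ν + 1 = 2 - ν by ring, show 1 - ν + 2 = 2 - ν + 1 by ring] at cb
    rw [show 1 + ν + 1 = 2 + ν by ring, show 1 - ν + 1 = 2 - ν by ring]
    simp only [id, Pi.mul_apply]
    linear_combination (-besselI (1 - ν) s) * ca + besselI (1 + ν) s * cb
  have hc : W t = W 0 := is_const_of_deriv_eq_zero (fun s => (hd s).differentiableAt)
    (fun s => (hd s).deriv) t 0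
  have h0 : W 0 = ν * ((Real.Gamma (1 + ν))⁻¹ * (Real.Gamma (1 - ν))⁻¹) := by
    simp [hW, besselI_zero]
  rw [← h0, ← hc]

/-- The connection formula expressing `K_ν` by `I_{-ν}` and `I_ν`. -/
lemma besselK_eq {ν : ℝ} (h0 : 0 < ν) (h1 : ν < 1) {t : ℝ} (ht : 0 < t) :
    besselK (-ν) t + Real.Gamma ν * Real.Gamma (1 - ν) * besselI (1 + ν) t =
      Real.Gamma ν * Real.Gamma (1 - ν) * (t ^ (-ν) * besselI (1 - ν) t) := by
  have A := besselK_besselI_wronskian (show -1 < -ν by linarith) ht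
  have B := besselK_besselI_wronskian (show -1 < ν by linarith) ht
  have C := besselI_wronskian h0 h1 t
  have s0 := besselK_neg ν ht
  have s1 := besselK_neg (1 - ν) ht
  have r := besselK_recurrence ν ht
  have g0 : Real.Gamma (1 + ν) = ν * Real.Gamma ν := by
    rw [add_comm, Real.Gamma_add_one h0.ne']
  have gp := Real.Gamma_pos_of_pos h0
  have gq := Real.Gamma_pos_of_pos (show 0 < 1 - ν by linarith)
  have tp := Real.rpow_pos_of_pos ht ν
  rw [← sub_eq_add_neg, ← sub_eq_add_neg] at A
  rw [neg_sub, Real.rpow_sub_one ht.ne'] at s1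
  rw [Real.rpow_neg ht.le] at s0 ⊢
  rw [g0] at C
  have C' : (ν * (besselI (1 + ν) t * besselI (1 - ν) t) +
      t * (besselI (2 + ν) t * besselI (1 - ν) t) -
      t * (besselI (2 - ν) t * besselI (1 + ν) t)) * (Real.Gamma ν * Real.Gamma (1 - ν)) = 1 := by
    rw [C]; field_simp
  have s1' : t * besselK (ν - 1) t = t ^ ν * besselK (1 - ν) t := by
    rw [s1]; field_simp
  have s0' : besselK ν t = t ^ ν * besselK (-ν) t := by
    rw [s0]; field_simp
  rw [add_comm ν 1] at r
  -- Cramer's rule: in `I_{1-ν} B - I_{1+ν} A' + I_{1-ν} I_{1+ν} r` the terms `besselK (1 ± ν)`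
  -- cancel, leaving `besselK ν t` times the Wronskian of the two `I`, which `C'` evaluates.
  have key : besselK ν t = Real.Gamma ν * Real.Gamma (1 - ν) *
      (besselI (1 - ν) t - t ^ ν * besselI (1 + ν) t) := by
    rw [s1'] at r
    rw [show besselK (-ν) t = (t ^ ν)⁻¹ * besselK ν t from s0] at A
    have A' : t ^ ν * besselK (1 - ν) t * besselI (1 - ν) t +
        t * (besselK ν t * besselI (2 - ν) t) = t ^ ν := by
      have h : t ^ ν * (t ^ ν)⁻¹ = 1 := mul_inv_cancel₀ tp.ne'
      linear_combination t ^ ν * A - t * besselK ν t * besselI (2 - ν) t * h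
    linear_combination (-besselK ν t) * C' + (Real.Gamma ν * Real.Gamma (1 - ν)) *
      (besselI (1 - ν) t * B - besselI (1 + ν) t * A' +
        besselI (1 - ν) t * besselI (1 + ν) t * r)
  rw [s0, key]
  field_simp
  ring

end Banana

end
open scoped BigOperators

noncomputable section

namespace Banana

open MeasureTheory Set Filter Topology
open scoped ENNReal

/-! ### One-dimensional integrals -/

/-- A nonzero Bochner integral certifies integrability by itself, since non-integrable functions
have integral `0` by convention. Known real integrals thus pass to `[0, ∞]` without a separate
convergence proof. -/
lemma lintegral_ofReal_of_integral_pos {μ : Measure ℝ} {f : ℝ → ℝ} {c : ℝ}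
    (hf : ∀ᵐ x ∂μ, 0 ≤ f x) (h : ∫ x, f x ∂μ = c) (hc : 0 < c) :
    ∫⁻ x, ENNReal.ofReal (f x) ∂μ = ENNReal.ofReal c := by
  have hi : Integrable f μ := .of_integral_ne_zero (by rw [h]; exact hc.ne')
  rw [← ofReal_integral_eq_lintegral_ofReal hi hf, h]

lemma lintegral_rpow_mul_exp_neg {p b : ℝ} (hp : 0 < p) (hb : 0 < b) :
    ∫⁻ t in Ioi (0 : ℝ), ENNReal.ofReal (t ^ (p - 1) * Real.exp (-(b * t))) =
      ENNReal.ofReal (b ^ (-p) * Real.Gamma p) := by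
  have hG := Real.Gamma_pos_of_pos hp
  refine lintegral_ofReal_of_integral_pos ?_ ?_ (by positivity)
  · refine (ae_restrict_mem measurableSet_Ioi).mono fun t (ht : 0 < t) => by positivity
  · rw [Real.integral_rpow_mul_exp_neg_mul_Ioi hp hb, one_div, Real.inv_rpow hb.le,
      Real.rpow_neg hb.le]

lemma lintegral_rpow_mul_exp_neg_sq {p b : ℝ} (hp : 0 < p) (hb : 0 < b) :
    ∫⁻ r in Ioi (0 : ℝ), ENNReal.ofReal (r ^ (p - 1) * Real.exp (-(b * r ^ 2))) =
      ENNReal.ofReal (b ^ (-(p / 2)) * (Real.Gamma (p / 2) / 2)) := by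
  have hG := Real.Gamma_pos_of_pos (half_pos hp)
  refine lintegral_ofReal_of_integral_pos ?_ ?_ (by positivity)
  · refine (ae_restrict_mem measurableSet_Ioi).mono fun t (ht : 0 < t) => by positivity
  · have := integral_rpow_mul_exp_neg_mul_rpow two_pos (show -1 < p - 1 by linarith) hb
    simp only [Real.rpow_two, sub_add_cancel, neg_mul] at this
    rw [this, neg_div]; ring

lemma lintegral_gaussian {b : ℝ} (hb : 0 < b) (c : ℝ) :
    ∫⁻ s : ℝ, ENNReal.ofReal (Real.exp (-(b * (s + c) ^ 2))) =
      ENNReal.ofReal (Real.sqrt (Real.pi / b)) := by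
  rw [lintegral_add_right_eq_self (fun s : ℝ => ENNReal.ofReal (Real.exp (-(b * s ^ 2)))) c]
  refine lintegral_ofReal_of_integral_pos (Eventually.of_forall fun s => (Real.exp_pos _).le) ?_
    (by positivity)
  simpa using integral_gaussian b

lemma lintegral_Ioi_comp_mul_left {a : ℝ} (ha : 0 < a) (f : ℝ → ℝ≥0∞) :
    ∫⁻ x in Ioi (0 : ℝ), f x = ∫⁻ y in Ioi (0 : ℝ), ENNReal.ofReal a * f (a * y) := by
  have him : (fun y => a * y) '' Ioi (0 : ℝ) = Ioi 0 := by
    ext x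
    constructor
    · rintro ⟨y, hy, rfl⟩; exact mul_pos ha hy
    · intro hx; exact ⟨x / a, div_pos hx ha, by field_simp⟩
  have h := lintegral_image_eq_lintegral_abs_deriv_mul (s := Ioi (0 : ℝ)) (f := fun y => a * y)
    (f' := fun _ => a) measurableSet_Ioi
    (fun x _ => by simpa using ((hasDerivAt_id x).const_mul a).hasDerivWithinAt)
    (mul_right_injective₀ ha.ne').injOn f
  rw [him] at h
  simpa [abs_of_pos ha] using h

/-- The exponential distribution `e^{-α} dα` on `(0, ∞)`. -/
def expDensity : Measure ℝ :=
  (volume.restrict (Ioi (0 : ℝ))).withDensity fun α => ENNReal.ofReal (Real.exp (-α))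

instance : SFinite expDensity := by unfold expDensity; infer_instance

lemma lintegral_expDensity {f : ℝ → ℝ≥0∞} (hf : Measurable f) :
    ∫⁻ α, f α ∂expDensity = ∫⁻ α in Ioi (0 : ℝ), ENNReal.ofReal (Real.exp (-α)) * f α := by
  rw [expDensity, lintegral_withDensity_eq_lintegral_mul _ (by fun_prop) hf]
  rfl

lemma ae_expDensity_pos : ∀ᵐ α ∂expDensity, 0 < α :=
  (withDensity_absolutelyContinuous _ _).ae_le (ae_restrict_mem measurableSet_Ioi)

lemma lintegral_exp_neg_mul {q : ℝ} (hq : -1 < q) :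
    ∫⁻ α, ENNReal.ofReal (Real.exp (-(α * q))) ∂expDensity = ENNReal.ofReal (1 / (q + 1)) := by
  rw [lintegral_expDensity (by fun_prop)]
  have h := lintegral_rpow_mul_exp_neg one_pos (show 0 < q + 1 by linarith)
  simp only [sub_self, Real.rpow_zero, one_mul, Real.Gamma_one, mul_one, Real.rpow_neg_one] at h
  rw [one_div, ← h]
  refine lintegral_congr fun α => ?_
  rw [← ENNReal.ofReal_mul (Real.exp_pos _).le, ← Real.exp_add]
  congr 2; ring

lemma lintegral_besselK (μ : ℝ) {t : ℝ} (ht : 0 < t) :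
    ∫⁻ α, ENNReal.ofReal (α ^ (μ - 1) * Real.exp (-(t / α))) ∂expDensity =
      ENNReal.ofReal (besselK μ t) := by
  rw [lintegral_expDensity (by fun_prop), besselK, ofReal_integral_eq_lintegral_ofReal
    (integrableOn_besselK μ ht)]
  · refine lintegral_congr fun α => ?_
    rw [← ENNReal.ofReal_mul (Real.exp_pos _).le, sub_eq_add_neg (-α), Real.exp_add]
    congr 1; ring
  · exact (ae_restrict_mem measurableSet_Ioi).mono fun α (hα : 0 < α) => by
      show 0 ≤ _
      positivity

lemma besselK_nonneg (μ t : ℝ) : 0 ≤ besselK μ t :=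
  setIntegral_nonneg measurableSet_Ioi fun α (hα : 0 < α) => by positivity

/-! ### The Mellin transform of the square of a modified Bessel function -/

/-- Substituting `β = αy` makes the `α`-integral a Gamma integral with rate `1 + y`. The powers of
`1 + y` then combine to `-2p`, so the remaining integral no longer depends on `s`. -/
lemma lintegral_beta_aux {p s : ℝ} (h : 0 < 2 * p - s) :
    ∫⁻ α, ∫⁻ β, ENNReal.ofReal ((α * β) ^ (p - 1) * (α + β) ^ (-s)) ∂expDensity ∂expDensity =
      ENNReal.ofReal (Real.Gamma (2 * p - s)) *
        ∫⁻ y in Ioi (0 : ℝ), ENNReal.ofReal (y ^ (p - 1) * (1 + y) ^ (-(2 * p))) := by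
  have e1 : ∀ α : ℝ, ∫⁻ β, ENNReal.ofReal ((α * β) ^ (p - 1) * (α + β) ^ (-s)) ∂expDensity =
      ∫⁻ β in Ioi (0 : ℝ), ENNReal.ofReal (Real.exp (-β)) *
        ENNReal.ofReal ((α * β) ^ (p - 1) * (α + β) ^ (-s)) := fun α =>
    lintegral_expDensity (by fun_prop)
  simp_rw [e1]
  rw [lintegral_expDensity (Measurable.lintegral_prod_right' (f := fun z : ℝ × ℝ =>
    ENNReal.ofReal (Real.exp (-z.2)) * ENNReal.ofReal ((z.1 * z.2) ^ (p - 1) * (z.1 + z.2) ^ (-s)))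
    (by fun_prop))]
  have e2 : ∀ α ∈ Ioi (0 : ℝ), ENNReal.ofReal (Real.exp (-α)) * (∫⁻ β in Ioi (0 : ℝ),
      ENNReal.ofReal (Real.exp (-β)) * ENNReal.ofReal ((α * β) ^ (p - 1) * (α + β) ^ (-s))) =
      ∫⁻ y in Ioi (0 : ℝ), ENNReal.ofReal (y ^ (p - 1) * (1 + y) ^ (-s)) *
        ENNReal.ofReal (α ^ (2 * p - s - 1) * Real.exp (-((1 + y) * α))) := by
    intro α (hα : 0 < α)
    rw [lintegral_Ioi_comp_mul_left hα, ← lintegral_const_mul _ (by fun_prop)]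
    refine setLIntegral_congr_fun measurableSet_Ioi fun y (hy : 0 < y) => ?_
    have h1y : 0 < 1 + y := by linarith
    rw [← ENNReal.ofReal_mul (by positivity), ← ENNReal.ofReal_mul (by positivity),
      ← ENNReal.ofReal_mul (by positivity), ← ENNReal.ofReal_mul (by positivity)]
    congr 1
    rw [show α * (α * y) = (α * α) * y by ring, Real.mul_rpow (by positivity) hy.le,
      Real.mul_rpow hα.le hα.le, show α + α * y = α * (1 + y) by ring,
      Real.mul_rpow hα.le h1y.le, show -((1 + y) * α) = -α + -(α * y) by ring, Real.exp_add,
      show 2 * p - s - 1 = (p - 1) + (p - 1) + 1 + -s by ring, Real.rpow_add hα,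
      Real.rpow_add hα, Real.rpow_add hα, Real.rpow_one]
    ring
  rw [setLIntegral_congr_fun measurableSet_Ioi e2, lintegral_lintegral_swap
    (by apply Measurable.aemeasurable; unfold Function.uncurry; fun_prop),
    ← lintegral_const_mul _ (by fun_prop)]
  refine setLIntegral_congr_fun measurableSet_Ioi fun y (hy : 0 < y) => ?_
  have h1y : 0 < 1 + y := by linarith
  have hG := Real.Gamma_pos_of_pos h
  rw [lintegral_const_mul _ (by fun_prop), lintegral_rpow_mul_exp_neg h h1y,
    ← ENNReal.ofReal_mul (by positivity), ← ENNReal.ofReal_mul (by positivity)]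
  congr 1
  rw [show -(2 * p) = -s + -(2 * p - s) by ring, Real.rpow_add h1y]
  ring

/-- The `s`-independent factor is found from `s = 0`, where the double integral splits into `Γ(p)²`;
no separate evaluation of the Beta integral is needed. -/
lemma lintegral_beta {p s : ℝ} (hp : 0 < p) (h : 0 < 2 * p - s) :
    ∫⁻ α, ∫⁻ β, ENNReal.ofReal ((α * β) ^ (p - 1) * (α + β) ^ (-s)) ∂expDensity ∂expDensity =
      ENNReal.ofReal (Real.Gamma (2 * p - s) * (Real.Gamma p ^ 2 / Real.Gamma (2 * p))) := by
  have hG := Real.Gamma_pos_of_pos hp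
  have hG2 := Real.Gamma_pos_of_pos (show 0 < 2 * p by linarith)
  have hGs := Real.Gamma_pos_of_pos h
  have h0 := lintegral_beta_aux (p := p) (s := 0) (by linarith)
  have hg : ∫⁻ α, ENNReal.ofReal (α ^ (p - 1)) ∂expDensity = ENNReal.ofReal (Real.Gamma p) := by
    have := lintegral_rpow_mul_exp_neg hp one_pos
    rw [lintegral_expDensity (by fun_prop)]
    simp only [one_mul, Real.one_rpow] at this
    rw [← this]
    refine lintegral_congr fun α => ?_
    rw [← ENNReal.ofReal_mul (Real.exp_pos _).le, mul_comm]
  have hl : ∫⁻ α, ∫⁻ β, ENNReal.ofReal ((α * β) ^ (p - 1) * (α + β) ^ (-(0 : ℝ)))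
      ∂expDensity ∂expDensity = ENNReal.ofReal (Real.Gamma p ^ 2) := by
    rw [pow_two, ENNReal.ofReal_mul hG.le, ← hg,
      ← lintegral_mul_const _ (by fun_prop)]
    refine lintegral_congr_ae (ae_expDensity_pos.mono fun α hα => ?_)
    simp only
    rw [← lintegral_const_mul _ (by fun_prop)]
    refine lintegral_congr_ae (ae_expDensity_pos.mono fun β hβ => ?_)
    simp only
    rw [Real.mul_rpow hα.le hβ.le, neg_zero, Real.rpow_zero, mul_one,
      ENNReal.ofReal_mul (by positivity)]
  rw [hl, sub_zero] at h0
  set B := ∫⁻ y in Ioi (0 : ℝ), ENNReal.ofReal (y ^ (p - 1) * (1 + y) ^ (-(2 * p))) with hB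
  have hBv : B = ENNReal.ofReal (Real.Gamma p ^ 2 / Real.Gamma (2 * p)) := by
    rw [ENNReal.ofReal_div_of_pos hG2, h0, mul_comm,
      ENNReal.mul_div_cancel_right (by simpa using hG2) ENNReal.ofReal_ne_top]
  rw [lintegral_beta_aux h, ← hB, hBv, ENNReal.ofReal_mul hGs.le]

/-- The Mellin transform of the squared modified Bessel function. -/
def mellinK (ν s : ℝ) : ℝ :=
  Real.sqrt Real.pi * 2 ^ (1 - 2 * (s - ν)) *
    (Real.Gamma s * Real.Gamma (s - ν) * Real.Gamma (s - 2 * ν)) / Real.Gamma (s - ν + 1 / 2)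

lemma measurable_besselK (μ : ℝ) : Measurable (besselK μ) :=
  (StronglyMeasurable.integral_prod_right' (f := fun z : ℝ × ℝ =>
    z.2 ^ (μ - 1) * Real.exp (-z.2 - z.1 / z.2)) (by
      apply Measurable.stronglyMeasurable; fun_prop)).measurable

/-- Inserting the integral for each `K` and doing the `t`-integral first gives `Γ(s) (αβ)^(s-ν-1)
(α+β)^(-s)`, a Beta-type integral with `p = s - ν`. -/
lemma lintegral_besselK_sq {ν s : ℝ} (hs : 0 < s) (h1 : 0 < s - ν) (h2 : 0 < s - 2 * ν) :
    ∫⁻ t in Ioi (0 : ℝ), ENNReal.ofReal (t ^ (s - 1) * besselK (-ν) t ^ 2) =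
      ENNReal.ofReal (mellinK ν s) := by
  have e1 : ∀ t ∈ Ioi (0 : ℝ), ENNReal.ofReal (t ^ (s - 1) * besselK (-ν) t ^ 2) =
      ∫⁻ z : ℝ × ℝ, ENNReal.ofReal (t ^ (s - 1)) *
        (ENNReal.ofReal (z.1 ^ (-ν - 1) * Real.exp (-(t / z.1))) *
        ENNReal.ofReal (z.2 ^ (-ν - 1) * Real.exp (-(t / z.2)))) ∂expDensity.prod expDensity := by
    intro t (ht : 0 < t)
    rw [lintegral_const_mul _ (by fun_prop),
      lintegral_prod_mul (f := fun x : ℝ => ENNReal.ofReal (x ^ (-ν - 1) * Real.exp (-(t / x))))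
        (g := fun x : ℝ => ENNReal.ofReal (x ^ (-ν - 1) * Real.exp (-(t / x))))
        (by fun_prop) (by fun_prop), lintegral_besselK _ ht,
      ← ENNReal.ofReal_mul (besselK_nonneg _ _), ← ENNReal.ofReal_mul (by positivity), pow_two]
  rw [setLIntegral_congr_fun measurableSet_Ioi e1, lintegral_lintegral_swap
    (by apply Measurable.aemeasurable; unfold Function.uncurry; fun_prop)]
  have hG := Real.Gamma_pos_of_pos hs
  have e2 : ∀ᵐ z : ℝ × ℝ ∂expDensity.prod expDensity,
      ∫⁻ t in Ioi (0 : ℝ), ENNReal.ofReal (t ^ (s - 1)) *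
        (ENNReal.ofReal (z.1 ^ (-ν - 1) * Real.exp (-(t / z.1))) *
        ENNReal.ofReal (z.2 ^ (-ν - 1) * Real.exp (-(t / z.2)))) =
      ENNReal.ofReal (Real.Gamma s) *
        ENNReal.ofReal ((z.1 * z.2) ^ (s - ν - 1) * (z.1 + z.2) ^ (-s)) := by
    filter_upwards [Measure.quasiMeasurePreserving_fst.ae ae_expDensity_pos,
      Measure.quasiMeasurePreserving_snd.ae ae_expDensity_pos] with z ha hb
    obtain ⟨α, β⟩ := z
    simp only at ha hb ⊢
    have hx : 0 < (α + β) / (α * β) := by positivity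
    have e3 : ∀ t ∈ Ioi (0 : ℝ), ENNReal.ofReal (t ^ (s - 1)) *
        (ENNReal.ofReal (α ^ (-ν - 1) * Real.exp (-(t / α))) *
        ENNReal.ofReal (β ^ (-ν - 1) * Real.exp (-(t / β)))) =
        ENNReal.ofReal ((α * β) ^ (-ν - 1)) *
          ENNReal.ofReal (t ^ (s - 1) * Real.exp (-((α + β) / (α * β) * t))) := by
      intro t (ht : 0 < t)
      rw [← ENNReal.ofReal_mul (by positivity), ← ENNReal.ofReal_mul (by positivity),
        ← ENNReal.ofReal_mul (by positivity), Real.mul_rpow ha.le hb.le,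
        show -((α + β) / (α * β) * t) = -(t / α) + -(t / β) by field_simp; ring, Real.exp_add]
      congr 1; ring
    rw [setLIntegral_congr_fun measurableSet_Ioi e3, lintegral_const_mul _ (by fun_prop),
      lintegral_rpow_mul_exp_neg hs hx, ← ENNReal.ofReal_mul (by positivity),
      ← ENNReal.ofReal_mul (by positivity)]
    congr 1
    have hab : 0 < α * β := by positivity
    rw [Real.div_rpow (by positivity) hab.le, Real.rpow_neg hab.le s, div_inv_eq_mul,
      show s - ν - 1 = (-ν - 1) + s by ring, Real.rpow_add hab]
    ring
  rw [lintegral_congr_ae e2, lintegral_const_mul _ (by fun_prop), lintegral_prod _ (by fun_prop),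
    lintegral_beta h1 (by linarith), ← ENNReal.ofReal_mul hG.le]
  congr 1
  -- Duplication replaces `Γ(s-ν)² / Γ(2(s-ν))` by a power of `2` and `Γ(s-ν) / Γ(s-ν+1/2)`; this is
  -- the source of the argument `1/4` and of the half-integer shifts in the series.
  have dup := Real.Gamma_mul_Gamma_add_half (s - ν)
  have g1 := Real.Gamma_pos_of_pos h1
  have g2 := Real.Gamma_pos_of_pos (show 0 < s - ν + 1 / 2 by linarith)
  have g3 := Real.Gamma_pos_of_pos (show 0 < 2 * (s - ν) by linarith)
  rw [mellinK, show 2 * (s - ν) - s = s - 2 * ν by ring]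
  generalize Real.Gamma (s - ν + 1 / 2) = x at *
  generalize Real.Gamma (2 * (s - ν)) = y at *
  field_simp
  linear_combination dup

end Banana

end
open scoped BigOperators

noncomputable section

namespace Banana

open MeasureTheory Set Filter Topology
open scoped ENNReal

/-! ### Schwinger parametrisation -/

/-- The product of four exponential distributions, for the Schwinger parameters. -/
def schwingerMeasure : Measure (ℝ × ℝ × ℝ × ℝ) :=
  expDensity.prod (expDensity.prod (expDensity.prod expDensity))

instance : SFinite schwingerMeasure := by unfold schwingerMeasure; infer_instance

/-- The first Symanzik polynomial of the three-loop banana graph. -/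
def symanzik (α : ℝ × ℝ × ℝ × ℝ) : ℝ :=
  α.1 * α.2.1 * α.2.2.1 + α.2.2.2 * (α.1 * α.2.1 + α.1 * α.2.2.1 + α.2.1 * α.2.2.1)

lemma measurable_symanzik : Measurable symanzik := by unfold symanzik; fun_prop

lemma lintegral_schwingerMeasure_mul {f₁ f₂ f₃ f₄ : ℝ → ℝ≥0∞} (h₁ : Measurable f₁)
    (h₂ : Measurable f₂) (h₃ : Measurable f₃) (h₄ : Measurable f₄) :
    ∫⁻ α, f₁ α.1 * (f₂ α.2.1 * (f₃ α.2.2.1 * f₄ α.2.2.2)) ∂schwingerMeasure =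
      (∫⁻ x, f₁ x ∂expDensity) * ((∫⁻ x, f₂ x ∂expDensity) *
        ((∫⁻ x, f₃ x ∂expDensity) * ∫⁻ x, f₄ x ∂expDensity)) := by
  rw [schwingerMeasure, lintegral_prod_mul (f := f₁)
    (g := fun z : ℝ × ℝ × ℝ => f₂ z.1 * (f₃ z.2.1 * f₄ z.2.2)) (by fun_prop) (by fun_prop),
    lintegral_prod_mul (f := f₂) (g := fun z : ℝ × ℝ => f₃ z.1 * f₄ z.2)
      (by fun_prop) (by fun_prop), lintegral_prod_mul (by fun_prop) (by fun_prop)]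

lemma ae_schwingerMeasure_pos :
    ∀ᵐ α ∂schwingerMeasure, 0 < α.1 ∧ 0 < α.2.1 ∧ 0 < α.2.2.1 ∧ 0 < α.2.2.2 := by
  have h2 : ∀ᵐ α ∂expDensity.prod expDensity, 0 < α.1 ∧ 0 < α.2 :=
    (Measure.quasiMeasurePreserving_fst.ae ae_expDensity_pos).and
      (Measure.quasiMeasurePreserving_snd.ae ae_expDensity_pos)
  have h3 : ∀ᵐ α ∂expDensity.prod (expDensity.prod expDensity), 0 < α.1 ∧ 0 < α.2.1 ∧ 0 < α.2.2 :=
    (Measure.quasiMeasurePreserving_fst.ae ae_expDensity_pos).and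
      (Measure.quasiMeasurePreserving_snd.ae h2)
  exact (Measure.quasiMeasurePreserving_fst.ae ae_expDensity_pos).and
      (Measure.quasiMeasurePreserving_snd.ae h3)

lemma symanzik_pos {α : ℝ × ℝ × ℝ × ℝ}
    (h : 0 < α.1 ∧ 0 < α.2.1 ∧ 0 < α.2.2.1 ∧ 0 < α.2.2.2) : 0 < symanzik α := by
  obtain ⟨h1, h2, h3, h4⟩ := h
  unfold symanzik; positivity

/-- The banana integral in position space, as a Mellin transform of `K_{a-1}⁴`. -/
lemma Gamma_mul_lintegral_symanzik {a : ℝ} (ha : 0 < a) :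
    ENNReal.ofReal (Real.Gamma a) *
        ∫⁻ α, ENNReal.ofReal (symanzik α ^ (-a)) ∂schwingerMeasure =
      ∫⁻ t in Ioi (0 : ℝ), ENNReal.ofReal (t ^ (a - 1) * besselK (1 - a) t ^ 4) := by
  have hm : Measurable fun α => ENNReal.ofReal (symanzik α ^ (-a)) :=
    (measurable_symanzik.pow_const _).ennreal_ofReal
  rw [← lintegral_const_mul _ hm]
  have e1 : ∀ t ∈ Ioi (0 : ℝ), ENNReal.ofReal (t ^ (a - 1) * besselK (1 - a) t ^ 4) =
      ∫⁻ α : ℝ × ℝ × ℝ × ℝ, ENNReal.ofReal (t ^ (a - 1)) *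
        (ENNReal.ofReal (α.1 ^ (1 - a - 1) * Real.exp (-(t / α.1))) *
        (ENNReal.ofReal (α.2.1 ^ (1 - a - 1) * Real.exp (-(t / α.2.1))) *
        (ENNReal.ofReal (α.2.2.1 ^ (1 - a - 1) * Real.exp (-(t / α.2.2.1))) *
        ENNReal.ofReal (α.2.2.2 ^ (1 - a - 1) * Real.exp (-(t / α.2.2.2)))))) ∂schwingerMeasure := by
    intro t (ht : 0 < t)
    have hk := besselK_nonneg (1 - a) t
    have hf : Measurable fun x : ℝ => ENNReal.ofReal (x ^ (1 - a - 1) * Real.exp (-(t / x))) := by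
      fun_prop
    rw [lintegral_const_mul _ (by fun_prop), lintegral_schwingerMeasure_mul hf hf hf hf,
      lintegral_besselK _ ht, ← ENNReal.ofReal_mul hk, ← ENNReal.ofReal_mul hk,
      ← ENNReal.ofReal_mul hk, ← ENNReal.ofReal_mul (by positivity)]
    congr 1; ring
  rw [setLIntegral_congr_fun measurableSet_Ioi e1, lintegral_lintegral_swap
    (by apply Measurable.aemeasurable; unfold Function.uncurry; fun_prop)]
  refine lintegral_congr_ae (ae_schwingerMeasure_pos.mono ?_)
  rintro ⟨x, y, z, w⟩ h
  have hU := symanzik_pos h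
  obtain ⟨hx, hy, hz, hw⟩ := h
  simp only at hx hy hz hw ⊢
  have hP : 0 < x * y * z * w := by positivity
  have hq : 0 < symanzik (x, y, z, w) / (x * y * z * w) := by positivity
  -- The exponents combine because `1/x + 1/y + 1/z + 1/w = U / (xyzw)`; the powers of `xyzw` cancel
  -- after the Gamma integral over `t`.
  have e3 : ∀ t ∈ Ioi (0 : ℝ), ENNReal.ofReal (t ^ (a - 1)) *
        (ENNReal.ofReal (x ^ (1 - a - 1) * Real.exp (-(t / x))) *
        (ENNReal.ofReal (y ^ (1 - a - 1) * Real.exp (-(t / y))) *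
        (ENNReal.ofReal (z ^ (1 - a - 1) * Real.exp (-(t / z))) *
        ENNReal.ofReal (w ^ (1 - a - 1) * Real.exp (-(t / w)))))) =
      ENNReal.ofReal ((x * y * z * w) ^ (-a)) * ENNReal.ofReal (t ^ (a - 1) *
        Real.exp (-(symanzik (x, y, z, w) / (x * y * z * w) * t))) := by
    intro t (ht : 0 < t)
    rw [← ENNReal.ofReal_mul (by positivity), ← ENNReal.ofReal_mul (by positivity),
      ← ENNReal.ofReal_mul (by positivity), ← ENNReal.ofReal_mul (by positivity),
      ← ENNReal.ofReal_mul (by positivity), Real.mul_rpow (by positivity) hw.le,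
      Real.mul_rpow (by positivity) hz.le, Real.mul_rpow hx.le hy.le,
      show -(symanzik (x, y, z, w) / (x * y * z * w) * t) =
        -(t / x) + -(t / y) + -(t / z) + -(t / w) by unfold symanzik; field_simp; ring,
      Real.exp_add, Real.exp_add, Real.exp_add, show 1 - a - 1 = -a by ring]
    congr 1; ring
  have hG := Real.Gamma_pos_of_pos ha
  rw [setLIntegral_congr_fun measurableSet_Ioi e3, lintegral_const_mul _ (by fun_prop),
    lintegral_rpow_mul_exp_neg ha hq, ← ENNReal.ofReal_mul (by positivity),
    ← ENNReal.ofReal_mul (by positivity)]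
  congr 1
  rw [Real.div_rpow hU.le hP.le]
  have := Real.rpow_pos_of_pos hP (-a)
  field_simp

/-! ### The momentum integral in adapted coordinates -/

/-- The square of the `i`-th propagator momentum in adapted coordinates. -/
def momentumSq (p : (Fin 3 → ℝ) × (Fin 3 → ℝ)) : ℝ × ℝ × ℝ × ℝ :=
  (p.1 0 ^ 2, p.2 0 ^ 2 + p.1 1 ^ 2, p.2 1 ^ 2 + p.2 2 ^ 2 + p.1 2 ^ 2,
    (-p.1 0 + p.2 0 + p.2 1) ^ 2 + (p.1 1 + p.2 2) ^ 2 + p.1 2 ^ 2)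

/-- The product of the four propagators in adapted coordinates. -/
def propagatorProd (p : (Fin 3 → ℝ) × (Fin 3 → ℝ)) : ℝ :=
  1 / (((momentumSq p).1 + 1) * ((momentumSq p).2.1 + 1) * ((momentumSq p).2.2.1 + 1) *
    ((momentumSq p).2.2.2 + 1))

lemma propagators_frame (p : (Fin 3 → ℝ) × (Fin 3 → ℝ)) :
    propagators (frame p.1 p.2) = (propagatorProd p : ℂ) := by
  rw [propagators, propagatorProd, momentumSq]
  simp [frame, EuclideanSpace.norm_sq_eq, Fin.sum_univ_three]

/-- The radial density `r₀^{d-1} r₁^{d-2} r₂^{d-3}`. -/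
def radialWeight (d : ℝ) (p : (Fin 3 → ℝ) × (Fin 3 → ℝ)) : ℝ :=
  p.1 0 ^ (d - 1) * p.1 1 ^ (d - 2) * p.1 2 ^ (d - 3)

lemma measurable_propagatorProd : Measurable propagatorProd := by
  unfold propagatorProd momentumSq; fun_prop

lemma measurable_radialWeight (d : ℝ) : Measurable (radialWeight d) := by
  unfold radialWeight; fun_prop

lemma propagatorProd_nonneg (p : (Fin 3 → ℝ) × (Fin 3 → ℝ)) : 0 ≤ propagatorProd p := by
  unfold propagatorProd momentumSq; positivity

lemma measurableSet_frameDomain : MeasurableSet frameDomain := by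
  unfold frameDomain; measurability

lemma radialWeight_nonneg (d : ℝ) {p : (Fin 3 → ℝ) × (Fin 3 → ℝ)} (hp : p ∈ frameDomain) :
    0 ≤ radialWeight d p := by
  have h0 : 0 < p.1 0 := hp 0
  have h1 : 0 < p.1 1 := hp 1
  have h2 : 0 < p.1 2 := hp 2
  unfold radialWeight; positivity

lemma lintegral_pi_fin_three (μ : Measure ℝ) [SigmaFinite μ] {g : (Fin 3 → ℝ) → ℝ≥0∞}
    (hg : Measurable g) :
    ∫⁻ x, g x ∂Measure.pi (fun _ : Fin 3 => μ) =
      ∫⁻ a, ∫⁻ b, ∫⁻ c, g ![a, b, c] ∂μ ∂μ ∂μ := by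
  have h3 := (measurePreserving_piFinSuccAbove (fun _ : Fin 3 => μ) 0).symm
  have h2 := (measurePreserving_piFinSuccAbove (fun _ : Fin 2 => μ) 0).symm
  have h1 : MeasurePreserving (MeasurableEquiv.funUnique (Fin 1) ℝ).symm μ
      (Measure.pi fun _ : Fin 1 => μ) := by
    convert (measurePreserving_funUnique μ (Fin 1)).symm
  rw [← h3.lintegral_comp hg, lintegral_prod _ (by fun_prop)]
  refine lintegral_congr fun a => ?_
  rw [← h2.lintegral_comp (by fun_prop), lintegral_prod _ (by fun_prop)]
  refine lintegral_congr fun b => ?_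
  rw [← h1.lintegral_comp (by fun_prop)]
  refine lintegral_congr fun c => ?_
  congr 1
  ext i
  fin_cases i <;> rfl

lemma volume_restrict_frameDomain :
    volume.restrict frameDomain =
      (Measure.pi fun _ : Fin 3 => (volume.restrict (Ioi (0:ℝ)))).prod
        (Measure.pi fun _ : Fin 3 => (volume : Measure ℝ)) := by
  have h : frameDomain = (univ.pi fun _ : Fin 3 => Ioi (0:ℝ)) ×ˢ (univ : Set (Fin 3 → ℝ)) := by
    ext p; simp [frameDomain]
  rw [h, Measure.volume_eq_prod, ← Measure.prod_restrict, Measure.restrict_univ, volume_pi,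
    Measure.restrict_pi_pi]

lemma lintegral_frameDomain {g : (Fin 3 → ℝ) × (Fin 3 → ℝ) → ℝ≥0∞} (hg : Measurable g) :
    ∫⁻ p in frameDomain, g p =
      ∫⁻ x in Ioi (0:ℝ), ∫⁻ y in Ioi (0:ℝ), ∫⁻ z in Ioi (0:ℝ),
        ∫⁻ u : ℝ, ∫⁻ v : ℝ, ∫⁻ w : ℝ, g (![x, y, z], ![u, v, w]) := by
  rw [volume_restrict_frameDomain, lintegral_prod _ hg.aemeasurable,
    lintegral_pi_fin_three _ hg.lintegral_prod_right']
  refine lintegral_congr fun x => lintegral_congr fun y => lintegral_congr fun z => ?_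
  rw [lintegral_pi_fin_three _ (by fun_prop)]

lemma lintegral_gaussian_three {A B c : ℝ} (hA : 0 < A) (hB : 0 < B) (hc : 0 ≤ c)
    (k₁ : ℝ) (k₂ : ℝ → ℝ) (k₃ : ℝ → ℝ → ℝ) :
    ∫⁻ u : ℝ, ∫⁻ v : ℝ, ∫⁻ w : ℝ, ENNReal.ofReal (c * (Real.exp (-(B * (u + k₁) ^ 2)) *
        (Real.exp (-(A * (v + k₂ u) ^ 2)) * Real.exp (-(A * (w + k₃ u v) ^ 2))))) =
      ENNReal.ofReal (c * (Real.sqrt (Real.pi / B) * (Real.pi / A))) := by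
  have e : ∀ u v w : ℝ, ENNReal.ofReal (c * (Real.exp (-(B * (u + k₁) ^ 2)) *
        (Real.exp (-(A * (v + k₂ u) ^ 2)) * Real.exp (-(A * (w + k₃ u v) ^ 2))))) =
      ENNReal.ofReal c * (ENNReal.ofReal (Real.exp (-(B * (u + k₁) ^ 2))) *
        (ENNReal.ofReal (Real.exp (-(A * (v + k₂ u) ^ 2))) *
          ENNReal.ofReal (Real.exp (-(A * (w + k₃ u v) ^ 2))))) := fun u v w => by
    rw [ENNReal.ofReal_mul hc, ENNReal.ofReal_mul (Real.exp_pos _).le,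
      ENNReal.ofReal_mul (Real.exp_pos _).le]
  have hAA : Real.pi / A = Real.sqrt (Real.pi / A) * Real.sqrt (Real.pi / A) :=
    (Real.mul_self_sqrt (by positivity)).symm
  simp_rw [e]
  have e1 : ∀ u v : ℝ, ∫⁻ w : ℝ, ENNReal.ofReal c *
      (ENNReal.ofReal (Real.exp (-(B * (u + k₁) ^ 2))) *
        (ENNReal.ofReal (Real.exp (-(A * (v + k₂ u) ^ 2))) *
          ENNReal.ofReal (Real.exp (-(A * (w + k₃ u v) ^ 2))))) =
      (ENNReal.ofReal c * (ENNReal.ofReal (Real.exp (-(B * (u + k₁) ^ 2))) *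
        ENNReal.ofReal (Real.sqrt (Real.pi / A)))) *
        ENNReal.ofReal (Real.exp (-(A * (v + k₂ u) ^ 2))) := fun u v => by
    rw [lintegral_const_mul _ (by fun_prop), lintegral_const_mul _ (by fun_prop),
      lintegral_const_mul _ (by fun_prop), lintegral_gaussian hA]
    ring
  simp_rw [e1]
  have e2 : ∀ u : ℝ, ∫⁻ v : ℝ, (ENNReal.ofReal c *
      (ENNReal.ofReal (Real.exp (-(B * (u + k₁) ^ 2))) *
        ENNReal.ofReal (Real.sqrt (Real.pi / A)))) *
        ENNReal.ofReal (Real.exp (-(A * (v + k₂ u) ^ 2))) =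
      (ENNReal.ofReal c * (ENNReal.ofReal (Real.sqrt (Real.pi / A)) *
        ENNReal.ofReal (Real.sqrt (Real.pi / A)))) *
        ENNReal.ofReal (Real.exp (-(B * (u + k₁) ^ 2))) := fun u => by
    rw [lintegral_const_mul _ (by fun_prop), lintegral_gaussian hA]
    ring
  simp_rw [e2]
  rw [lintegral_const_mul _ (by fun_prop), lintegral_gaussian hB,
    ← ENNReal.ofReal_mul (by positivity), ← ENNReal.ofReal_mul hc,
    ← ENNReal.ofReal_mul (by positivity)]
  congr 1
  linear_combination (-(c * Real.sqrt (Real.pi / B))) * hAA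

/-- The constant `∏ⱼ ½ Γ((d-j)/2) π^{1/2}` of the radial Gaussian integrals. -/
def radialConst (d : ℝ) : ℝ :=
  (Real.Gamma (d / 2) / 2) * (Real.Gamma ((d - 1) / 2) / 2) * (Real.Gamma ((d - 2) / 2) / 2) *
    (Real.sqrt Real.pi * Real.pi)

/-- Completing squares successively in the third, second and first momentum diagonalises the
quadratic form with pivots `A`, `E/A` and `Δ/E`. In each direction the radial power and the Gaussian
parallel components together contribute the pivot to the power `-d/2`, and the product of the pivots
telescopes to `Δ`, the Symanzik polynomial. -/
lemma lintegral_radialWeight_mul_exp {d : ℝ} (hd : 2 < d) {α : ℝ × ℝ × ℝ × ℝ}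
    (h : 0 < α.1 ∧ 0 < α.2.1 ∧ 0 < α.2.2.1 ∧ 0 < α.2.2.2) :
    ∫⁻ p in frameDomain, ENNReal.ofReal (radialWeight d p * Real.exp
        (-(α.1 * (momentumSq p).1 + α.2.1 * (momentumSq p).2.1 +
          α.2.2.1 * (momentumSq p).2.2.1 + α.2.2.2 * (momentumSq p).2.2.2))) =
      ENNReal.ofReal (radialConst d * symanzik α ^ (-(d / 2))) := by
  have hU := symanzik_pos h
  obtain ⟨a₁, a₂, a₃, a₄⟩ := α
  obtain ⟨h1, h2, h3, h4⟩ := h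
  simp only at h1 h2 h3 h4 ⊢
  have hm : Measurable momentumSq := by unfold momentumSq; fun_prop
  have hw := measurable_radialWeight d
  rw [lintegral_frameDomain (by fun_prop)]
  set A := a₃ + a₄ with hA
  set E := a₂ * a₃ + a₂ * a₄ + a₃ * a₄ with hE
  set Δ := symanzik (a₁, a₂, a₃, a₄) with hΔ
  have hΔ' : Δ = a₁ * E + a₂ * a₃ * a₄ := by rw [hΔ, symanzik, hE]; ring
  have hA0 : 0 < A := by positivity
  have hE0 : 0 < E := by positivity
  have hB0 : 0 < E / A := by positivity
  have hexp : ∀ x y z u v w : ℝ, radialWeight d (![x, y, z], ![u, v, w]) * Real.exp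
      (-(a₁ * (momentumSq (![x, y, z], ![u, v, w])).1 +
        a₂ * (momentumSq (![x, y, z], ![u, v, w])).2.1 +
        a₃ * (momentumSq (![x, y, z], ![u, v, w])).2.2.1 +
        a₄ * (momentumSq (![x, y, z], ![u, v, w])).2.2.2)) =
      (x ^ (d - 1) * Real.exp (-(Δ / E * x ^ 2)) * (y ^ (d - 2) * Real.exp (-(E / A * y ^ 2))) *
        (z ^ (d - 3) * Real.exp (-(A * z ^ 2)))) *
      (Real.exp (-(E / A * (u + -(a₃ * a₄ * x / E)) ^ 2)) *
        (Real.exp (-(A * (v + a₄ * (u - x) / A) ^ 2)) *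
          Real.exp (-(A * (w + a₄ * y / A) ^ 2)))) := by
    intro x y z u v w
    have e : -(a₁ * (momentumSq (![x, y, z], ![u, v, w])).1 +
        a₂ * (momentumSq (![x, y, z], ![u, v, w])).2.1 +
        a₃ * (momentumSq (![x, y, z], ![u, v, w])).2.2.1 +
        a₄ * (momentumSq (![x, y, z], ![u, v, w])).2.2.2) =
      -(Δ / E * x ^ 2) + -(E / A * y ^ 2) + -(A * z ^ 2) + (-(E / A * (u + -(a₃ * a₄ * x / E)) ^ 2)
        + (-(A * (v + a₄ * (u - x) / A) ^ 2) + -(A * (w + a₄ * y / A) ^ 2))) := by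
      simp only [momentumSq, Matrix.cons_val_zero, Matrix.cons_val_one, Matrix.cons_val]
      rw [hΔ']
      field_simp
      rw [hA, hE]
      ring
    rw [e, Real.exp_add, Real.exp_add, Real.exp_add, Real.exp_add, Real.exp_add]
    simp only [radialWeight, Matrix.cons_val_zero, Matrix.cons_val_one, Matrix.cons_val]
    ring
  simp_rw [hexp]
  set c₀ := Real.sqrt (Real.pi / (E / A)) * (Real.pi / A) with hc₀
  have hc₀0 : 0 ≤ c₀ := by positivity
  have l1 := lintegral_rpow_mul_exp_neg_sq (show 0 < d by linarith) (show 0 < Δ / E by positivity)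
  have l2 := lintegral_rpow_mul_exp_neg_sq (show 0 < d - 1 by linarith) hB0
  have l3 := lintegral_rpow_mul_exp_neg_sq (show 0 < d - 2 by linarith) hA0
  rw [show d - 1 - 1 = d - 2 by ring] at l2
  rw [show d - 2 - 1 = d - 3 by ring] at l3
  have s1 : ∀ x ∈ Ioi (0:ℝ), ∀ y ∈ Ioi (0:ℝ), ∀ z ∈ Ioi (0:ℝ),
      ∫⁻ u : ℝ, ∫⁻ v : ℝ, ∫⁻ w : ℝ, ENNReal.ofReal
      ((x ^ (d - 1) * Real.exp (-(Δ / E * x ^ 2)) * (y ^ (d - 2) * Real.exp (-(E / A * y ^ 2))) *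
        (z ^ (d - 3) * Real.exp (-(A * z ^ 2)))) *
      (Real.exp (-(E / A * (u + -(a₃ * a₄ * x / E)) ^ 2)) *
        (Real.exp (-(A * (v + a₄ * (u - x) / A) ^ 2)) *
          Real.exp (-(A * (w + a₄ * y / A) ^ 2))))) =
      ENNReal.ofReal (x ^ (d - 1) * Real.exp (-(Δ / E * x ^ 2))) *
        (ENNReal.ofReal (y ^ (d - 2) * Real.exp (-(E / A * y ^ 2))) *
          (ENNReal.ofReal c₀ * ENNReal.ofReal (z ^ (d - 3) * Real.exp (-(A * z ^ 2))))) := by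
    intro x hx y hy z hz
    have hx : 0 < x := hx
    have hy : 0 < y := hy
    have hz : 0 < z := hz
    rw [lintegral_gaussian_three hA0 hB0 (by positivity) _ (fun u => a₄ * (u - x) / A)
      (fun _ _ => a₄ * y / A), ← ENNReal.ofReal_mul hc₀0, ← ENNReal.ofReal_mul (by positivity),
      ← ENNReal.ofReal_mul (by positivity)]
    congr 1; ring
  have s2 : ∀ x ∈ Ioi (0:ℝ), ∀ y ∈ Ioi (0:ℝ), _ := fun x hx y hy =>
    setLIntegral_congr_fun (μ := volume) measurableSet_Ioi (s1 x hx y hy)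
  have s3 : ∀ x ∈ Ioi (0:ℝ), _ := fun x hx =>
    setLIntegral_congr_fun (μ := volume) measurableSet_Ioi (s2 x hx)
  rw [setLIntegral_congr_fun measurableSet_Ioi s3]
  simp_rw [lintegral_const_mul' _ _ ENNReal.ofReal_ne_top, l3]
  have hm2 : Measurable fun y : ℝ => ENNReal.ofReal (y ^ (d - 2) * Real.exp (-(E / A * y ^ 2))) := by
    fun_prop
  have hm1 : Measurable fun x : ℝ => ENNReal.ofReal (x ^ (d - 1) * Real.exp (-(Δ / E * x ^ 2))) := by
    fun_prop
  rw [lintegral_mul_const _ hm2, l2, lintegral_mul_const _ hm1, l1]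
  have g1 := Real.Gamma_pos_of_pos (show 0 < d / 2 by linarith)
  have g2 := Real.Gamma_pos_of_pos (show 0 < (d - 1) / 2 by linarith)
  have g3 := Real.Gamma_pos_of_pos (show 0 < (d - 2) / 2 by linarith)
  rw [← ENNReal.ofReal_mul hc₀0, ← ENNReal.ofReal_mul (by positivity),
    ← ENNReal.ofReal_mul (by positivity)]
  congr 1
  have r1 : (Δ / E) ^ (-(d / 2)) = Δ ^ (-(d / 2)) * E ^ (d / 2) := by
    rw [Real.div_rpow hU.le hE0.le, Real.rpow_neg hE0.le, div_inv_eq_mul]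
  have r2 : (E / A) ^ (-((d - 1) / 2)) = E ^ (-(d / 2)) * E ^ (1 / 2 : ℝ) * A ^ ((d - 1) / 2) := by
    rw [Real.div_rpow hE0.le hA0.le, Real.rpow_neg hA0.le, div_inv_eq_mul, ← Real.rpow_add hE0]
    congr 2; ring
  have r3 : A ^ (-((d - 2) / 2)) = A ^ (-((d - 1) / 2)) * A ^ (1 / 2 : ℝ) := by
    rw [← Real.rpow_add hA0]; congr 1; ring
  have r4 : c₀ = Real.sqrt Real.pi * Real.pi * (A ^ (1 / 2 : ℝ))⁻¹ * (E ^ (1 / 2 : ℝ))⁻¹ := by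
    rw [hc₀, ← Real.sqrt_eq_rpow, ← Real.sqrt_eq_rpow, div_div_eq_mul_div,
      Real.sqrt_div' _ hE0.le, Real.sqrt_mul' _ hA0.le]
    have hs := Real.mul_self_sqrt hA0.le
    have hs0 := Real.sqrt_pos.2 hA0
    have hs1 := Real.sqrt_pos.2 hE0
    field_simp
    rw [pow_two, hs]
  rw [r1, r2, r3, r4, radialConst, Real.rpow_neg hE0.le (d / 2), Real.rpow_neg hA0.le ((d - 1) / 2)]
  have q1 := Real.rpow_pos_of_pos hE0 (d / 2)
  have q2 := Real.rpow_pos_of_pos hE0 (1 / 2)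
  have q3 := Real.rpow_pos_of_pos hA0 ((d - 1) / 2)
  have q4 := Real.rpow_pos_of_pos hA0 (1 / 2)
  field_simp

lemma ofReal_propagatorProd (p : (Fin 3 → ℝ) × (Fin 3 → ℝ)) :
    ENNReal.ofReal (propagatorProd p) =
      ∫⁻ α, ENNReal.ofReal (Real.exp
        (-(α.1 * (momentumSq p).1 + α.2.1 * (momentumSq p).2.1 +
          α.2.2.1 * (momentumSq p).2.2.1 + α.2.2.2 * (momentumSq p).2.2.2))) ∂schwingerMeasure := by
  have q1 : 0 ≤ (momentumSq p).1 := by unfold momentumSq; positivity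
  have q2 : 0 ≤ (momentumSq p).2.1 := by unfold momentumSq; positivity
  have q3 : 0 ≤ (momentumSq p).2.2.1 := by unfold momentumSq; positivity
  have q4 : 0 ≤ (momentumSq p).2.2.2 := by unfold momentumSq; positivity
  have e : ∀ α : ℝ × ℝ × ℝ × ℝ, ENNReal.ofReal (Real.exp
        (-(α.1 * (momentumSq p).1 + α.2.1 * (momentumSq p).2.1 +
          α.2.2.1 * (momentumSq p).2.2.1 + α.2.2.2 * (momentumSq p).2.2.2))) =
      ENNReal.ofReal (Real.exp (-(α.1 * (momentumSq p).1))) *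
        (ENNReal.ofReal (Real.exp (-(α.2.1 * (momentumSq p).2.1))) *
          (ENNReal.ofReal (Real.exp (-(α.2.2.1 * (momentumSq p).2.2.1))) *
            ENNReal.ofReal (Real.exp (-(α.2.2.2 * (momentumSq p).2.2.2))))) := fun α => by
    rw [← ENNReal.ofReal_mul (Real.exp_pos _).le, ← ENNReal.ofReal_mul (Real.exp_pos _).le,
      ← ENNReal.ofReal_mul (Real.exp_pos _).le, ← Real.exp_add, ← Real.exp_add, ← Real.exp_add]
    congr 2; ring
  simp_rw [e]
  have hm : ∀ q : ℝ, Measurable fun x : ℝ => ENNReal.ofReal (Real.exp (-(x * q))) := fun q => by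
    fun_prop
  rw [lintegral_schwingerMeasure_mul (hm _) (hm _) (hm _) (hm _),
    lintegral_exp_neg_mul (by linarith), lintegral_exp_neg_mul (by linarith),
    lintegral_exp_neg_mul (by linarith), lintegral_exp_neg_mul (by linarith),
    ← ENNReal.ofReal_mul (by positivity), ← ENNReal.ofReal_mul (by positivity),
    ← ENNReal.ofReal_mul (by positivity)]
  congr 1
  rw [propagatorProd]
  field_simp

lemma lintegral_radialWeight_mul_propagatorProd {d : ℝ} (hd : 2 < d) :
    ∫⁻ p in frameDomain, ENNReal.ofReal (radialWeight d p * propagatorProd p) =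
      ENNReal.ofReal (radialConst d) *
        ∫⁻ α, ENNReal.ofReal (symanzik α ^ (-(d / 2))) ∂schwingerMeasure := by
  have hm : Measurable momentumSq := by unfold momentumSq; fun_prop
  have hw := measurable_radialWeight d
  have hs : Measurable fun α => ENNReal.ofReal (symanzik α ^ (-(d / 2))) :=
    (measurable_symanzik.pow_const _).ennreal_ofReal
  have e1 : ∀ p ∈ frameDomain, ENNReal.ofReal (radialWeight d p * propagatorProd p) =
      ∫⁻ α, ENNReal.ofReal (radialWeight d p * Real.exp
        (-(α.1 * (momentumSq p).1 + α.2.1 * (momentumSq p).2.1 +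
          α.2.2.1 * (momentumSq p).2.2.1 + α.2.2.2 * (momentumSq p).2.2.2)))
        ∂schwingerMeasure := by
    intro p hp
    have h0 := radialWeight_nonneg d hp
    simp_rw [ENNReal.ofReal_mul h0]
    rw [lintegral_const_mul' _ _ ENNReal.ofReal_ne_top, ofReal_propagatorProd]
  rw [setLIntegral_congr_fun measurableSet_frameDomain e1, lintegral_lintegral_swap
    (by apply Measurable.aemeasurable; unfold Function.uncurry; fun_prop),
    ← lintegral_const_mul _ hs]
  have hc : 0 ≤ radialConst d := by
    have g1 := Real.Gamma_pos_of_pos (show 0 < d / 2 by linarith)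
    have g2 := Real.Gamma_pos_of_pos (show 0 < (d - 1) / 2 by linarith)
    have g3 := Real.Gamma_pos_of_pos (show 0 < (d - 2) / 2 by linarith)
    unfold radialConst; positivity
  refine lintegral_congr_ae (ae_schwingerMeasure_pos.mono fun α hα => ?_)
  simp only
  rw [lintegral_radialWeight_mul_exp hd hα, ENNReal.ofReal_mul hc]

end Banana

end
open scoped BigOperators

noncomputable section

namespace Banana

open MeasureTheory Set Filter Topology
open scoped ENNReal

/-! ### Evaluation of the Bessel moment by double series -/

/-- The coefficients of the double series for the Mellin transform of `I_{b-1} I_{b'-1} K_ν²`. -/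
def mellinTerm (ν s b b' : ℝ) (p : ℕ × ℕ) : ℝ :=
  mellinK ν (s + (p.1 + p.2 : ℕ)) /
    ((p.1.factorial * Real.Gamma (b + p.1)) * (p.2.factorial * Real.Gamma (b' + p.2)))

/-- The prefactor of the double series for the Mellin transform of `I_{b-1} I_{b'-1} K_ν²`. -/
def mellinConst (ν s : ℝ) : ℝ :=
  Real.sqrt Real.pi * 2 ^ (1 - 2 * (s - ν)) *
    (Real.Gamma s * Real.Gamma (s - ν) * Real.Gamma (s - 2 * ν))

lemma ofReal_Gamma_mul_poch {x : ℝ} (hx : 0 < x) (n : ℕ) :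
    ((Real.Gamma (x + n) : ℝ) : ℂ) = (Real.Gamma x : ℝ) * poch x n := by
  rw [← Complex.Gamma_ofReal, ← Complex.Gamma_ofReal, Gamma_mul_poch]
  · push_cast; rfl
  · intro k h
    have h' : x = -(k : ℝ) := by exact_mod_cast h
    linarith [(Nat.cast_nonneg k : (0:ℝ) ≤ k)]

lemma ofReal_mellinTerm {ν s b b' : ℝ} (h0 : 0 < s) (h1 : 0 < s - ν) (h2 : 0 < s - 2 * ν)
    (p : ℕ × ℕ) :
    ((mellinTerm ν s b b' p : ℝ) : ℂ) = (mellinConst ν s : ℝ) *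
      rterm s (s - ν : ℝ) (s - 2 * ν : ℝ) b' (s - ν + 1 / 2 : ℝ) b p.1 p.2 := by
  obtain ⟨m, n⟩ := p
  have e2 : (2 : ℝ) ^ (1 - 2 * (s + (m + n : ℕ) - ν)) =
      2 ^ (1 - 2 * (s - ν)) * (1 / 4) ^ (m + n) := by
    rw [show 1 - 2 * (s + (m + n : ℕ) - ν) = (1 - 2 * (s - ν)) - ((2 * (m + n) : ℕ) : ℝ) by
      push_cast; ring, Real.rpow_sub two_pos, Real.rpow_natCast, pow_mul, div_eq_mul_inv,
      one_div, inv_pow]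
    norm_num
  have e3 : mellinK ν (s + (m + n : ℕ)) = Real.sqrt Real.pi * (2 ^ (1 - 2 * (s - ν)) *
      (1 / 4) ^ (m + n)) * (Real.Gamma (s + (m + n : ℕ)) * Real.Gamma (s - ν + (m + n : ℕ)) *
      Real.Gamma (s - 2 * ν + (m + n : ℕ))) / Real.Gamma (s - ν + 1 / 2 + (m + n : ℕ)) := by
    rw [mellinK, e2, show s + (m + n : ℕ) - ν + 1 / 2 = s - ν + 1 / 2 + (m + n : ℕ) by ring,
      show s + (m + n : ℕ) - 2 * ν = s - 2 * ν + (m + n : ℕ) by ring,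
      show s + (m + n : ℕ) - ν = s - ν + (m + n : ℕ) by ring]
  rw [mellinTerm, e3, rterm, mellinConst]
  have g1 := ofReal_Gamma_mul_poch h0 (m + n)
  have g2 := ofReal_Gamma_mul_poch h1 (m + n)
  have g3 := ofReal_Gamma_mul_poch h2 (m + n)
  have c1 : ∀ (x : ℝ) (j : ℕ), Complex.Gamma ((x : ℂ) + j) = ((Real.Gamma (x + j) : ℝ) : ℂ) :=
    fun x j => by rw [← Complex.Gamma_ofReal]; push_cast; rfl
  rw [c1, c1, c1]
  generalize Real.Gamma (s + (m + n : ℕ)) = G₁ at *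
  generalize Real.Gamma (s - ν + (m + n : ℕ)) = G₂ at *
  generalize Real.Gamma (s - 2 * ν + (m + n : ℕ)) = G₃ at *
  generalize Real.Gamma (s - ν + 1 / 2 + (m + n : ℕ)) = G₄ at *
  generalize Real.Gamma (b + m) = G₅ at *
  generalize Real.Gamma (b' + n) = G₆ at *
  generalize (2 : ℝ) ^ (1 - 2 * (s - ν)) = x at *
  generalize poch (s : ℂ) (m + n) = P₁ at *
  generalize poch ((s - ν : ℝ) : ℂ) (m + n) = P₂ at *
  generalize poch ((s - 2 * ν : ℝ) : ℂ) (m + n) = P₃ at *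
  rw [Complex.ofReal_div, Complex.ofReal_div, Complex.ofReal_mul _ (G₁ * G₂ * G₃),
    Complex.ofReal_mul _ G₃, Complex.ofReal_mul G₁ G₂, g1, g2, g3]
  push_cast
  simp only [div_eq_mul_inv, mul_inv]
  ring

/-- The parameter excess of the corresponding `rterm` series is `2s - 2ν - b - b' - 1/2`, so the
hypothesis is the criterion of `summable_rterm`. -/
lemma summable_mellinTerm {ν s b b' : ℝ} (h0 : 0 < s) (h1 : 0 < s - ν) (h2 : 0 < s - 2 * ν)
    (hs : 2 * s - 2 * ν < b + b') : Summable (mellinTerm ν s b b') := by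
  rw [← Complex.summable_ofReal]
  simp_rw [ofReal_mellinTerm h0 h1 h2]
  refine (summable_rterm ?_).mul_left _
  simp
  linarith

lemma mellinK_nonneg {ν s : ℝ} (h0 : 0 < s) (h1 : 0 < s - ν) (h2 : 0 < s - 2 * ν) :
    0 ≤ mellinK ν s := by
  have g0 := Real.Gamma_pos_of_pos h0
  have g1 := Real.Gamma_pos_of_pos h1
  have g2 := Real.Gamma_pos_of_pos h2
  have g3 := Real.Gamma_pos_of_pos (show 0 < s - ν + 1 / 2 by linarith)
  unfold mellinK; positivity

lemma mellinTerm_nonneg {ν s b b' : ℝ} (h0 : 0 < s) (h1 : 0 < s - ν) (h2 : 0 < s - 2 * ν)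
    (hb : 0 < b) (hb' : 0 < b') (p : ℕ × ℕ) : 0 ≤ mellinTerm ν s b b' p := by
  have hN : (0 : ℝ) ≤ (p.1 + p.2 : ℕ) := Nat.cast_nonneg _
  have := mellinK_nonneg (ν := ν) (s := s + (p.1 + p.2 : ℕ)) (by linarith) (by linarith)
    (by linarith)
  have g1 := Real.Gamma_pos_of_pos (show 0 < b + p.1 by positivity)
  have g2 := Real.Gamma_pos_of_pos (show 0 < b' + p.2 by positivity)
  unfold mellinTerm; positivity

lemma measurable_besselI {b : ℝ} (hb : 0 < b) : Measurable (besselI b) :=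
  (continuous_iff_continuousAt.2 fun t => (hasDerivAt_besselI hb t).continuousAt).measurable

/-- Both power series have nonnegative terms, so they may be multiplied out and integrated term by
term; each term is a Mellin transform of `K²` at `s + m + n`. -/
lemma lintegral_besselI_mul_besselI_mul_besselK_sq {ν s b b' : ℝ} (h0 : 0 < s) (h1 : 0 < s - ν)
    (h2 : 0 < s - 2 * ν) (hb : 0 < b) (hb' : 0 < b') (hs : 2 * s - 2 * ν < b + b') :
    ∫⁻ t in Ioi (0 : ℝ), ENNReal.ofReal
        (t ^ (s - 1) * (besselI b t * besselI b' t) * besselK (-ν) t ^ 2) =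
      ENNReal.ofReal (∑' p, mellinTerm ν s b b' p) := by
  have hmK := measurable_besselK (-ν)
  have e1 : ∀ t ∈ Ioi (0 : ℝ), ENNReal.ofReal
        (t ^ (s - 1) * (besselI b t * besselI b' t) * besselK (-ν) t ^ 2) =
      ∑' p : ℕ × ℕ, ENNReal.ofReal (((p.1.factorial * Real.Gamma (b + p.1)) *
        (p.2.factorial * Real.Gamma (b' + p.2)))⁻¹ *
        (t ^ (s + (p.1 + p.2 : ℕ) - 1) * besselK (-ν) t ^ 2)) := by
    intro t (ht : 0 < t)
    have sb := summable_besselI hb t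
    have sb' := summable_besselI hb' t
    have gb : ∀ n : ℕ, 0 < Real.Gamma (b + n) := fun n => Real.Gamma_pos_of_pos (by positivity)
    have gb' : ∀ n : ℕ, 0 < Real.Gamma (b' + n) := fun n => Real.Gamma_pos_of_pos (by positivity)
    have hprod : Summable fun p : ℕ × ℕ => t ^ p.1 / (p.1.factorial * Real.Gamma (b + p.1)) *
        (t ^ p.2 / (p.2.factorial * Real.Gamma (b' + p.2))) :=
      sb.mul_of_nonneg sb' (fun n => by have := gb n; simp only [Pi.zero_apply]; positivity)
        (fun n => by have := gb' n; simp only [Pi.zero_apply]; positivity)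
    have e : ∀ p : ℕ × ℕ, ((p.1.factorial * Real.Gamma (b + p.1)) *
        (p.2.factorial * Real.Gamma (b' + p.2)))⁻¹ *
        (t ^ (s + (p.1 + p.2 : ℕ) - 1) * besselK (-ν) t ^ 2) =
        (t ^ (s - 1) * besselK (-ν) t ^ 2) * (t ^ p.1 / (p.1.factorial * Real.Gamma (b + p.1)) *
        (t ^ p.2 / (p.2.factorial * Real.Gamma (b' + p.2)))) := fun p => by
      rw [show s + (p.1 + p.2 : ℕ) - 1 = (s - 1) + (p.1 + p.2 : ℕ) by ring, Real.rpow_add ht,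
        Real.rpow_natCast, pow_add]
      have := gb p.1
      have := gb' p.2
      field_simp
    simp_rw [e]
    rw [← ENNReal.ofReal_tsum_of_nonneg _ (hprod.mul_left _), tsum_mul_left,
      besselI, besselI, sb.tsum_mul_tsum sb' hprod]
    · congr 1; ring
    · intro p
      have := gb p.1
      have := gb' p.2
      positivity
  rw [setLIntegral_congr_fun measurableSet_Ioi e1, lintegral_tsum fun p => by
    apply Measurable.aemeasurable; fun_prop,
    ENNReal.ofReal_tsum_of_nonneg (mellinTerm_nonneg h0 h1 h2 hb hb')
      (summable_mellinTerm h0 h1 h2 hs)]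
  refine tsum_congr fun p => ?_
  have hN : (0 : ℝ) ≤ (p.1 + p.2 : ℕ) := Nat.cast_nonneg _
  have g1 := Real.Gamma_pos_of_pos (show 0 < b + p.1 by positivity)
  have g2 := Real.Gamma_pos_of_pos (show 0 < b' + p.2 by positivity)
  have hk : 0 ≤ ((p.1.factorial * Real.Gamma (b + p.1)) *
        (p.2.factorial * Real.Gamma (b' + p.2)))⁻¹ := by positivity
  simp_rw [ENNReal.ofReal_mul hk]
  rw [lintegral_const_mul _ (by fun_prop), lintegral_besselK_sq (by linarith) (by linarith)
    (by linarith), ← ENNReal.ofReal_mul hk, mellinTerm]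
  congr 1
  rw [div_eq_mul_inv, mul_comm]

/-- The fourth moment of the modified Bessel function. -/
lemma lintegral_besselK_pow_four {ν : ℝ} (h0 : 0 < ν) (h1 : ν < 1 / 3) :
    ∫⁻ t in Ioi (0 : ℝ), ENNReal.ofReal (t ^ ν * besselK (-ν) t ^ 4) =
      ENNReal.ofReal ((Real.Gamma ν * Real.Gamma (1 - ν)) ^ 2 *
        ((∑' p, mellinTerm ν (1 + ν) (1 + ν) (1 + ν) p) +
          (∑' p, mellinTerm ν (1 - ν) (1 - ν) (1 - ν) p) -
          2 * ∑' p, mellinTerm ν 1 (1 + ν) (1 - ν) p)) ∧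
    0 ≤ (Real.Gamma ν * Real.Gamma (1 - ν)) ^ 2 *
        ((∑' p, mellinTerm ν (1 + ν) (1 + ν) (1 + ν) p) +
          (∑' p, mellinTerm ν (1 - ν) (1 - ν) (1 - ν) p) -
          2 * ∑' p, mellinTerm ν 1 (1 + ν) (1 - ν) p) := by
  set c := Real.Gamma ν * Real.Gamma (1 - ν) with hc
  have hc0 : 0 < c := mul_pos (Real.Gamma_pos_of_pos h0) (Real.Gamma_pos_of_pos (by linarith))
  have b1 : 0 < 1 + ν := by linarith
  have b2 : 0 < 1 - ν := by linarith
  -- The products carry `t^ν`, `t^0` and `t^(-ν)`, hence `s = 1 + ν`, `1`, `1 - ν`. The last one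
  -- requires `s - 2ν = 1 - 3ν > 0`, the origin of `ν < 1/3`.
  have L1 := lintegral_besselI_mul_besselI_mul_besselK_sq (ν := ν) (s := 1 + ν) (by linarith)
    (by linarith) (by linarith) b1 b1 (by linarith)
  have L2 := lintegral_besselI_mul_besselI_mul_besselK_sq (ν := ν) (s := 1) (by linarith)
    (by linarith) (by linarith) b1 b2 (by linarith)
  have L3 := lintegral_besselI_mul_besselI_mul_besselK_sq (ν := ν) (s := 1 - ν) (by linarith)
    (by linarith) (by linarith) b2 b2 (by linarith)
  have p1 : 0 ≤ ∑' p, mellinTerm ν (1 + ν) (1 + ν) (1 + ν) p := tsum_nonneg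
    (mellinTerm_nonneg (by linarith) (by linarith) (by linarith) b1 b1)
  have p2 : 0 ≤ ∑' p, mellinTerm ν 1 (1 + ν) (1 - ν) p := tsum_nonneg
    (mellinTerm_nonneg (by linarith) (by linarith) (by linarith) b1 b2)
  have p3 : 0 ≤ ∑' p, mellinTerm ν (1 - ν) (1 - ν) (1 - ν) p := tsum_nonneg
    (mellinTerm_nonneg (by linarith) (by linarith) (by linarith) b2 b2)
  set S1 := ∑' p, mellinTerm ν (1 + ν) (1 + ν) (1 + ν) p
  set S2 := ∑' p, mellinTerm ν 1 (1 + ν) (1 - ν) p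
  set S3 := ∑' p, mellinTerm ν (1 - ν) (1 - ν) (1 - ν) p
  have m1 := measurable_besselI b1
  have m2 := measurable_besselI b2
  have mK := measurable_besselK (-ν)
  -- The negative cross term of the square is moved to the left, since subtraction in `[0, ∞]` is
  -- truncated.
  have key : (∫⁻ t in Ioi (0 : ℝ), ENNReal.ofReal (t ^ ν * besselK (-ν) t ^ 4)) +
      ENNReal.ofReal (2 * c ^ 2 * S2) = ENNReal.ofReal (c ^ 2 * S1) +
        ENNReal.ofReal (c ^ 2 * S3) := by
    rw [ENNReal.ofReal_mul (p := 2 * c ^ 2) (by positivity), ← L2,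
      ENNReal.ofReal_mul (p := c ^ 2) (q := S1) (by positivity), ← L1,
      ENNReal.ofReal_mul (p := c ^ 2) (q := S3) (by positivity), ← L3, ← lintegral_const_mul _ (by fun_prop),
      ← lintegral_const_mul _ (by fun_prop), ← lintegral_const_mul _ (by fun_prop),
      ← lintegral_add_left (by fun_prop), ← lintegral_add_left (by fun_prop)]
    refine setLIntegral_congr_fun measurableSet_Ioi fun t (ht : 0 < t) => ?_
    have i1 := besselI_nonneg b1 ht.le
    have i2 := besselI_nonneg b2 ht.le
    rw [← ENNReal.ofReal_mul (by positivity), ← ENNReal.ofReal_mul (by positivity),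
      ← ENNReal.ofReal_mul (by positivity), ← ENNReal.ofReal_add (by positivity) (by positivity),
      ← ENNReal.ofReal_add (by positivity) (by positivity)]
    congr 1
    have hK := besselK_eq h0 (by linarith) ht
    rw [← hc, Real.rpow_neg ht.le] at hK
    have hK' : besselK (-ν) t = c * ((t ^ ν)⁻¹ * besselI (1 - ν) t) - c * besselI (1 + ν) t := by
      linarith
    have tp := Real.rpow_pos_of_pos ht ν
    have hsq : besselK (-ν) t ^ 4 = (c * ((t ^ ν)⁻¹ * besselI (1 - ν) t) -
        c * besselI (1 + ν) t) ^ 2 * besselK (-ν) t ^ 2 := by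
      rw [← hK']; ring
    rw [hsq, show 1 + ν - 1 = ν by ring, show 1 - ν - 1 = -ν by ring, Real.rpow_neg ht.le,
      sub_self, Real.rpow_zero]
    field_simp
    ring
  rw [← ENNReal.ofReal_add (by positivity) (by positivity)] at key
  have hX : (∫⁻ t in Ioi (0 : ℝ), ENNReal.ofReal (t ^ ν * besselK (-ν) t ^ 4)) ≠ ⊤ := by
    intro h
    rw [h, top_add] at key
    exact ENNReal.ofReal_ne_top key.symm
  rw [← ENNReal.ofReal_toReal hX] at key ⊢
  rw [← ENNReal.ofReal_add ENNReal.toReal_nonneg (by positivity),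
    ENNReal.ofReal_eq_ofReal_iff (add_nonneg ENNReal.toReal_nonneg (by positivity))
      (by positivity)] at key
  have hv : c ^ 2 * (S1 + S3 - 2 * S2) =
      (∫⁻ t in Ioi (0 : ℝ), ENNReal.ofReal (t ^ ν * besselK (-ν) t ^ 4)).toReal := by linarith
  rw [hv]
  exact ⟨rfl, ENNReal.toReal_nonneg⟩

lemma lintegral_symanzik_ne_top {ν : ℝ} (h0 : 0 < ν) (h1 : ν < 1 / 3) :
    ∫⁻ α, ENNReal.ofReal (symanzik α ^ (-(1 + ν))) ∂schwingerMeasure ≠ ⊤ := by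
  have h := Gamma_mul_lintegral_symanzik (show 0 < 1 + ν by linarith)
  rw [show 1 + ν - 1 = ν by ring, show 1 - (1 + ν) = -ν by ring,
    (lintegral_besselK_pow_four h0 h1).1] at h
  intro htop
  rw [htop, ENNReal.mul_top (by simpa using Real.Gamma_pos_of_pos (by linarith))] at h
  exact ENNReal.ofReal_ne_top h.symm

lemma integral_symanzik {ν : ℝ} (h0 : 0 < ν) (h1 : ν < 1 / 3) :
    Real.Gamma (1 + ν) * ∫ α, symanzik α ^ (-(1 + ν)) ∂schwingerMeasure =
      (Real.Gamma ν * Real.Gamma (1 - ν)) ^ 2 *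
        ((∑' p, mellinTerm ν (1 + ν) (1 + ν) (1 + ν) p) +
          (∑' p, mellinTerm ν (1 - ν) (1 - ν) (1 - ν) p) -
          2 * ∑' p, mellinTerm ν 1 (1 + ν) (1 - ν) p) := by
  have h := Gamma_mul_lintegral_symanzik (show 0 < 1 + ν by linarith)
  rw [show 1 + ν - 1 = ν by ring, show 1 - (1 + ν) = -ν by ring,
    (lintegral_besselK_pow_four h0 h1).1] at h
  have hp : ∀ᵐ α ∂schwingerMeasure, 0 ≤ symanzik α ^ (-(1 + ν)) :=
    ae_schwingerMeasure_pos.mono fun α hα => (Real.rpow_pos_of_pos (symanzik_pos hα) _).le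
  have hm : Measurable fun α => symanzik α ^ (-(1 + ν)) := measurable_symanzik.pow_const _
  have hG := Real.Gamma_pos_of_pos (show 0 < 1 + ν by linarith)
  rw [integral_eq_lintegral_of_nonneg_ae hp hm.aestronglyMeasurable]
  have h2 := congrArg ENNReal.toReal h
  rw [ENNReal.toReal_mul, ENNReal.toReal_ofReal hG.le] at h2
  rw [h2, ENNReal.toReal_ofReal (lintegral_besselK_pow_four h0 h1).2]

end Banana

end
open scoped BigOperators

noncomputable section

namespace Banana

open MeasureTheory Set Filter Topology ProbabilityTheory
open scoped ENNReal

/-! ### Analyticity of the Schwinger and the momentum integral -/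

lemma measurable_log_symanzik : Measurable fun α => Real.log (symanzik α) :=
  measurable_symanzik.log

lemma lintegral_one_add_pow_ne_top (N : ℕ) :
    ∫⁻ α, ENNReal.ofReal ((1 + |α|) ^ N) ∂expDensity ≠ ⊤ := by
  have h := lintegral_exp_neg_mul (q := -(1 / 2)) (by norm_num)
  have hle : ∫⁻ α, ENNReal.ofReal ((1 + |α|) ^ N) ∂expDensity ≤
      ∫⁻ α, ENNReal.ofReal (2 ^ N * N.factorial * Real.exp (1 / 2)) *
        ENNReal.ofReal (Real.exp (-(α * -(1 / 2)))) ∂expDensity := by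
    refine lintegral_mono_ae (ae_expDensity_pos.mono fun α hα => ?_)
    rw [← ENNReal.ofReal_mul (by positivity)]
    apply ENNReal.ofReal_le_ofReal
    have hp := Real.pow_div_factorial_le_exp ((1 + α) / 2) (by positivity) N
    rw [div_le_iff₀ (by positivity), div_pow, div_le_iff₀ (by positivity)] at hp
    rw [abs_of_pos hα, mul_assoc, ← Real.exp_add]
    refine hp.trans (le_of_eq ?_)
    rw [show 1 / 2 + -(α * -(1 / 2)) = (1 + α) / 2 by ring]
    ring
  refine ne_top_of_le_ne_top ?_ hle
  rw [lintegral_const_mul _ (by fun_prop), h]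
  exact ENNReal.mul_ne_top ENNReal.ofReal_ne_top ENNReal.ofReal_ne_top

lemma integrable_exp_mul_log_symanzik_iff (t : ℝ) :
    t ∈ integrableExpSet (fun α => Real.log (symanzik α)) schwingerMeasure ↔
      ∫⁻ α, ENNReal.ofReal (symanzik α ^ t) ∂schwingerMeasure ≠ ⊤ := by
  have hm : Measurable fun α => Real.exp (t * Real.log (symanzik α)) :=
    (measurable_log_symanzik.const_mul t).exp
  rw [integrableExpSet, mem_ofPred_eq, ← lt_top_iff_ne_top, Integrable,
    hasFiniteIntegral_iff_ofReal (Eventually.of_forall fun α => (Real.exp_pos _).le),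
    and_iff_right hm.aestronglyMeasurable]
  refine iff_of_eq (congrArg (· < ⊤) (lintegral_congr_ae (ae_schwingerMeasure_pos.mono ?_)))
  intro α hα
  simp only
  rw [Real.rpow_def_of_pos (symanzik_pos hα), mul_comm]

/-- The exponents with finite moment form a convex set, so one exponent on each side of `t`
suffices: `-(1+ν)` with `0 < ν < 1/3` from the Bessel moment, and a large integer `N` because `U ≤ ∏
(1 + αᵢ)`. -/
lemma Ioi_subset_integrableExpSet :
    Ioi (-(4 / 3) : ℝ) ⊆
      interior (integrableExpSet (fun α => Real.log (symanzik α)) schwingerMeasure) := by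
  refine interior_maximal ?_ isOpen_Ioi
  intro t (ht : -(4 / 3) < t)
  obtain ⟨N, hN⟩ := exists_nat_gt t
  obtain ⟨ν, hν0, hν1⟩ : ∃ ν : ℝ, max 0 (-1 - t) < ν ∧ ν < 1 / 3 :=
    exists_between (max_lt (by norm_num) (by linarith))
  have hν := max_lt_iff.1 hν0
  have h1 : -(1 + ν) ∈ integrableExpSet (fun α => Real.log (symanzik α)) schwingerMeasure :=
    (integrable_exp_mul_log_symanzik_iff _).2 (lintegral_symanzik_ne_top hν.1 hν1)
  have h2 : (N : ℝ) ∈ integrableExpSet (fun α => Real.log (symanzik α)) schwingerMeasure := by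
    rw [integrable_exp_mul_log_symanzik_iff]
    have hm : Measurable fun x : ℝ => ENNReal.ofReal ((1 + |x|) ^ N) := by fun_prop
    have hfin := lintegral_one_add_pow_ne_top N
    refine ne_top_of_le_ne_top (b := ∫⁻ α : ℝ × ℝ × ℝ × ℝ, ENNReal.ofReal ((1 + |α.1|) ^ N) *
      (ENNReal.ofReal ((1 + |α.2.1|) ^ N) * (ENNReal.ofReal ((1 + |α.2.2.1|) ^ N) *
        ENNReal.ofReal ((1 + |α.2.2.2|) ^ N))) ∂schwingerMeasure) ?_ ?_
    · rw [lintegral_schwingerMeasure_mul hm hm hm hm]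
      exact ENNReal.mul_ne_top hfin (ENNReal.mul_ne_top hfin (ENNReal.mul_ne_top hfin hfin))
    · refine lintegral_mono_ae (ae_schwingerMeasure_pos.mono ?_)
      rintro ⟨x, y, z, w⟩ h
      have hU := symanzik_pos h
      obtain ⟨hx, hy, hz, hw⟩ := h
      simp only at hx hy hz hw ⊢
      rw [← ENNReal.ofReal_mul (by positivity), ← ENNReal.ofReal_mul (by positivity),
        ← ENNReal.ofReal_mul (by positivity), ← mul_pow, ← mul_pow, ← mul_pow, Real.rpow_natCast,
        abs_of_pos hx, abs_of_pos hy, abs_of_pos hz, abs_of_pos hw]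
      apply ENNReal.ofReal_le_ofReal
      gcongr
      rw [symanzik]
      have : 0 ≤ 1 + x + y + z + w + x * y + x * z + x * w + y * z + y * w + z * w +
        x * y * z * w := by positivity
      nlinarith
  exact convex_integrableExpSet.ordConnected.out h1 h2 ⟨by linarith, hN.le⟩

/-- The Schwinger parametric representation of the normalised banana integral. -/
def schwingerIntegral (ε : ℂ) : ℂ :=
  Complex.exp (3 * ε * (Real.eulerMascheroniConstant : ℂ)) *
    complexMGF (fun α => Real.log (symanzik α)) schwingerMeasure (ε - 2)

lemma analyticAt_schwingerIntegral {ε : ℂ} (hε : 2 / 3 < ε.re) :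
    AnalyticAt ℂ schwingerIntegral ε := by
  have h : AnalyticAt ℂ (complexMGF (fun α => Real.log (symanzik α)) schwingerMeasure)
      ((fun z : ℂ => z - 2) ε) := analyticOnNhd_complexMGF (ε - 2) (Ioi_subset_integrableExpSet (by simp; linarith))
  have h2 : AnalyticAt ℂ (fun z : ℂ => z - 2) ε := by fun_prop
  have h3 : AnalyticAt ℂ
      (fun z : ℂ => Complex.exp (3 * z * (Real.eulerMascheroniConstant : ℂ))) ε := by fun_prop
  exact h3.mul (AnalyticAt.comp (f := fun z : ℂ => z - 2) h h2)

lemma schwingerIntegral_ofReal (ε : ℝ) :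
    schwingerIntegral ε = Complex.exp (3 * ε * (Real.eulerMascheroniConstant : ℂ)) *
      ((∫ α, symanzik α ^ (ε - 2) ∂schwingerMeasure : ℝ) : ℂ) := by
  rw [schwingerIntegral, show (ε : ℂ) - 2 = ((ε - 2 : ℝ) : ℂ) by push_cast; rfl,
    complexMGF_ofReal, mgf]
  congr 2
  refine integral_congr_ae (ae_schwingerMeasure_pos.mono fun α hα => ?_)
  simp only
  rw [Real.rpow_def_of_pos (symanzik_pos hα), mul_comm]

/-- The prefactor of the momentum integral in dimension `D`. -/
def sphereConst (D : ℂ) : ℂ :=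
  ∏ j : Fin 3, sphereArea (D - (j : ℕ)) / (Real.pi : ℂ) ^ (D / 2)

/-- The logarithm of the product of the radii. -/
def logRadii (p : (Fin 3 → ℝ) × (Fin 3 → ℝ)) : ℝ :=
  Real.log (p.1 0) + Real.log (p.1 1) + Real.log (p.1 2)

/-- The propagators times the radial density in dimension `0`. -/
def frameMeasure : Measure ((Fin 3 → ℝ) × (Fin 3 → ℝ)) :=
  (volume.restrict frameDomain).withDensity fun p =>
    ENNReal.ofReal (radialWeight 0 p * propagatorProd p)

lemma measurable_frameWeight : Measurable fun p => radialWeight 0 p * propagatorProd p :=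
  (measurable_radialWeight 0).mul measurable_propagatorProd

lemma measurable_logRadii : Measurable logRadii := by unfold logRadii; fun_prop

lemma radialWeight_eq {p : (Fin 3 → ℝ) × (Fin 3 → ℝ)} (hp : p ∈ frameDomain) (d : ℝ) :
    radialWeight d p = Real.exp (d * logRadii p) * radialWeight 0 p := by
  have h0 : 0 < p.1 0 := hp 0
  have h1 : 0 < p.1 1 := hp 1
  have h2 : 0 < p.1 2 := hp 2
  simp only [radialWeight, logRadii, Real.rpow_def_of_pos h0, Real.rpow_def_of_pos h1,
    Real.rpow_def_of_pos h2, ← Real.exp_add]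
  congr 1; ring

/-- All dependence on `D` is isolated in an entire prefactor and in `exp(D · logRadii)`. The
momentum integral thereby becomes a moment generating function, whose analyticity is automatic
inside its convergence strip. -/
lemma dimRegIntegrand_eq {p : (Fin 3 → ℝ) × (Fin 3 → ℝ)} (hp : p ∈ frameDomain) (D : ℂ) :
    dimRegIntegrand D propagators p = sphereConst D *
      (((radialWeight 0 p * propagatorProd p : ℝ) : ℂ) * Complex.exp (D * logRadii p)) := by
  have h0 : 0 < p.1 0 := hp 0
  have h1 : 0 < p.1 1 := hp 1
  have h2 : 0 < p.1 2 := hp 2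
  have hc : ∀ {x : ℝ}, 0 < x → ∀ k : ℝ, (x : ℂ) ^ (D - k - 1) =
      Complex.exp (D * Real.log x) * ((x ^ (0 - (k + 1)) : ℝ) : ℂ) := by
    intro x hx k
    rw [Complex.ofReal_cpow hx.le, Complex.cpow_def_of_ne_zero (by exact_mod_cast hx.ne'),
      Complex.cpow_def_of_ne_zero (by exact_mod_cast hx.ne'), ← Complex.exp_add,
      Complex.ofReal_log hx.le]
    congr 1; push_cast; ring
  have c0 := hc h0 0
  have c1 := hc h1 1
  have c2 := hc h2 2
  norm_num at c0 c1 c2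
  rw [dimRegIntegrand, propagators_frame, sphereConst, logRadii, radialWeight]
  simp only [Fin.prod_univ_three, Fin.val_zero, Fin.val_one, Fin.val_two]
  push_cast
  rw [mul_add, mul_add, Complex.exp_add, Complex.exp_add]
  norm_num
  rw [c0, c1, c2]
  ring

lemma lintegral_radialWeight_ne_top {d : ℝ} (h2 : 2 < d) (h3 : d < 8 / 3) :
    ∫⁻ p in frameDomain, ENNReal.ofReal (radialWeight d p * propagatorProd p) ≠ ⊤ := by
  rw [lintegral_radialWeight_mul_propagatorProd h2,
    show -(d / 2) = -(1 + (d / 2 - 1)) by ring]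
  exact ENNReal.mul_ne_top ENNReal.ofReal_ne_top
    (lintegral_symanzik_ne_top (by linarith) (by linarith))

lemma integrableOn_radialWeight {d : ℝ} (h2 : 2 < d) (h3 : d < 8 / 3) :
    IntegrableOn (fun p => radialWeight d p * propagatorProd p) frameDomain := by
  have hm : Measurable fun p => radialWeight d p * propagatorProd p :=
    (measurable_radialWeight d).mul measurable_propagatorProd
  refine ⟨hm.aestronglyMeasurable, ?_⟩
  rw [hasFiniteIntegral_iff_ofReal]
  · exact lt_top_iff_ne_top.2 (lintegral_radialWeight_ne_top h2 h3)
  · exact (ae_restrict_mem measurableSet_frameDomain).mono fun p hp =>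
      mul_nonneg (radialWeight_nonneg d hp) (propagatorProd_nonneg p)

theorem integrableOn_dimRegIntegrand {D : ℂ} (h2 : 2 < D.re) (h3 : D.re < 8 / 3) :
    IntegrableOn (dimRegIntegrand D propagators) frameDomain := by
  have hm : Measurable fun p => sphereConst D *
      (((radialWeight 0 p * propagatorProd p : ℝ) : ℂ) * Complex.exp (D * logRadii p)) := by
    have a := measurable_radialWeight 0
    have b := measurable_propagatorProd
    have c := measurable_logRadii
    fun_prop
  have hmain : IntegrableOn (fun p => sphereConst D *
      (((radialWeight 0 p * propagatorProd p : ℝ) : ℂ) * Complex.exp (D * logRadii p)))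
      frameDomain := by
    refine ((integrableOn_radialWeight h2 h3).const_mul ‖sphereConst D‖).mono'
      hm.aestronglyMeasurable ?_
    refine (ae_restrict_mem measurableSet_frameDomain).mono fun p hp => ?_
    rw [norm_mul, norm_mul, Complex.norm_exp, Complex.norm_real, Real.norm_of_nonneg
      (mul_nonneg (radialWeight_nonneg 0 hp) (propagatorProd_nonneg p)), radialWeight_eq hp D.re]
    apply le_of_eq
    rw [Complex.re_mul_ofReal]
    ring
  exact hmain.congr_fun (fun p hp => (dimRegIntegrand_eq hp D).symm) measurableSet_frameDomain

lemma Ioo_subset_integrableExpSet_frameMeasure :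
    Ioo (2 : ℝ) (8 / 3) ⊆ interior (integrableExpSet logRadii frameMeasure) := by
  refine interior_maximal ?_ isOpen_Ioo
  rintro d ⟨h2, h3⟩
  have hm : Measurable fun p => Real.exp (d * logRadii p) :=
    (measurable_logRadii.const_mul d).exp
  refine ⟨hm.aestronglyMeasurable, ?_⟩
  rw [hasFiniteIntegral_iff_ofReal (Eventually.of_forall fun α => (Real.exp_pos _).le),
    lt_top_iff_ne_top, frameMeasure, lintegral_withDensity_eq_lintegral_mul _
    measurable_frameWeight.ennreal_ofReal hm.ennreal_ofReal]
  convert lintegral_radialWeight_ne_top h2 h3 using 1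
  refine setLIntegral_congr_fun measurableSet_frameDomain fun p hp => ?_
  simp only [Pi.mul_apply]
  rw [radialWeight_eq hp d, ← ENNReal.ofReal_mul
    (mul_nonneg (radialWeight_nonneg 0 hp) (propagatorProd_nonneg p))]
  congr 1; ring

lemma dimRegIntegral_eq (D : ℂ) :
    dimRegIntegral D propagators = sphereConst D * complexMGF logRadii frameMeasure D := by
  rw [dimRegIntegral, setIntegral_congr_fun measurableSet_frameDomain
    fun p hp => dimRegIntegrand_eq hp D, integral_const_mul, complexMGF, frameMeasure,
    integral_withDensity_eq_integral_toReal_smul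
      measurable_frameWeight.ennreal_ofReal
      (Eventually.of_forall fun p => ENNReal.ofReal_lt_top)]
  congr 1
  refine setIntegral_congr_fun measurableSet_frameDomain fun p hp => ?_
  rw [ENNReal.toReal_ofReal
    (mul_nonneg (radialWeight_nonneg 0 hp) (propagatorProd_nonneg p)), Complex.real_smul]

lemma differentiable_sphereConst : Differentiable ℂ sphereConst := by
  have hpi : (Real.pi : ℂ) ≠ 0 := by exact_mod_cast Real.pi_ne_zero
  have hpow : ∀ z : ℂ, (Real.pi : ℂ) ^ z ≠ 0 := fun z => by simp [Complex.cpow_eq_zero_iff, hpi]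
  have hP : ∀ {g : ℂ → ℂ}, Differentiable ℂ g → Differentiable ℂ fun z => (Real.pi : ℂ) ^ g z :=
    fun hg => hg.const_cpow (Or.inl hpi)
  have hA : Differentiable ℂ sphereArea := by
    have hG : Differentiable ℂ fun d : ℂ => (Complex.Gamma (d / 2))⁻¹ :=
      Complex.differentiable_one_div_Gamma.comp (differentiable_id.div_const 2)
    simpa only [sphereArea, div_eq_mul_inv] using!
      ((hP (differentiable_id.div_const 2)).const_mul 2).mul hG
  unfold sphereConst
  refine Differentiable.fun_finsetProd fun j _ => ?_
  exact (hA.comp (differentiable_id.sub_const _)).div (hP (differentiable_id.div_const 2))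
    fun z => hpow _

lemma analyticAt_momentumIntegral {ε : ℂ} (h1 : 2 / 3 < ε.re) (h2 : ε.re < 1) :
    AnalyticAt ℂ momentumIntegral ε := by
  have e : momentumIntegral = fun ε => Complex.exp (3 * ε * (Real.eulerMascheroniConstant : ℂ)) *
      (sphereConst (4 - 2 * ε) * complexMGF logRadii frameMeasure (4 - 2 * ε)) := by
    ext ε; rw [momentumIntegral, dimRegIntegral_eq]
  rw [e]
  have hD : AnalyticAt ℂ (fun z : ℂ => 4 - 2 * z) ε := by fun_prop
  have h : AnalyticAt ℂ (complexMGF logRadii frameMeasure) ((fun z : ℂ => 4 - 2 * z) ε) :=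
    analyticOnNhd_complexMGF (4 - 2 * ε) (Ioo_subset_integrableExpSet_frameMeasure (by simp; constructor <;> linarith))
  have h3 : AnalyticAt ℂ
      (fun z : ℂ => Complex.exp (3 * z * (Real.eulerMascheroniConstant : ℂ))) ε := by fun_prop
  have hs : AnalyticAt ℂ (fun z : ℂ => sphereConst (4 - 2 * z)) ε :=
    AnalyticAt.comp (g := sphereConst) (f := fun z : ℂ => 4 - 2 * z)
      (differentiable_sphereConst.analyticAt _) hD
  exact h3.mul (hs.mul (AnalyticAt.comp (f := fun z : ℂ => 4 - 2 * z) h hD))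

/-- The Gamma functions of the sphere areas cancel those of the radial integrals, and the powers of
`π` from areas and parallel Gaussians match the normalisation `π^(-3d/2)`. -/
lemma sphereConst_mul_radialConst {d : ℝ} (hd : 2 < d) :
    sphereConst d * (radialConst d : ℂ) = 1 := by
  have g1 := Real.Gamma_pos_of_pos (show 0 < d / 2 by linarith)
  have g2 := Real.Gamma_pos_of_pos (show 0 < (d - 1) / 2 by linarith)
  have g3 := Real.Gamma_pos_of_pos (show 0 < (d - 2) / 2 by linarith)
  have hA : ∀ x : ℝ, sphereArea x = ((2 * Real.pi ^ (x / 2) / Real.Gamma (x / 2) : ℝ) : ℂ) := by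
    intro x
    rw [sphereArea]
    push_cast
    rw [Complex.ofReal_cpow Real.pi_pos.le, ← Complex.Gamma_ofReal]
    push_cast; rfl
  have hpi : (Real.pi : ℂ) ^ ((d : ℂ) / 2) = ((Real.pi ^ (d / 2) : ℝ) : ℂ) := by
    rw [Complex.ofReal_cpow Real.pi_pos.le]; push_cast; rfl
  have e0 := hA d
  have e1 := hA (d - 1)
  have e2 := hA (d - 2)
  rw [Complex.ofReal_sub] at e1 e2
  rw [sphereConst, Fin.prod_univ_three]
  simp only [Fin.val_zero, Fin.val_one, Fin.val_two, Nat.cast_zero, Nat.cast_one, Nat.cast_ofNat,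
    sub_zero]
  rw [e0, hpi, show (d : ℂ) - 1 = (d : ℂ) - ((1 : ℝ) : ℂ) by push_cast; rfl, e1,
    show (d : ℂ) - 2 = (d : ℂ) - ((2 : ℝ) : ℂ) by push_cast; rfl, e2, radialConst]
  norm_cast
  have hp : ∀ x : ℝ, 0 < Real.pi ^ x := fun x => Real.rpow_pos_of_pos Real.pi_pos x
  have p1 : Real.pi ^ ((d - 1) / 2) * Real.sqrt Real.pi = Real.pi ^ (d / 2) := by
    rw [Real.sqrt_eq_rpow, ← Real.rpow_add Real.pi_pos]; congr 1; ring
  have p2 : Real.pi ^ ((d - 2) / 2) * Real.pi = Real.pi ^ (d / 2) := by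
    rw [← Real.rpow_add_one Real.pi_pos.ne']; congr 1; ring
  have := hp (d / 2)
  rw [show ∀ a b c x y z t u v : ℝ, a / t * (b / t) * (c / t) * (x * y * z * (u * v)) =
    (a * x) * (b * y) * (c * z) * u * v / t ^ 3 by intros; ring]
  rw [div_eq_one_iff_eq (by positivity)]
  have r1 : 2 * Real.pi ^ (d / 2) / Real.Gamma (d / 2) * (Real.Gamma (d / 2) / 2) =
    Real.pi ^ (d / 2) := by field_simp
  have r2 : 2 * Real.pi ^ ((d - 1) / 2) / Real.Gamma ((d - 1) / 2) * (Real.Gamma ((d - 1) / 2) / 2)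
    = Real.pi ^ ((d - 1) / 2) := by field_simp
  have r3 : 2 * Real.pi ^ ((d - 2) / 2) / Real.Gamma ((d - 2) / 2) * (Real.Gamma ((d - 2) / 2) / 2)
    = Real.pi ^ ((d - 2) / 2) := by field_simp
  rw [r1, r2, r3]
  calc _ = Real.pi ^ (d / 2) * (Real.pi ^ ((d - 1) / 2) * Real.sqrt Real.pi) *
        (Real.pi ^ ((d - 2) / 2) * Real.pi) := by ring
    _ = _ := by rw [p1, p2]; ring

/-- Only real `ε` is treated here: the integrands are then nonnegative and the identity is Tonelli.
Complex `ε` follows from analyticity of both sides. -/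
lemma momentumIntegral_ofReal {ε : ℝ} (h1 : 2 / 3 < ε) (h2 : ε < 1) :
    momentumIntegral ε = schwingerIntegral ε := by
  have hd2 : 2 < 4 - 2 * ε := by linarith
  rw [momentumIntegral, schwingerIntegral_ofReal, dimRegIntegral_eq,
    show (4 : ℂ) - 2 * (ε : ℂ) = ((4 - 2 * ε : ℝ) : ℂ) by push_cast; rfl, complexMGF_ofReal]
  congr 1
  have hm : Measurable fun p => Real.exp ((4 - 2 * ε) * logRadii p) :=
    (measurable_logRadii.const_mul _).exp
  have hmS : Measurable fun α => symanzik α ^ (ε - 2) := measurable_symanzik.pow_const _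
  have hc : 0 ≤ radialConst (4 - 2 * ε) := by
    have g1 := Real.Gamma_pos_of_pos (show 0 < (4 - 2 * ε) / 2 by linarith)
    have g2 := Real.Gamma_pos_of_pos (show 0 < (4 - 2 * ε - 1) / 2 by linarith)
    have g3 := Real.Gamma_pos_of_pos (show 0 < (4 - 2 * ε - 2) / 2 by linarith)
    unfold radialConst; positivity
  have key : mgf logRadii frameMeasure (4 - 2 * ε) =
      radialConst (4 - 2 * ε) * ∫ α, symanzik α ^ (ε - 2) ∂schwingerMeasure := by
    have hl := lintegral_radialWeight_mul_propagatorProd hd2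
    rw [show -((4 - 2 * ε) / 2) = ε - 2 by ring] at hl
    rw [mgf, integral_eq_lintegral_of_nonneg_ae (Eventually.of_forall fun α => (Real.exp_pos _).le)
      hm.aestronglyMeasurable, integral_eq_lintegral_of_nonneg_ae
      (ae_schwingerMeasure_pos.mono fun α hα => (Real.rpow_pos_of_pos (symanzik_pos hα) _).le)
      hmS.aestronglyMeasurable]
    conv_rhs => rw [← ENNReal.toReal_ofReal hc]
    rw [← ENNReal.toReal_mul, ← hl, frameMeasure, lintegral_withDensity_eq_lintegral_mul _
      measurable_frameWeight.ennreal_ofReal hm.ennreal_ofReal]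
    congr 1
    refine setLIntegral_congr_fun measurableSet_frameDomain fun p hp => ?_
    simp only [Pi.mul_apply]
    rw [radialWeight_eq hp (4 - 2 * ε), ← ENNReal.ofReal_mul
      (mul_nonneg (radialWeight_nonneg 0 hp) (propagatorProd_nonneg p))]
    congr 1; ring
  rw [key, Complex.ofReal_mul, ← mul_assoc, sphereConst_mul_radialConst hd2, one_mul]

end Banana

end
open scoped BigOperators

noncomputable section

namespace Banana

open MeasureTheory Set Filter Topology ProbabilityTheory

/-! ### The double series representation -/

/-- The double series of the first summand, with reciprocal Gamma functions. -/
def rsum₁ (ε : ℂ) : ℂ := ∑' p : ℕ × ℕ, rterm (2 - ε) 1 ε (2 - ε) (3 / 2) (2 - ε) p.1 p.2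

/-- The double series of the second summand, with reciprocal Gamma functions. -/
def rsum₂ (ε : ℂ) : ℂ :=
  ∑' p : ℕ × ℕ, rterm 1 ε (-1 + 2 * ε) ε (1 / 2 + ε) (2 - ε) p.1 p.2

/-- The double series of the third summand, with reciprocal Gamma functions. -/
def rsum₃ (ε : ℂ) : ℂ :=
  ∑' p : ℕ × ℕ, rterm ε (-1 + 2 * ε) (-2 + 3 * ε) ε (-1 / 2 + 2 * ε) ε p.1 p.2

/-- The double series representation of the banana integral for `Re ε < 1`. -/
def bananaSeries (ε : ℂ) : ℂ :=
  Complex.exp (3 * ε * (Real.eulerMascheroniConstant : ℂ)) * (Real.sqrt Real.pi : ℂ) *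
    (1 / 2 * (Complex.Gamma (1 - ε) ^ 2 * Complex.Gamma ε ^ 3) * rsum₁ ε +
      Complex.Gamma ε ^ 2 * Complex.Gamma (-1 + 2 * ε) * Complex.Gamma (1 - ε) *
        Complex.Gamma (-1 + ε) * (1 / 4 : ℂ) ^ (-1 + ε) * rsum₂ ε +
      1 / 2 * (Complex.Gamma ε ^ 3 * Complex.Gamma (-1 + 2 * ε) * Complex.Gamma (-2 + 3 * ε) *
        Complex.Gamma (1 - ε) ^ 2) * (Complex.Gamma (2 - ε))⁻¹ *
        (1 / 4 : ℂ) ^ (-2 + 2 * ε) * rsum₃ ε)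

lemma differentiableOn_rsum₁ : DifferentiableOn ℂ rsum₁ {z | z.re < 1} :=
  differentiableOn_tsum_rterm (a := fun z => 2 - z) (b := fun _ => 1) (c := fun z => z)
    (d := fun z => 2 - z) (e := fun _ => 3 / 2) (f := fun z => 2 - z) (by fun_prop) (by fun_prop)
    (by fun_prop) (by fun_prop) (by fun_prop) (by fun_prop) fun z => by ring

lemma differentiableOn_rsum₂ : DifferentiableOn ℂ rsum₂ {z | z.re < 1} :=
  differentiableOn_tsum_rterm (a := fun _ => 1) (b := fun z => z) (c := fun z => -1 + 2 * z)
    (d := fun z => z) (e := fun z => 1 / 2 + z) (f := fun z => 2 - z) (by fun_prop) (by fun_prop)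
    (by fun_prop) (by fun_prop) (by fun_prop) (by fun_prop) fun z => by ring

lemma differentiableOn_rsum₃ : DifferentiableOn ℂ rsum₃ {z | z.re < 1} :=
  differentiableOn_tsum_rterm (a := fun z => z) (b := fun z => -1 + 2 * z)
    (c := fun z => -2 + 3 * z) (d := fun z => z) (e := fun z => -1 / 2 + 2 * z) (f := fun z => z)
    (by fun_prop) (by fun_prop) (by fun_prop) (by fun_prop) (by fun_prop) (by fun_prop)
    fun z => by ring

lemma isOpen_re_lt_one : IsOpen {z : ℂ | z.re < 1} :=
  isOpen_lt Complex.continuous_re continuous_const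

lemma analyticAt_of_differentiableOn_re_lt_one {f : ℂ → ℂ}
    (hf : DifferentiableOn ℂ f {z | z.re < 1}) {ε : ℂ} (hε : ε.re < 1) : AnalyticAt ℂ f ε :=
  hf.analyticAt (isOpen_re_lt_one.mem_nhds hε)

lemma analyticAt_inv_Gamma_comp {g : ℂ → ℂ} {z : ℂ} (hg : AnalyticAt ℂ g z) :
    AnalyticAt ℂ (fun w => (Complex.Gamma (g w))⁻¹) z :=
  AnalyticAt.comp (g := fun s => (Complex.Gamma s)⁻¹) (f := g)
    (Complex.differentiable_one_div_Gamma.analyticAt _) hg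

/-- `Γ` is the pointwise inverse of the entire function `1/Γ`, also at its poles, where both take
the value `0`. -/
lemma meromorphicAt_Gamma_comp {g : ℂ → ℂ} {z : ℂ} (hg : AnalyticAt ℂ g z) :
    MeromorphicAt (fun w => Complex.Gamma (g w)) z := by
  have e : (fun w => Complex.Gamma (g w)) = (fun w => (Complex.Gamma (g w))⁻¹)⁻¹ := by
    ext w; simp
  rw [e]
  exact (analyticAt_inv_Gamma_comp hg).meromorphicAt.inv

lemma analyticAt_Gamma_comp {g : ℂ → ℂ} {z : ℂ} (hg : AnalyticAt ℂ g z)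
    (h : ∀ k : ℕ, g z ≠ -k) : AnalyticAt ℂ (fun w => Complex.Gamma (g w)) z := by
  have e : (fun w => Complex.Gamma (g w)) = (fun w => (Complex.Gamma (g w))⁻¹)⁻¹ := by
    ext w; simp
  rw [e]
  exact (analyticAt_inv_Gamma_comp hg).inv (inv_ne_zero (Complex.Gamma_ne_zero h))

lemma meromorphicAt_bananaSeries {ε : ℂ} (hε : ε.re < 1) : MeromorphicAt bananaSeries ε := by
  have r1 := (analyticAt_of_differentiableOn_re_lt_one differentiableOn_rsum₁ hε).meromorphicAt
  have r2 := (analyticAt_of_differentiableOn_re_lt_one differentiableOn_rsum₂ hε).meromorphicAt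
  have r3 := (analyticAt_of_differentiableOn_re_lt_one differentiableOn_rsum₃ hε).meromorphicAt
  have g0 := meromorphicAt_Gamma_comp (g := fun z => z) (z := ε) (by fun_prop)
  have g1 := meromorphicAt_Gamma_comp (g := fun z => 1 - z) (z := ε) (by fun_prop)
  have g2 := meromorphicAt_Gamma_comp (g := fun z => -1 + z) (z := ε) (by fun_prop)
  have g3 := meromorphicAt_Gamma_comp (g := fun z => -1 + 2 * z) (z := ε) (by fun_prop)
  have g4 := meromorphicAt_Gamma_comp (g := fun z => -2 + 3 * z) (z := ε) (by fun_prop)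
  have g5 := (analyticAt_inv_Gamma_comp (g := fun z => 2 - z) (z := ε) (by fun_prop)).meromorphicAt
  have p1 : MeromorphicAt (fun z : ℂ => (1 / 4 : ℂ) ^ (-1 + z)) ε :=
    (analyticAt_const.cpow (by fun_prop) (by norm_num [Complex.slitPlane])).meromorphicAt
  have p2 : MeromorphicAt (fun z : ℂ => (1 / 4 : ℂ) ^ (-2 + 2 * z)) ε :=
    (analyticAt_const.cpow (by fun_prop) (by norm_num [Complex.slitPlane])).meromorphicAt
  have e : MeromorphicAt (fun z : ℂ => Complex.exp (3 * z * (Real.eulerMascheroniConstant : ℂ)) *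
      (Real.sqrt Real.pi : ℂ)) ε := by
    apply AnalyticAt.meromorphicAt; fun_prop
  have half : MeromorphicAt (fun _ : ℂ => (1 / 2 : ℂ)) ε := analyticAt_const.meromorphicAt
  exact e.mul ((((half.mul ((g1.pow 2).mul (g0.pow 3))).mul r1).add
    ((((((g0.pow 2).mul g3).mul g1).mul g2).mul p1).mul r2)).add
    ((((half.mul ((((g0.pow 3).mul g3).mul g4).mul (g1.pow 2))).mul g5).mul p2).mul r3))

lemma analyticAt_bananaSeries {ε : ℂ} (hε : ε.re < 1) (h0 : ∀ k : ℕ, ε ≠ -k)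
    (h1 : ∀ k : ℕ, -1 + ε ≠ -k) (h2 : ∀ k : ℕ, -1 + 2 * ε ≠ -k)
    (h3 : ∀ k : ℕ, -2 + 3 * ε ≠ -k) : AnalyticAt ℂ bananaSeries ε := by
  have h4 : ∀ k : ℕ, 1 - ε ≠ -k := fun k h => by
    have := congrArg Complex.re h
    simp at this
    linarith [(Nat.cast_nonneg k : (0:ℝ) ≤ k)]
  have r1 := analyticAt_of_differentiableOn_re_lt_one differentiableOn_rsum₁ hε
  have r2 := analyticAt_of_differentiableOn_re_lt_one differentiableOn_rsum₂ hε
  have r3 := analyticAt_of_differentiableOn_re_lt_one differentiableOn_rsum₃ hε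
  have g0 := analyticAt_Gamma_comp (g := fun z => z) (z := ε) (by fun_prop) h0
  have g1 := analyticAt_Gamma_comp (g := fun z => 1 - z) (z := ε) (by fun_prop) h4
  have g2 := analyticAt_Gamma_comp (g := fun z => -1 + z) (z := ε) (by fun_prop) h1
  have g3 := analyticAt_Gamma_comp (g := fun z => -1 + 2 * z) (z := ε) (by fun_prop) h2
  have g4 := analyticAt_Gamma_comp (g := fun z => -2 + 3 * z) (z := ε) (by fun_prop) h3
  have g5 := analyticAt_inv_Gamma_comp (g := fun z => 2 - z) (z := ε) (by fun_prop)
  have p1 : AnalyticAt ℂ (fun z : ℂ => (1 / 4 : ℂ) ^ (-1 + z)) ε :=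
    analyticAt_const.cpow (by fun_prop) (by norm_num [Complex.slitPlane])
  have p2 : AnalyticAt ℂ (fun z : ℂ => (1 / 4 : ℂ) ^ (-2 + 2 * z)) ε :=
    analyticAt_const.cpow (by fun_prop) (by norm_num [Complex.slitPlane])
  have e : AnalyticAt ℂ (fun z : ℂ => Complex.exp (3 * z * (Real.eulerMascheroniConstant : ℂ)) *
      (Real.sqrt Real.pi : ℂ)) ε := by fun_prop
  have half : AnalyticAt ℂ (fun _ : ℂ => (1 / 2 : ℂ)) ε := analyticAt_const
  exact e.mul ((((half.mul ((g1.pow 2).mul (g0.pow 3))).mul r1).add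
    ((((((g0.pow 2).mul g3).mul g1).mul g2).mul p1).mul r2)).add
    ((((half.mul ((((g0.pow 3).mul g3).mul g4).mul (g1.pow 2))).mul g5).mul p2).mul r3))

lemma ne_neg_natCast_of_re_pos {z : ℂ} (hz : 0 < z.re) (k : ℕ) : z ≠ -k := fun h => by
  have := congrArg Complex.re h
  simp at this
  linarith [(Nat.cast_nonneg k : (0:ℝ) ≤ k)]

lemma analyticAt_bananaSeries_of_strip {ε : ℂ} (h1 : 2 / 3 < ε.re) (h2 : ε.re < 1) :
    AnalyticAt ℂ bananaSeries ε := by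
  refine analyticAt_bananaSeries h2 (ne_neg_natCast_of_re_pos (by linarith)) (fun k h => ?_)
    (ne_neg_natCast_of_re_pos (by simp; linarith)) (ne_neg_natCast_of_re_pos (by simp; linarith))
  have h' := congrArg Complex.re h
  simp at h'
  rcases k.eq_zero_or_pos with rfl | hk
  · simp at h'; linarith
  · have : (1 : ℝ) ≤ k := by exact_mod_cast hk
    linarith

/-! ### The series representation on the real segment `2/3 < ε < 1` -/

lemma ofReal_tsum_mellinTerm {ν s b b' : ℝ} (h0 : 0 < s) (h1 : 0 < s - ν) (h2 : 0 < s - 2 * ν) :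
    ((∑' p, mellinTerm ν s b b' p : ℝ) : ℂ) = (mellinConst ν s : ℝ) *
      ∑' p : ℕ × ℕ, rterm s (s - ν : ℝ) (s - 2 * ν : ℝ) b' (s - ν + 1 / 2 : ℝ) b p.1 p.2 := by
  rw [Complex.ofReal_tsum, ← tsum_mul_left]
  exact tsum_congr fun p => ofReal_mellinTerm h0 h1 h2 p

lemma schwingerIntegral_eq_bananaSeries_ofReal {ε : ℝ} (h1 : 2 / 3 < ε) (h2 : ε < 1) :
    schwingerIntegral ε = bananaSeries ε := by
  have hS := integral_symanzik (ν := 1 - ε) (by linarith) (by linarith)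
  have t1 := ofReal_tsum_mellinTerm (ν := 1 - ε) (s := 1 + (1 - ε)) (b := 1 + (1 - ε))
    (b' := 1 + (1 - ε)) (by linarith) (by linarith) (by linarith)
  have t2 := ofReal_tsum_mellinTerm (ν := 1 - ε) (s := 1) (b := 1 + (1 - ε))
    (b' := 1 - (1 - ε)) (by linarith) (by linarith) (by linarith)
  have t3 := ofReal_tsum_mellinTerm (ν := 1 - ε) (s := 1 - (1 - ε)) (b := 1 - (1 - ε))
    (b' := 1 - (1 - ε)) (by linarith) (by linarith) (by linarith)
  have u1 : (∑' p : ℕ × ℕ, rterm ((1 + (1 - ε) : ℝ) : ℂ) (1 + (1 - ε) - (1 - ε) : ℝ)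
      (1 + (1 - ε) - 2 * (1 - ε) : ℝ) (1 + (1 - ε) : ℝ) (1 + (1 - ε) - (1 - ε) + 1 / 2 : ℝ)
      (1 + (1 - ε) : ℝ) p.1 p.2) = rsum₁ ε := by
    refine tsum_congr fun p => ?_
    congr 1 <;> push_cast <;> ring
  have u2 : (∑' p : ℕ × ℕ, rterm ((1 : ℝ) : ℂ) (1 - (1 - ε) : ℝ)
      (1 - 2 * (1 - ε) : ℝ) (1 - (1 - ε) : ℝ) (1 - (1 - ε) + 1 / 2 : ℝ)
      (1 + (1 - ε) : ℝ) p.1 p.2) = rsum₂ ε := by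
    refine tsum_congr fun p => ?_
    congr 1 <;> push_cast <;> ring
  have u3 : (∑' p : ℕ × ℕ, rterm ((1 - (1 - ε) : ℝ) : ℂ) (1 - (1 - ε) - (1 - ε) : ℝ)
      (1 - (1 - ε) - 2 * (1 - ε) : ℝ) (1 - (1 - ε) : ℝ) (1 - (1 - ε) - (1 - ε) + 1 / 2 : ℝ)
      (1 - (1 - ε) : ℝ) p.1 p.2) = rsum₃ ε := by
    refine tsum_congr fun p => ?_
    congr 1 <;> push_cast <;> ring
  rw [u1] at t1
  rw [u2] at t2
  rw [u3] at t3
  -- The values `s - ν = 1`, `ε` and `-1 + 2ε` turn `2^(1 - 2(s-ν))` into `1/2` times the powers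
  -- `0`, `-1 + ε` and `-2 + 2ε` of `1/4`.
  have m1 : mellinConst (1 - ε) (1 + (1 - ε)) =
      Real.sqrt Real.pi * (1 / 2) * (Real.Gamma (2 - ε) * Real.Gamma ε) := by
    rw [mellinConst, show 1 - 2 * (1 + (1 - ε) - (1 - ε)) = -1 by ring,
      show 1 + (1 - ε) - (1 - ε) = 1 by ring, show 1 + (1 - ε) - 2 * (1 - ε) = ε by ring,
      show 1 + (1 - ε) = 2 - ε by ring, Real.Gamma_one, Real.rpow_neg_one]
    ring
  have m2 : mellinConst (1 - ε) 1 =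
      Real.sqrt Real.pi * (1 / 2 * (1 / 4) ^ (-1 + ε)) *
        (Real.Gamma ε * Real.Gamma (-1 + 2 * ε)) := by
    rw [mellinConst, show 1 - (1 - ε) = ε by ring, show 1 - 2 * (1 - ε) = -1 + 2 * ε by ring,
      Real.Gamma_one, show (1 / 4 : ℝ) = 2 ^ (-2 : ℝ) by norm_num [Real.rpow_neg],
      ← Real.rpow_mul two_pos.le, show 1 - 2 * ε = -1 + -2 * (-1 + ε) by ring,
      Real.rpow_add two_pos, Real.rpow_neg_one]
    ring
  have m3 : mellinConst (1 - ε) (1 - (1 - ε)) =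
      Real.sqrt Real.pi * (1 / 2 * (1 / 4) ^ (-2 + 2 * ε)) *
        (Real.Gamma ε * Real.Gamma (-1 + 2 * ε) * Real.Gamma (-2 + 3 * ε)) := by
    rw [mellinConst, show 1 - (1 - ε) = ε by ring, show ε - 2 * (1 - ε) = -2 + 3 * ε by ring,
      show ε - (1 - ε) = -1 + 2 * ε by ring,
      show (1 / 4 : ℝ) = 2 ^ (-2 : ℝ) by norm_num [Real.rpow_neg],
      ← Real.rpow_mul two_pos.le, show 1 - 2 * (-1 + 2 * ε) = -1 + -2 * (-2 + 2 * ε) by ring,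
      Real.rpow_add two_pos, Real.rpow_neg_one]
    ring
  rw [m1] at t1
  rw [m2] at t2
  rw [m3] at t3
  have hS' := congrArg (fun x : ℝ => (x : ℂ)) hS
  simp only [Complex.ofReal_mul, Complex.ofReal_sub, Complex.ofReal_add, Complex.ofReal_pow,
    t1, t2, t3] at hS'
  rw [show -(1 + (1 - ε)) = ε - 2 by ring, show 1 + (1 - ε) = 2 - ε by ring,
    show 1 - (1 - ε) = ε by ring] at hS'
  rw [schwingerIntegral_ofReal, bananaSeries]
  have cG : ∀ (x : ℝ) (z : ℂ), z = x → Complex.Gamma z = (Real.Gamma x : ℂ) := fun x z h => by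
    rw [h, Complex.Gamma_ofReal]
  have cP : ∀ (x : ℝ) (z : ℂ), z = x → (1 / 4 : ℂ) ^ z = (((1 / 4 : ℝ) ^ x : ℝ) : ℂ) :=
    fun x z h => by
      rw [h, Complex.ofReal_cpow (by norm_num)]; push_cast; rfl
  rw [cG ε ε rfl, cG (1 - ε) (1 - ε) (by push_cast; rfl),
    cG (-1 + ε) (-1 + ε) (by push_cast; rfl), cG (-1 + 2 * ε) (-1 + 2 * ε) (by push_cast; rfl),
    cG (-2 + 3 * ε) (-2 + 3 * ε) (by push_cast; rfl), cG (2 - ε) (2 - ε) (by push_cast; rfl),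
    cP (-1 + ε) (-1 + ε) (by push_cast; rfl),
    cP (-2 + 2 * ε) (-2 + 2 * ε) (by push_cast; rfl), mul_assoc (Complex.exp _)]
  congr 1
  have g1 := Real.Gamma_pos_of_pos (show 0 < 2 - ε by linarith)
  -- The sign `-1` accounts for the negative cross term of the square, which appears with a plus
  -- sign in the series once `Γ(-1+ε)` is used.
  have hrefl : Real.Gamma (-1 + ε) * Real.Gamma (2 - ε) =
      -(Real.Gamma (1 - ε) * Real.Gamma ε) := by
    have e1 : Real.Gamma ε = (-1 + ε) * Real.Gamma (-1 + ε) := by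
      rw [← Real.Gamma_add_one (by linarith)]; congr 1; ring
    have e2 : Real.Gamma (2 - ε) = (1 - ε) * Real.Gamma (1 - ε) := by
      rw [← Real.Gamma_add_one (by linarith)]; congr 1; ring
    rw [e1, e2]; ring
  have hrefl' : (Real.Gamma (-1 + ε) : ℂ) * (Real.Gamma (2 - ε) : ℂ) =
      -((Real.Gamma (1 - ε) : ℂ) * (Real.Gamma ε : ℂ)) := by exact_mod_cast hrefl
  have g1' : (Real.Gamma (2 - ε) : ℂ) ≠ 0 := by exact_mod_cast g1.ne'
  apply mul_left_cancel₀ g1'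
  rw [hS']
  generalize (Real.Gamma (2 - ε) : ℂ) = G at *
  generalize (Real.Gamma (-1 + ε) : ℂ) = H at *
  generalize (Real.Gamma (1 - ε) : ℂ) = A at *
  generalize (Real.Gamma ε : ℂ) = B at *
  generalize (Real.Gamma (-1 + 2 * ε) : ℂ) = P at *
  generalize (((1 / 4 : ℝ) ^ (-1 + ε) : ℝ) : ℂ) = X at *
  push_cast
  field_simp
  linear_combination (-2 * A * B ^ 2 * P * X * rsum₂ ε) * hrefl'

end Banana

end
open scoped BigOperators

noncomputable section

namespace Banana

open MeasureTheory Set Filter Topology ProbabilityTheory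

/-! ### Analytic continuation -/

/-- A real segment accumulates at each of its interior points within `ℂ`, so agreement there is
enough for the identity theorem. -/
lemma eqOn_of_eq_ofReal {f g : ℂ → ℂ} {U : Set ℂ} {a b : ℝ} (hab : a < b)
    (hf : AnalyticOnNhd ℂ f U) (hg : AnalyticOnNhd ℂ g U) (hU : IsPreconnected U)
    (hab' : ∀ x : ℝ, a < x → x < b → (x : ℂ) ∈ U)
    (h : ∀ x : ℝ, a < x → x < b → f x = g x) : EqOn f g U := by
  obtain ⟨c, hac, hcb⟩ := exists_between hab
  refine hf.eqOn_of_preconnected_of_frequently_eq hg hU (hab' c hac hcb) ?_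
  have hev : ∀ᶠ x : ℝ in 𝓝[≠] c, f x = g x := by
    filter_upwards [nhdsWithin_le_nhds (Ioo_mem_nhds hac hcb)] with x hx using h x hx.1 hx.2
  have ht : Tendsto (fun x : ℝ => (x : ℂ)) (𝓝[≠] c) (𝓝[≠] (c : ℂ)) := by
    refine tendsto_nhdsWithin_iff.2
      ⟨(Complex.continuous_ofReal.tendsto c).mono_left nhdsWithin_le_nhds, ?_⟩
    filter_upwards [self_mem_nhdsWithin] with x hx
    simpa using hx
  exact ht.frequently hev.frequently

lemma isPreconnected_strip : IsPreconnected {z : ℂ | 2 / 3 < z.re ∧ z.re < 1} :=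
  ((convex_halfSpace_re_gt (2 / 3)).inter (convex_halfSpace_re_lt 1)).isPreconnected

lemma momentumIntegral_eq_schwingerIntegral {ε : ℂ} (h1 : 2 / 3 < ε.re) (h2 : ε.re < 1) :
    momentumIntegral ε = schwingerIntegral ε :=
  eqOn_of_eq_ofReal (a := 2 / 3) (b := 1) (by norm_num)
    (fun _ hz => analyticAt_momentumIntegral hz.1 hz.2)
    (fun _ hz => analyticAt_schwingerIntegral hz.1) isPreconnected_strip
    (fun x hx1 hx2 => by simpa using And.intro hx1 hx2)
    (fun _ hx1 hx2 => momentumIntegral_ofReal hx1 hx2) ⟨h1, h2⟩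

lemma schwingerIntegral_eq_bananaSeries {ε : ℂ} (h1 : 2 / 3 < ε.re) (h2 : ε.re < 1) :
    schwingerIntegral ε = bananaSeries ε :=
  eqOn_of_eq_ofReal (a := 2 / 3) (b := 1) (by norm_num)
    (fun _ hz => analyticAt_schwingerIntegral hz.1)
    (fun _ hz => analyticAt_bananaSeries_of_strip hz.1 hz.2) isPreconnected_strip
    (fun x hx1 hx2 => by simpa using And.intro hx1 hx2)
    (fun _ hx1 hx2 => schwingerIntegral_eq_bananaSeries_ofReal hx1 hx2) ⟨h1, h2⟩

/-- The Schwinger integral to the right of the line `Re ε = 5/6`, the double series elsewhere. -/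
def bananaFun (ε : ℂ) : ℂ := if 5 / 6 < ε.re then schwingerIntegral ε else bananaSeries ε

lemma bananaFun_eq_schwingerIntegral {ε : ℂ} (h : 2 / 3 < ε.re) :
    bananaFun ε = schwingerIntegral ε := by
  unfold bananaFun
  split_ifs with h'
  · rfl
  · exact (schwingerIntegral_eq_bananaSeries h (by linarith)).symm

lemma bananaFun_eq_bananaSeries {ε : ℂ} (h : ε.re < 1) : bananaFun ε = bananaSeries ε := by
  unfold bananaFun
  split_ifs with h'
  · exact schwingerIntegral_eq_bananaSeries (by linarith) h
  · rfl

lemma bananaFun_eventuallyEq_schwingerIntegral {ε : ℂ} (h : 2 / 3 < ε.re) :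
    bananaFun =ᶠ[𝓝 ε] schwingerIntegral := by
  filter_upwards [(isOpen_lt continuous_const Complex.continuous_re).mem_nhds h] with z hz
    using bananaFun_eq_schwingerIntegral hz

lemma bananaFun_eventuallyEq_bananaSeries {ε : ℂ} (h : ε.re < 1) :
    bananaFun =ᶠ[𝓝 ε] bananaSeries := by
  filter_upwards [isOpen_re_lt_one.mem_nhds h] with z hz using bananaFun_eq_bananaSeries hz

lemma meromorphicOn_bananaFun : MeromorphicOn bananaFun univ := by
  intro ε _
  rcases lt_or_ge ε.re 1 with h | h
  · exact (meromorphicAt_bananaSeries h).congr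
      ((bananaFun_eventuallyEq_bananaSeries h).symm.filter_mono nhdsWithin_le_nhds)
  · have h' : 2 / 3 < ε.re := by linarith
    exact (analyticAt_schwingerIntegral h').meromorphicAt.congr
      ((bananaFun_eventuallyEq_schwingerIntegral h').symm.filter_mono nhdsWithin_le_nhds)

/-- The dimensionally regularised banana integral. -/
def bananaIntegral : ℂ → ℂ := toMeromorphicNFOn bananaFun univ

/-- Passing to normal form changes values only where the function is not already in normal form, and
an analytic point is. -/
lemma bananaIntegral_eq_of_analyticAt {ε : ℂ} (h : AnalyticAt ℂ bananaFun ε) :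
    bananaIntegral ε = bananaFun ε := by
  rw [bananaIntegral, toMeromorphicNFOn_eq_toMeromorphicNFAt meromorphicOn_bananaFun (mem_univ _),
    toMeromorphicNFAt_eq_self.2 h.meromorphicNFAt]

lemma isDimRegIntegral_bananaIntegral : IsDimRegIntegral bananaIntegral := by
  refine ⟨meromorphicNFOn_toMeromorphicNFOn _ _, fun ε h1 h2 => ?_⟩
  rw [bananaIntegral_eq_of_analyticAt
    ((analyticAt_schwingerIntegral h1).congr (bananaFun_eventuallyEq_schwingerIntegral h1).symm),
    bananaFun_eq_schwingerIntegral h1, momentumIntegral_eq_schwingerIntegral h1 h2]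

/-- Infinite order of `f - g` at one point spreads over the connected plane, so `f` and `g` agree on
every punctured neighbourhood. Normal form then fixes the values at the centres, poles included. -/
lemma eq_of_meromorphicNFOn_of_eventuallyEq {f g : ℂ → ℂ} (hf : MeromorphicNFOn f univ)
    (hg : MeromorphicNFOn g univ) {z₀ : ℂ} (h : f =ᶠ[𝓝 z₀] g) : f = g := by
  have hfg : MeromorphicOn (f - g) univ := hf.meromorphicOn.sub hg.meromorphicOn
  have htop : meromorphicOrderAt (f - g) z₀ = ⊤ := by
    rw [meromorphicOrderAt_eq_top_iff]
    filter_upwards [h.filter_mono nhdsWithin_le_nhds] with z hz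
    simp [hz]
  funext z
  have hz : meromorphicOrderAt (f - g) z = ⊤ := by
    by_contra hne
    exact hfg.meromorphicOrderAt_ne_top_of_isPreconnected isPreconnected_univ (mem_univ z)
      (mem_univ z₀) hne htop
  rw [meromorphicOrderAt_eq_top_iff] at hz
  have hev : f =ᶠ[𝓝[≠] z] g := by
    filter_upwards [hz] with w hw
    exact sub_eq_zero.1 hw
  exact (((hf (mem_univ z)).eventuallyEq_nhdsNE_iff_eventuallyEq_nhds
    (hg (mem_univ z))).1 hev).eq_of_nhds

lemma IsDimRegIntegral.eq {I J : ℂ → ℂ} (hI : IsDimRegIntegral I) (hJ : IsDimRegIntegral J) :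
    I = J := by
  refine eq_of_meromorphicNFOn_of_eventuallyEq hI.1 hJ.1 (z₀ := ((5 / 6 : ℝ) : ℂ)) ?_
  have h1 : IsOpen {z : ℂ | 2 / 3 < z.re} := isOpen_lt continuous_const Complex.continuous_re
  filter_upwards [h1.mem_nhds (show 2 / 3 < (((5 / 6 : ℝ) : ℂ)).re by
    rw [Complex.ofReal_re]; norm_num), isOpen_re_lt_one.mem_nhds
    (show (((5 / 6 : ℝ) : ℂ)).re < 1 by rw [Complex.ofReal_re]; norm_num)] with z hz1 hz2
  rw [hI.2 z hz1 hz2, hJ.2 z hz1 hz2]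

lemma tsum_tsum_term_eq {a b c d e f : ℂ} (hd : ∀ k : ℕ, d ≠ -k) (he : ∀ k : ℕ, e ≠ -k)
    (hf : ∀ k : ℕ, f ≠ -k) (h : (a + b + c - d - e - f).re < -(1 / 2)) :
    ∑' m : ℕ, ∑' n : ℕ, term a b c d e f m n =
      Complex.Gamma d * Complex.Gamma e * Complex.Gamma f *
        ∑' p : ℕ × ℕ, rterm a b c d e f p.1 p.2 := by
  rw [← (summable_term hd he hf h).tsum_prod, ← tsum_mul_left]
  exact tsum_congr fun p => term_eq_rterm a b c hd he hf p.1 p.2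

end Banana

end

/-! ### The main theorem: assembling convergence, uniqueness and the formula -/

theorem mainTheorem2 :
    (∀ ε : ℂ, 2 / 3 < ε.re → ε.re < 1 →
      MeasureTheory.IntegrableOn (Banana.dimRegIntegrand (4 - 2 * ε) Banana.propagators)
        Banana.frameDomain) ∧
    (∃! I : ℂ → ℂ, Banana.IsDimRegIntegral I) ∧
    ∀ I : ℂ → ℂ, Banana.IsDimRegIntegral I →
      ∀ ε : ℂ, ε.re < 1 →
        (∀ k : ℕ, 2 * ε - 1 ≠ -(k : ℂ) ∧ 3 * ε - 2 ≠ -(k : ℂ) ∧ 2 * ε - 1 / 2 ≠ -(k : ℂ)) →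
        Summable (fun p : ℕ × ℕ =>
          Banana.term (2 - ε) 1 ε (2 - ε) (3 / 2) (2 - ε) p.1 p.2) ∧
        Summable (fun p : ℕ × ℕ =>
          Banana.term 1 ε (-1 + 2 * ε) ε (1 / 2 + ε) (2 - ε) p.1 p.2) ∧
        Summable (fun p : ℕ × ℕ =>
          Banana.term ε (-1 + 2 * ε) (-2 + 3 * ε) ε (-1 / 2 + 2 * ε) ε p.1 p.2) ∧
        I ε =
          (Real.sqrt Real.pi : ℂ) *
              Complex.exp (3 * (Real.eulerMascheroniConstant : ℂ) * ε) *
              Complex.Gamma (-1 + ε) ^ 2 * Complex.Gamma ε /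
              (2 * Complex.Gamma (3 / 2)) *
            (∑' m : ℕ, ∑' n : ℕ,
              Banana.term (2 - ε) 1 ε (2 - ε) (3 / 2) (2 - ε) m n) +
          (Real.sqrt Real.pi : ℂ) *
              Complex.exp (3 * (Real.eulerMascheroniConstant : ℂ) * ε) *
              Complex.Gamma ε * Complex.Gamma (-1 + 2 * ε) * Complex.Gamma (1 - ε) *
              Complex.Gamma (-1 + ε) /
              (Complex.Gamma (2 - ε) * Complex.Gamma (1 / 2 + ε)) *
            (1 / 4 : ℂ) ^ (-1 + ε) *
            (∑' m : ℕ, ∑' n : ℕ,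
              Banana.term 1 ε (-1 + 2 * ε) ε (1 / 2 + ε) (2 - ε) m n) +
          (Real.sqrt Real.pi : ℂ) *
              Complex.exp (3 * (Real.eulerMascheroniConstant : ℂ) * ε) *
              Complex.Gamma ε * Complex.Gamma (-1 + 2 * ε) * Complex.Gamma (-2 + 3 * ε) *
              Complex.Gamma (1 - ε) ^ 2 /
              (2 * Complex.Gamma (2 - ε) * Complex.Gamma (-1 / 2 + 2 * ε)) *
            (1 / 4 : ℂ) ^ (-2 + 2 * ε) *
            (∑' m : ℕ, ∑' n : ℕ,
              Banana.term ε (-1 + 2 * ε) (-2 + 3 * ε) ε (-1 / 2 + 2 * ε) ε m n) := by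
  refine ⟨fun ε h1 h2 => Banana.integrableOn_dimRegIntegrand (by simp; linarith)
    (by simp; linarith), ⟨Banana.bananaIntegral, Banana.isDimRegIntegral_bananaIntegral,
    fun J hJ => hJ.eq Banana.isDimRegIntegral_bananaIntegral⟩, fun I hI ε hε hk => ?_⟩
  have h2 : ∀ k : ℕ, -1 + 2 * ε ≠ -k := fun k h => (hk k).1 (by rw [← h]; ring)
  have h3 : ∀ k : ℕ, -2 + 3 * ε ≠ -k := fun k h => (hk k).2.1 (by rw [← h]; ring)
  have h4 : ∀ k : ℕ, -1 / 2 + 2 * ε ≠ -k := fun k h => (hk k).2.2 (by rw [← h]; ring)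
  -- The condition on `2ε - 1` alone covers several Gamma functions: its odd negative values exclude
  -- the poles of `Γ(ε)`, its even negative values those of `Γ(1/2 + ε)`. The extra pole `ε = 1` of
  -- `Γ(-1+ε)` is excluded by `Re ε < 1`.
  have h0 : ∀ k : ℕ, ε ≠ -k := fun k h => h2 (2 * k + 1) (by rw [h]; push_cast; ring)
  have h5 : ∀ k : ℕ, 1 / 2 + ε ≠ -k := fun k h => h2 (2 * k + 2) (by
    rw [show ε = -k - 1 / 2 by rw [← h]; ring]; push_cast; ring)
  have h1 : ∀ k : ℕ, -1 + ε ≠ -k := by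
    rintro (_ | k) h
    · have : ε = 1 := by linear_combination h
      simp [this] at hε
    · exact h0 k (by push_cast at h; linear_combination h)
  have h6 : ∀ k : ℕ, 2 - ε ≠ -k := Banana.ne_neg_natCast_of_re_pos (by simp; linarith)
  have h7 : ∀ k : ℕ, (3 / 2 : ℂ) ≠ -k := Banana.ne_neg_natCast_of_re_pos (by norm_num)
  have s1 : ((2 - ε) + 1 + ε - (2 - ε) - 3 / 2 - (2 - ε)).re < -(1 / 2) := by
    rw [show (2 - ε) + 1 + ε - (2 - ε) - 3 / 2 - (2 - ε) = 2 * ε - ((5 / 2 : ℝ) : ℂ) by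
      push_cast; ring]
    simp; linarith
  have s2 : (1 + ε + (-1 + 2 * ε) - ε - (1 / 2 + ε) - (2 - ε)).re < -(1 / 2) := by
    rw [show 1 + ε + (-1 + 2 * ε) - ε - (1 / 2 + ε) - (2 - ε) = 2 * ε - ((5 / 2 : ℝ) : ℂ) by
      push_cast; ring]
    simp; linarith
  have s3 : (ε + (-1 + 2 * ε) + (-2 + 3 * ε) - ε - (-1 / 2 + 2 * ε) - ε).re < -(1 / 2) := by
    rw [show ε + (-1 + 2 * ε) + (-2 + 3 * ε) - ε - (-1 / 2 + 2 * ε) - ε =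
      2 * ε - ((5 / 2 : ℝ) : ℂ) by push_cast; ring]
    simp; linarith
  refine ⟨Banana.summable_term h6 h7 h6 s1, Banana.summable_term h0 h5 h6 s2,
    Banana.summable_term h0 h4 h0 s3, ?_⟩
  rw [Banana.tsum_tsum_term_eq h6 h7 h6 s1, Banana.tsum_tsum_term_eq h0 h5 h6 s2,
    Banana.tsum_tsum_term_eq h0 h4 h0 s3, hI.eq Banana.isDimRegIntegral_bananaIntegral,
    Banana.bananaIntegral_eq_of_analyticAt ((Banana.analyticAt_bananaSeries hε h0 h1 h2 h3).congr
      (Banana.bananaFun_eventuallyEq_bananaSeries hε).symm),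
    Banana.bananaFun_eq_bananaSeries hε, Banana.bananaSeries, ← Banana.rsum₁, ← Banana.rsum₂,
    ← Banana.rsum₃, mul_right_comm (3 : ℂ) ε]
  have hrefl : Complex.Gamma (-1 + ε) * Complex.Gamma (2 - ε) =
      -(Complex.Gamma (1 - ε) * Complex.Gamma ε) := by
    have e1 : Complex.Gamma ε = (-1 + ε) * Complex.Gamma (-1 + ε) := by
      rw [← Complex.Gamma_add_one _ (by simpa using h1 0)]; congr 1; ring
    have e2 : Complex.Gamma (2 - ε) = (1 - ε) * Complex.Gamma (1 - ε) := by
      rw [← Complex.Gamma_add_one]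
      · congr 1; ring
      · intro h; simp [← sub_eq_zero.1 h] at hε
    rw [e1, e2]; ring
  have g1 := Complex.Gamma_ne_zero h6
  have g2 := Complex.Gamma_ne_zero h7
  have g3 := Complex.Gamma_ne_zero h5
  have g4 := Complex.Gamma_ne_zero h4
  have hrefl2 : Complex.Gamma (-1 + ε) ^ 2 * Complex.Gamma (2 - ε) ^ 2 =
      Complex.Gamma (1 - ε) ^ 2 * Complex.Gamma ε ^ 2 := by
    rw [← mul_pow, hrefl]; ring
  generalize Complex.Gamma (2 - ε) = G at *
  generalize Complex.Gamma (-1 + ε) = H at *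
  generalize Complex.Gamma (1 - ε) = A at *
  generalize Complex.Gamma (3 / 2) = t at *
  generalize Complex.Gamma (1 / 2 + ε) = u at *
  generalize Complex.Gamma (-1 / 2 + 2 * ε) = v at *
  generalize Complex.exp _ = E at *
  generalize Complex.Gamma ε = B at *
  -- The first summand is treated apart because it needs the squared relation `hrefl2` to exchange
  -- `Γ(-1+ε)² Γ(2-ε)²` for `Γ(1-ε)² Γ(ε)²`; in the others the Gamma factors cancel directly.
  have a1 : ∀ R : ℂ, (Real.sqrt Real.pi : ℂ) * E * H ^ 2 * B / (2 * t) * (G * t * G * R) =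
      E * (Real.sqrt Real.pi : ℂ) * (1 / 2 * (A ^ 2 * B ^ 3) * R) := fun R => by
    field_simp
    linear_combination (E * R * B) * hrefl2
  rw [a1]
  field_simp
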